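/- Metric spaces may take the value $\infty$ as a distance. A *length space* is a metric space $(M,d)$ such that for all $x,y\in M$ with $d(x,y)<\infty$ and every $\varepsilon>0$ there is a path from $x$ to $y$ of length at most $d(x,y)+\varepsilon$. Every graph is regarded as a length space in which each edge is an arc of length one. For sets of points $A,B$ of a length space $M$, $\mathrm{dist}_M(A,B)$ is the infimum of the lengths of the paths in $M$ with one end-point in $A$ and the other in $B$. For a real $K>0$, a *$K$-fat minor model* of a graph $H$ in a length space $M$ consists of non-empty path-connected sets $B_v\subseteq M$ $(v\in V(H))$ and $P_e\subseteq M$ $(e\in E(H))$ such that $B_v\cap P_e\neq\emptyset$ whenever $v$ is an end of $e$, and any two of these sets (with distinct indices) not covered by this condition are at distance at least $K$ in $M$. If such a model exists, $H$ is a *$K$-fat minor* of $M$. For a positive integer $q$, $X$ is *$q$-quasi-isometric* to $Y$ if there is a map $\phi\colon X\to Y$ such that $q^{-1}d_X(x,y)-q\le d_Y(\phi(x),\phi(y))\le q\,d_X(x,y)+q$ for all $x,y\in X$, and every point of $Y$ is at distance at most $q$ from some $\phi(x)$, $x\in X$. **Theorem.** There exists a finite graph $H$ such that, for every integer $q\ge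 1$, there is a graph $G_q$ that does not contain $H$ as a $3$-fat minor and is not $q$-quasi-isometric to any length space with no $(2^{-13q^2})$-fat $H$ minor. -/

import Mathlib

open scoped ENNReal

/-! ### Length spaces, distances between sets, fat minors, quasi-isometries

Metric spaces are allowed to take the value `∞` as a distance (`EMetricSpace`). -/

/-- The length of a path in an extended metric space: the supremum of the lengths of its inscribed
polygons. -/
noncomputable def pathLength {X : Type*} [EMetricSpace X] {x y : X} (γ : Path x y) : ℝ≥0∞ :=
  eVariationOn γ Set.univ

/-- A length space: points at finite distance are joined by paths whose length exceeds their
distance by arbitrarily little. -/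
def IsLengthSpace (X : Type*) [EMetricSpace X] : Prop :=
  ∀ x y : X, edist x y ≠ ∞ → ∀ ε : ℝ≥0∞, 0 < ε → ∃ γ : Path x y, pathLength γ ≤ edist x y + ε

/-- The distance between two sets of points: the infimum of the lengths of the paths with one
end-point in `A` and the other in `B`. -/
noncomputable def setDist {X : Type*} [EMetricSpace X] (A B : Set X) : ℝ≥0∞ :=
  ⨅ (x ∈ A) (y ∈ B) (γ : Path x y), pathLength γ

/-- A `K`-fat minor model of the graph `H` in the space `X`: a branch set `B v` for each vertex `v`
of `H` and a set `P e` for each edge `e` of `H`. -/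
structure FatMinorModel {W : Type*} (H : SimpleGraph W) (K : ℝ) (X : Type*) [EMetricSpace X] where
  B : W → Set X
  P : H.edgeSet → Set X
  isPathConnected_B : ∀ v, IsPathConnected (B v)
  isPathConnected_P : ∀ e, IsPathConnected (P e)
  inter_nonempty : ∀ v e, v ∈ e.1 → (B v ∩ P e).Nonempty
  le_setDist_B_B : ∀ v w, v ≠ w → ENNReal.ofReal K ≤ setDist (B v) (B w)
  le_setDist_P_P : ∀ e f, e ≠ f → ENNReal.ofReal K ≤ setDist (P e) (P f)
  le_setDist_B_P : ∀ v e, v ∉ e.1 → ENNReal.ofReal K ≤ setDist (B v) (P e)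

/-- `H` is a `K`-fat minor of the space `X`. -/
def HasFatMinor {W : Type*} (H : SimpleGraph W) (K : ℝ) (X : Type*) [EMetricSpace X] : Prop :=
  Nonempty (FatMinorModel H K X)

/-- `φ` is a `q`-quasi-isometry of `X` into `Y`. (The subtraction is truncated at `0`, which does
not affect the inequality.) -/
def IsQuasiIsometry {X Y : Type*} [EMetricSpace X] [EMetricSpace Y] (q : ℕ) (φ : X → Y) : Prop :=
  (∀ x y : X, (q : ℝ≥0∞)⁻¹ * edist x y - q ≤ edist (φ x) (φ y) ∧
    edist (φ x) (φ y) ≤ q * edist x y + q) ∧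
  ∀ z : Y, ∃ x : X, edist z (φ x) ≤ q

/-- `X` is `q`-quasi-isometric to `Y`. -/
def QuasiIsometric (q : ℕ) (X Y : Type*) [EMetricSpace X] [EMetricSpace Y] : Prop :=
  ∃ φ : X → Y, IsQuasiIsometry q φ

/-! ### Graphs as length spaces

The points of a graph are those of its geometric realization, in barycentric coordinates: the
vertex `u` is the indicator function of `u`, and an edge `uv` is the segment between its ends.
Every edge has length one, and the distance is that of the path metric. -/

/-- The function `c` lies on the closed edge with ends `u` and `v`, or is the vertex `u = v`. -/
def SimpleGraph.OnEdge {V : Type*} (G : SimpleGraph V) (c : V → ℝ) (u v : V) : Prop :=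
  (u = v ∨ G.Adj u v) ∧
    c ∈ segment ℝ (Set.indicator {u} (fun _ => (1 : ℝ))) (Set.indicator {v} (fun _ => (1 : ℝ)))

/-- A point of the graph `G`, in barycentric coordinates. -/
@[ext]
structure GraphSpace {V : Type*} (G : SimpleGraph V) where
  coord : V → ℝ
  exists_onEdge : ∃ u v, G.OnEdge coord u v

namespace GraphSpace

variable {V : Type*} {G : SimpleGraph V}

/-- The length of the segment between `p` and `q` inside a common closed edge (`∞` if there is no
such edge). -/
noncomputable def localDist (p q : GraphSpace G) : ℝ≥0∞ :=
  ⨅ (u : V) (v : V) (_ : G.OnEdge p.coord u v) (_ : G.OnEdge q.coord u v),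
    ENNReal.ofReal |p.coord u - q.coord u|

/-- The length of a shortest walk from `p` to `q` through vertices: from `p` along its edge to an
end `a`, then through the graph from `a` to a vertex `b`, then along the edge of `q` to `q`. (If
`p.coord a ≠ 0`, then `a` is an end of the edge of `p`, at distance `1 - p.coord a` from `p`.) -/
noncomputable def vertexDist (p q : GraphSpace G) : ℝ≥0∞ :=
  ⨅ (a : V) (b : V) (_ : p.coord a ≠ 0) (_ : q.coord b ≠ 0),
    ENNReal.ofReal (1 - p.coord a) + (G.edist a b : ℝ≥0∞) + ENNReal.ofReal (1 - q.coord b)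

/-- The path metric of the graph `G` with all edges of length one. -/
noncomputable instance : EDist (GraphSpace G) where
  edist p q := min (localDist p q) (vertexDist p q)

theorem onEdge_data {c : V → ℝ} {u v : V} (h : G.OnEdge c u v) :
    0 ≤ c u ∧ 0 ≤ c v ∧ (u = v → c u = 1) ∧ (u ≠ v → c u + c v = 1 ∧ G.Adj u v) ∧
      ∀ w, w ≠ u → w ≠ v → c w = 0 := by
  obtain ⟨h, a, b, ha, hb, hab, rfl⟩ := h
  by_cases huv : u = v
  · subst huv
    simp +contextual [hab, Set.indicator]
  · have hvu : v ≠ u := fun h => huv h.symm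
    have := h.resolve_left huv
    simp +contextual [hab, Set.indicator, huv, hvu, ha, hb, this]

theorem edist_le_local {p q : GraphSpace G} {u v : V} (hp : G.OnEdge p.coord u v)
    (hq : G.OnEdge q.coord u v) : edist p q ≤ ENNReal.ofReal |p.coord u - q.coord u| :=
  (min_le_left _ _).trans
    (iInf_le_of_le u (iInf_le_of_le v (iInf_le_of_le hp (iInf_le_of_le hq le_rfl))))

theorem edist_le_vertex {p q : GraphSpace G} {a b : V} (hp : p.coord a ≠ 0)
    (hq : q.coord b ≠ 0) : edist p q ≤
      ENNReal.ofReal (1 - p.coord a) + (G.edist a b : ℝ≥0∞) + ENNReal.ofReal (1 - q.coord b) :=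
  (min_le_right _ _).trans
    (iInf_le_of_le a (iInf_le_of_le b (iInf_le_of_le hp (iInf_le_of_le hq le_rfl))))

theorem le_edist_add {p q : GraphSpace G} {c s : ℝ≥0∞}
    (h₁ : ∀ u v, G.OnEdge p.coord u v → G.OnEdge q.coord u v →
      c ≤ ENNReal.ofReal |p.coord u - q.coord u| + s)
    (h₂ : ∀ a b, p.coord a ≠ 0 → q.coord b ≠ 0 →
      c ≤ ENNReal.ofReal (1 - p.coord a) + (G.edist a b : ℝ≥0∞) +
        ENNReal.ofReal (1 - q.coord b) + s) :
    c ≤ edist p q + s := by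
  rw [← tsub_le_iff_right]
  refine le_min ?_ ?_
  · refine le_iInf fun u => le_iInf fun v => le_iInf fun hp => le_iInf fun hq => ?_
    rw [tsub_le_iff_right]
    exact h₁ u v hp hq
  · refine le_iInf fun u => le_iInf fun v => le_iInf fun hp => le_iInf fun hq => ?_
    rw [tsub_le_iff_right]
    exact h₂ u v hp hq

theorem coord_mem (p : GraphSpace G) (a : V) : 0 ≤ p.coord a ∧ p.coord a ≤ 1 := by
  obtain ⟨u, v, h⟩ := p.exists_onEdge
  have := onEdge_data h
  by_cases h1 : a = u <;> by_cases h2 : a = v <;> grind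

theorem coord_eq_zero {p : GraphSpace G} {a w : V} (hp : p.coord a = 1) (hw : w ≠ a) :
    p.coord w = 0 := by
  obtain ⟨u, v, h⟩ := p.exists_onEdge
  obtain ⟨hu, hv, h1, h2, h3⟩ := onEdge_data h
  by_cases huv : u = v
  · subst huv
    have hau : a = u := by
      by_contra hau
      simp [h3 a hau hau] at hp
    exact h3 w (hau ▸ hw) (hau ▸ hw)
  · have h4 := (h2 huv).1
    by_cases hau : a = u
    · subst hau
      by_cases hwv : w = v
      · subst hwv
        linarith
      · exact h3 w hw hwv
    · by_cases hav : a = v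
      · subst hav
        by_cases hwu : w = u
        · subst hwu
          linarith
        · exact h3 w hwu hw
      · simp [h3 a hau hav] at hp

theorem eq_of_coord_eq_one {p q : GraphSpace G} {a : V} (hp : p.coord a = 1)
    (hq : q.coord a = 1) : p = q := by
  ext w
  by_cases hw : w = a
  · rw [hw, hp, hq]
  · rw [coord_eq_zero hp hw, coord_eq_zero hq hw]

theorem edist_comm' (p q : GraphSpace G) : edist p q = edist q p := by
  have key : ∀ p q : GraphSpace G, edist p q ≤ edist q p := by
    intro p q
    rw [← add_zero (edist q p)]
    refine le_edist_add (fun u v hp hq => ?_) (fun a b hp hq => ?_)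
    · rw [add_zero, abs_sub_comm]
      exact edist_le_local hq hp
    · rw [add_zero]
      refine (edist_le_vertex hq hp).trans (le_of_eq ?_)
      rw [SimpleGraph.edist_comm]
      ring
  exact le_antisymm (key p q) (key q p)

theorem toENNReal_edist_le_one {a b : V} (h : G.Adj a b) : (G.edist a b : ℝ≥0∞) ≤ 1 := by
  rw [SimpleGraph.edist_eq_one_iff_adj.2 h]
  simp

theorem toENNReal_edist_triangle (a b c : V) :
    (G.edist a c : ℝ≥0∞) ≤ (G.edist a b : ℝ≥0∞) + (G.edist b c : ℝ≥0∞) := by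
  rw [← ENat.toENNReal_add]
  exact ENat.toENNReal_le.2 G.edist_triangle

theorem onEdge_symm {c : V → ℝ} {u v : V} (h : G.OnEdge c u v) : G.OnEdge c v u :=
  ⟨h.1.imp Eq.symm SimpleGraph.Adj.symm, by rw [segment_symm]; exact h.2⟩

theorem exists_end {p q : GraphSpace G} {u v b : V} (hp : G.OnEdge p.coord u v)
    (hq : G.OnEdge q.coord u v) (hb : q.coord b ≠ 0) :
    ∃ a, p.coord a ≠ 0 ∧ ENNReal.ofReal (1 - p.coord a) + (G.edist a b : ℝ≥0∞) ≤
      ENNReal.ofReal |p.coord u - q.coord u| + ENNReal.ofReal (1 - q.coord b) := by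
  have dp := onEdge_data hp
  have dq := onEdge_data hq
  have hq1 := q.coord_mem b
  have hbuv : b = u ∨ b = v := by grind
  by_cases h : p.coord b = 0
  · have huv : u ≠ v := by grind
    have hadj := (dp.2.2.2.1 huv).2
    have hs : ∀ a, p.coord a = 1 → G.Adj a b → |p.coord u - q.coord u| = q.coord b →
        ∃ a, p.coord a ≠ 0 ∧ ENNReal.ofReal (1 - p.coord a) + (G.edist a b : ℝ≥0∞) ≤
      ENNReal.ofReal |p.coord u - q.coord u| + ENNReal.ofReal (1 - q.coord b) := by
      intro a ha hab hd
      refine ⟨a, by simp [ha], ?_⟩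
      rw [hd, ← ENNReal.ofReal_add hq1.1 (by linarith), ha]
      simpa using toENNReal_edist_le_one hab
    rcases hbuv with rfl | rfl
    · refine hs v (by grind) hadj.symm ?_
      rw [h, zero_sub, abs_neg, abs_of_nonneg hq1.1]
    · refine hs u (by grind) hadj ?_
      have h1 : p.coord u = 1 := by grind
      have h2 : q.coord b = 1 - q.coord u := by grind
      rw [h1, h2, abs_of_nonneg (by linarith)]
  · refine ⟨b, h, ?_⟩
    rw [← ENNReal.ofReal_add (abs_nonneg _) (by linarith)]
    simp only [SimpleGraph.edist_self, ENat.toENNReal_zero, add_zero]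
    apply ENNReal.ofReal_le_ofReal
    have : |p.coord u - q.coord u| = |p.coord b - q.coord b| := by
      rcases hbuv with rfl | rfl
      · rfl
      · by_cases huv : u = b
        · rw [huv]
        · rw [← abs_neg]
          congr 1
          grind
    rw [this]
    have := neg_abs_le (p.coord b - q.coord b)
    linarith

theorem edist_triangle' (p q r : GraphSpace G) : edist p r ≤ edist p q + edist q r := by
  have hLN : ∀ p q r : GraphSpace G, ∀ u v, G.OnEdge p.coord u v → G.OnEdge q.coord u v →
      ∀ b c, q.coord b ≠ 0 → r.coord c ≠ 0 → edist p r ≤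
        ENNReal.ofReal |p.coord u - q.coord u| + (ENNReal.ofReal (1 - q.coord b) +
          (G.edist b c : ℝ≥0∞) + ENNReal.ofReal (1 - r.coord c)) := by
    intro p q r u v hp hq b c hb hc
    obtain ⟨a, ha, hab⟩ := exists_end hp hq hb
    calc edist p r ≤ _ := edist_le_vertex ha hc
      _ ≤ ENNReal.ofReal (1 - p.coord a) + ((G.edist a b : ℝ≥0∞) + (G.edist b c : ℝ≥0∞)) +
          ENNReal.ofReal (1 - r.coord c) := by
        gcongr
        exact toENNReal_edist_triangle a b c
      _ = (ENNReal.ofReal (1 - p.coord a) + (G.edist a b : ℝ≥0∞)) + (G.edist b c : ℝ≥0∞) +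
          ENNReal.ofReal (1 - r.coord c) := by ring
      _ ≤ (ENNReal.ofReal |p.coord u - q.coord u| + ENNReal.ofReal (1 - q.coord b)) +
          (G.edist b c : ℝ≥0∞) + ENNReal.ofReal (1 - r.coord c) := by gcongr
      _ = _ := by ring
  refine le_edist_add (fun u v hp hq => ?_) (fun a b ha hb => ?_)
  · rw [add_comm]
    refine le_edist_add (fun u' v' hq' hr => ?_) (fun b c hb hc => ?_)
    · by_cases hw : ∃ w, q.coord w = 1
      · obtain ⟨w, hw⟩ := hw
        obtain ⟨c, hc, hcw⟩ := exists_end hr hq' (b := w) (by simp [hw])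
        refine (hLN p q r u v hp hq w c (by simp [hw]) hc).trans ?_
        rw [add_comm, abs_sub_comm (q.coord u')]
        gcongr
        simp only [hw, sub_self, ENNReal.ofReal_zero, zero_add, add_zero] at hcw ⊢
        rwa [SimpleGraph.edist_comm, add_comm]
      · have d1 := onEdge_data hq
        have d2 := onEdge_data hq'
        have d3 := onEdge_data hr
        have huv : (u = u' ∧ v = v') ∨ (u = v' ∧ v = u') := by grind
        have hr' : G.OnEdge r.coord u v := by
          rcases huv with ⟨rfl, rfl⟩ | ⟨rfl, rfl⟩
          · exact hr
          · exact onEdge_symm hr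
        have he : |q.coord u' - r.coord u'| = |q.coord u - r.coord u| := by
          rcases huv with ⟨rfl, rfl⟩ | ⟨rfl, rfl⟩
          · rfl
          · have huv : u ≠ v := by grind
            rw [← abs_neg]
            congr 1
            grind
        refine (edist_le_local hp hr').trans ?_
        rw [he, ← ENNReal.ofReal_add (abs_nonneg _) (abs_nonneg _), add_comm]
        exact ENNReal.ofReal_le_ofReal (abs_sub_le _ _ _)
    · rw [add_comm]
      exact hLN p q r u v hp hq b c hb hc
  · rw [add_comm]
    refine le_edist_add (fun u v hq hr => ?_) (fun b' c hb' hc => ?_)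
    · rw [edist_comm' p r, abs_sub_comm]
      refine (hLN r q p u v hr hq b a hb ha).trans (le_of_eq ?_)
      rw [SimpleGraph.edist_comm]
      ring
    · have hq := q.coord_mem b
      have hq' := q.coord_mem b'
      have hbb : (G.edist b b' : ℝ≥0∞) ≤
          ENNReal.ofReal (1 - q.coord b) + ENNReal.ofReal (1 - q.coord b') := by
        by_cases h : b = b'
        · simp [h]
        · obtain ⟨u, v, huv⟩ := q.exists_onEdge
          have d := onEdge_data huv
          have hadj : G.Adj b b' ∧ q.coord b + q.coord b' = 1 := by
            have h3 : (b = u ∧ b' = v) ∨ (b = v ∧ b' = u) := by grind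
            rcases h3 with ⟨rfl, rfl⟩ | ⟨rfl, rfl⟩
            · exact ⟨(d.2.2.2.1 h).2, (d.2.2.2.1 h).1⟩
            · have := d.2.2.2.1 (Ne.symm h)
              exact ⟨this.2.symm, by linarith⟩
          rw [← ENNReal.ofReal_add (by linarith) (by linarith)]
          refine (toENNReal_edist_le_one hadj.1).trans ?_
          rw [ENNReal.one_le_ofReal]
          linarith
      calc edist p r ≤ _ := edist_le_vertex ha hc
        _ ≤ ENNReal.ofReal (1 - p.coord a) + ((G.edist a b : ℝ≥0∞) +
            ((ENNReal.ofReal (1 - q.coord b) + ENNReal.ofReal (1 - q.coord b')) +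
              (G.edist b' c : ℝ≥0∞))) + ENNReal.ofReal (1 - r.coord c) := by
          gcongr
          refine (toENNReal_edist_triangle a b c).trans ?_
          gcongr
          refine (toENNReal_edist_triangle b b' c).trans ?_
          gcongr
        _ = _ := by ring

theorem edist_self' (p : GraphSpace G) : edist p p = 0 := by
  obtain ⟨u, v, h⟩ := p.exists_onEdge
  simpa using edist_le_local h h

theorem eq_of_edist_eq_zero' {p q : GraphSpace G} (h : edist p q = 0) : p = q := by
  by_contra hne
  obtain ⟨u, v, hp⟩ := p.exists_onEdge
  obtain ⟨u', v', hq⟩ := q.exists_onEdge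
  have dp := onEdge_data hp
  have dq := onEdge_data hq
  -- a positive lower bound for all the terms of the two infima
  set S : Finset ℝ := {|p.coord u - q.coord u|, |p.coord v - q.coord v|,
    |p.coord u' - q.coord u'|, |p.coord v' - q.coord v'|, 1 - p.coord u, 1 - p.coord v,
    1 - q.coord u', 1 - q.coord v', 1} with hS
  obtain ⟨m, hm0, hm⟩ : ∃ m : ℝ, 0 < m ∧ ∀ x ∈ S, 0 < x → m ≤ x := by
    have hne : (S.filter (0 < ·)).Nonempty := ⟨1, by simp [hS]⟩
    refine ⟨(S.filter (0 < ·)).min' hne, (Finset.mem_filter.1 (Finset.min'_mem _ hne)).2, ?_⟩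
    intro x hx hx0
    exact Finset.min'_le _ _ (Finset.mem_filter.2 ⟨hx, hx0⟩)
  have key : ENNReal.ofReal m ≤ edist p q + 0 := by
    refine le_edist_add (fun a b ha hb => ?_) (fun a b ha hb => ?_)
    · have da := onEdge_data ha
      have db := onEdge_data hb
      rw [add_zero]
      apply ENNReal.ofReal_le_ofReal
      have hpos : p.coord a ≠ q.coord a := by
        intro heq
        apply hne
        ext w
        by_cases w = a <;> by_cases w = b <;> grind
      refine hm _ ?_ (abs_pos.2 (sub_ne_zero.2 hpos))
      have : a = u ∨ a = v ∨ a = u' ∨ a = v' := by grind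
      rcases this with rfl | rfl | rfl | rfl <;> simp [hS]
    · rw [add_zero]
      by_cases hab : a = b
      · subst hab
        have hpa := p.coord_mem a
        have hqa := q.coord_mem a
        by_cases h1 : p.coord a = 1
        · have h2 : q.coord a ≠ 1 := fun h2 => hne (eq_of_coord_eq_one h1 h2)
          refine le_trans (ENNReal.ofReal_le_ofReal ?_) le_add_self
          refine hm _ ?_ (sub_pos.2 (lt_of_le_of_ne hqa.2 h2))
          have : a = u' ∨ a = v' := by grind
          rcases this with rfl | rfl <;> simp [hS]
        · rw [add_assoc]
          refine le_trans (ENNReal.ofReal_le_ofReal ?_) le_self_add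
          refine hm _ ?_ (sub_pos.2 (lt_of_le_of_ne hpa.2 h1))
          have : a = u ∨ a = v := by grind
          rcases this with rfl | rfl <;> simp [hS]
      · have h1 : (1 : ℝ≥0∞) ≤ (G.edist a b : ℝ≥0∞) := by
          have : 1 ≤ G.edist a b := by
            rw [Order.one_le_iff_ne_zero]
            simpa [SimpleGraph.edist_eq_zero_iff] using hab
          simpa using ENat.toENNReal_le.2 this
        have h2 : ENNReal.ofReal m ≤ 1 := by
          simpa using hm 1 (by simp [hS]) one_pos
        exact (h2.trans h1).trans (le_add_self.trans le_self_add)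
  rw [h, add_zero, nonpos_iff_eq_zero, ENNReal.ofReal_eq_zero] at key
  linarith

/-- The graph `G`, with edges of length one, as an extended metric space. -/
noncomputable instance : EMetricSpace (GraphSpace G) where
  edist_self := edist_self'
  edist_comm := edist_comm'
  edist_triangle := edist_triangle'
  eq_of_edist_eq_zero := eq_of_edist_eq_zero'

end GraphSpace

/-! ### Lengths of paths -/

/-! The graph $H$ is $K_{20}$ and $G_q$ is the gadget with $n = 13q^2$. Its frame is $K_{20}$
without the edges 01, 23, 45, and it is joined to a complete binary tree of height $n$, whose leaves
form a top row, and to a bottom row of $2^n$ vertices. Long edges, subdivided $4n$ times, join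
consecutive columns in every way except leaf to leaf. Vertices 0 and 2 are attached to the left ends
of the top and bottom row, 1 and 3 to both right ends, 4 and 5 to the root. To recover $K_{20}$ one
has to route 45 through the root and two disjoint strands, 01 and 23, from left to right.

No 3-fat model: small separations do not split a model of a large clique
(`CliqueModel.meets_of_separates`), and descending through them shows that each branch set contains
a frame vertex, so the branch sets correspond to the frame vertices. The missing pairs then yield
connected sets at mutual distance at least 3 (`exists_strands`); the one for 45 contains the root,
so neither row strand does. At a gap between columns that neither strand jumps through the tree,
both use a long edge; there is no leaf-leaf edge, so one strand contains the leaf on the left and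
the other the leaf on the right (`exists_gap_mem`). Take an unjumped gap below a tree node of least
height. All lower gaps are jumped, which forces one strand up the right spine of the left child and
the other up the left spine of the right child, until they contain two siblings, at distance 2
(`false_of_two_sets`).

A fat model in $X$: a quasi-isometry draws the gadget in $X$ so that vertices at distance at least
$n$ stay far apart (`exists_drawing`). Every required distance except one follows from this. The
exception is the top row: drawings of neighbouring leaves may be arbitrarily close. With
$\varepsilon = 2^{-n}$, merge these drawings into runs whose connecting sets are at distance at
least $\varepsilon$ (`exists_runs`). As there are $2^n$ leaves, merging moves points by at most
$2^n\varepsilon = 1$. The two strands exchange rows exactly at the cuts between runs; in each run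
one uses the connecting set and the other the bottom row (`hasFatMinor_of_drawing`). -/

theorem edist_le_pathLength {X : Type*} [EMetricSpace X] {x y : X} (γ : Path x y) :
    edist x y ≤ pathLength γ := by
  have := eVariationOn.edist_le (γ : unitInterval → X) (Set.mem_univ 0) (Set.mem_univ 1)
  simpa [pathLength] using this

theorem edist_apply_le_pathLength {X : Type*} [EMetricSpace X] {x y : X} (γ : Path x y)
    (t : unitInterval) : edist x (γ t) ≤ pathLength γ := by
  have := eVariationOn.edist_le (γ : unitInterval → X) (Set.mem_univ 0) (Set.mem_univ t)
  simpa [pathLength] using this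

theorem le_setDist {X : Type*} [EMetricSpace X] {A B : Set X} {c : ℝ≥0∞}
    (h : ∀ x ∈ A, ∀ y ∈ B, c ≤ edist x y) : c ≤ setDist A B :=
  le_iInf₂ fun x hx => le_iInf₂ fun y hy => le_iInf fun γ =>
    (h x hx y hy).trans (edist_le_pathLength γ)

theorem exists_path_of_setDist_lt {X : Type*} [EMetricSpace X] {A B : Set X} {c : ℝ≥0∞}
    (h : setDist A B < c) : ∃ x ∈ A, ∃ y ∈ B, ∃ γ : Path x y, pathLength γ < c := by
  simpa [setDist, iInf_lt_iff] using h

theorem setDist_le {X : Type*} [EMetricSpace X] {A B : Set X} {x y : X} (hx : x ∈ A) (hy : y ∈ B)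
    (γ : Path x y) : setDist A B ≤ pathLength γ :=
  iInf₂_le_of_le x hx (iInf₂_le_of_le y hy (iInf_le _ γ))

theorem pathLength_trans_le {X : Type*} [EMetricSpace X] {x y z : X} (γ : Path x y)
    (δ : Path y z) : pathLength (γ.trans δ) ≤ pathLength γ + pathLength δ := by
  have h0 : (0 : ℝ) ≤ 1 / 2 ∧ (1 / 2 : ℝ) ≤ 1 := by norm_num
  set c : unitInterval := ⟨1 / 2, h0⟩ with hc
  have hU : (Set.univ : Set unitInterval) = Set.Iic c ∪ Set.Ici c := by
    rw [Set.Iic_union_Ici]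
  unfold pathLength
  rw [hU, eVariationOn.union _ (x := c) ⟨Set.self_mem_Iic, fun _ h => h⟩
    ⟨Set.self_mem_Ici, fun _ h => h⟩, ← hU]
  gcongr
  · have h1 : Set.EqOn (γ.trans δ) (γ ∘ fun t : unitInterval =>
        Set.projIcc (0 : ℝ) 1 zero_le_one (2 * (t : ℝ))) (Set.Iic c) := by
      intro t ht
      have ht' : (t : ℝ) ≤ 1 / 2 := ht
      rw [Path.trans_apply, dif_pos ht']
      simp only [Function.comp]
      congr 1
      rw [Set.projIcc_of_mem]
    rw [eVariationOn.congr h1]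
    refine eVariationOn.comp_le_of_monotoneOn _ _ ?_ (fun _ _ => Set.mem_univ _)
    intro s _ t _ hst
    refine Set.monotone_projIcc _ ?_
    have : (s : ℝ) ≤ t := hst
    linarith
  · have h1 : Set.EqOn (γ.trans δ) (δ ∘ fun t : unitInterval =>
        Set.projIcc (0 : ℝ) 1 zero_le_one (2 * (t : ℝ) - 1)) (Set.Ici c) := by
      intro t ht
      have ht' : 1 / 2 ≤ (t : ℝ) := ht
      simp only [Function.comp]
      rw [Path.trans_apply]
      split_ifs with h
      · have : (t : ℝ) = 1 / 2 := le_antisymm h ht'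
        have h2 : (⟨2 * (t : ℝ), (unitInterval.mul_pos_mem_iff zero_lt_two).2 ⟨t.2.1, h⟩⟩ :
          unitInterval) = 1 := by ext; simp [this]
        have h3 : Set.projIcc (0 : ℝ) 1 zero_le_one (2 * (t : ℝ) - 1) = 0 := by
          rw [this]; norm_num
        rw [h2, h3]; simp
      · congr 1
        rw [Set.projIcc_of_mem]
    rw [eVariationOn.congr h1]
    refine eVariationOn.comp_le_of_monotoneOn _ _ ?_ (fun _ _ => Set.mem_univ _)
    intro s _ t _ hst
    refine Set.monotone_projIcc _ ?_
    have : (s : ℝ) ≤ t := hst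
    linarith

theorem pathLength_le_of_lipschitz {X : Type*} [EMetricSpace X] {x y : X} (γ : Path x y) {c : ℝ}
    (hc : 0 ≤ c)
    (h : ∀ s t : unitInterval, edist (γ s) (γ t) ≤ ENNReal.ofReal (c * |(s : ℝ) - t|)) :
    pathLength γ ≤ ENNReal.ofReal c := by
  refine iSup_le fun ⟨k, u, hu, _⟩ => ?_
  have key : ∀ k : ℕ, ∑ i ∈ Finset.range k, edist (γ (u (i + 1))) (γ (u i)) ≤
      ENNReal.ofReal (c * ((u k : ℝ) - u 0)) := by
    intro k
    induction k with
    | zero => simp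
    | succ k ih =>
      rw [Finset.sum_range_succ]
      have h1 : (u 0 : ℝ) ≤ u k := hu (Nat.zero_le k)
      have h2 : (u k : ℝ) ≤ u (k + 1) := hu (Nat.le_succ k)
      calc _ ≤ ENNReal.ofReal (c * ((u k : ℝ) - u 0)) +
            ENNReal.ofReal (c * |(u (k + 1) : ℝ) - u k|) := add_le_add ih (h _ _)
        _ = _ := by
          rw [abs_of_nonneg (by linarith), ← ENNReal.ofReal_add
            (mul_nonneg hc (by linarith)) (mul_nonneg hc (by linarith))]
          congr 1
          ring
  refine (key k).trans (ENNReal.ofReal_le_ofReal ?_)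
  have h1 := (u k).2.2
  have h2 := (u 0).2.1
  have h3 : (u k : ℝ) - u 0 ≤ 1 := by linarith
  nlinarith

/-! ### Points, vertices and stars of a graph -/

namespace GraphSpace

variable {V : Type*} {G : SimpleGraph V}

theorem onEdge_self (G : SimpleGraph V) (a : V) :
    G.OnEdge (Set.indicator {a} (fun _ => (1 : ℝ))) a a := ⟨Or.inl rfl, by simp⟩

/-- The vertex `a` as a point of the graph. -/
noncomputable def vert (G : SimpleGraph V) (a : V) : GraphSpace G :=
  ⟨Set.indicator {a} (fun _ => 1), a, a, onEdge_self G a⟩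

@[simp] theorem vert_coord_self (a : V) : (vert G a).coord a = 1 := by simp [vert]

theorem vert_coord_of_ne {a b : V} (h : b ≠ a) : (vert G a).coord b = 0 := by
  simp [vert, h]

theorem vert_coord_ne_zero {a b : V} : (vert G a).coord b ≠ 0 ↔ b = a := by
  by_cases h : b = a
  · simp [h]
  · simp [vert_coord_of_ne h, h]

theorem onEdge_vert_left {a b : V} (h : a = b ∨ G.Adj a b) : G.OnEdge (vert G a).coord a b :=
  ⟨h, left_mem_segment _ _ _⟩

theorem onEdge_vert_right {a b : V} (h : a = b ∨ G.Adj a b) : G.OnEdge (vert G b).coord a b :=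
  ⟨h, right_mem_segment _ _ _⟩

theorem coord_add_coord_le (p : GraphSpace G) {a b : V} (h : a ≠ b) :
    p.coord a + p.coord b ≤ 1 := by
  obtain ⟨u, v, h'⟩ := p.exists_onEdge
  have := onEdge_data h'
  by_cases a = u <;> by_cases a = v <;> by_cases b = u <;> by_cases b = v <;> grind

theorem adj_of_coord_ne_zero (p : GraphSpace G) {a b : V} (h : a ≠ b) (ha : p.coord a ≠ 0)
    (hb : p.coord b ≠ 0) : G.Adj a b := by
  obtain ⟨u, v, h'⟩ := p.exists_onEdge
  obtain ⟨h1, h2, h3, h4, h5⟩ := onEdge_data h'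
  have hau : a = u ∨ a = v := by grind
  have hbu : b = u ∨ b = v := by grind
  have huv : u ≠ v := by grind
  have := (h4 huv).2
  rcases hau with rfl | rfl <;> rcases hbu with rfl | rfl <;>
    first | exact absurd rfl h | exact this | exact this.symm

theorem exists_coord_ne_zero (p : GraphSpace G) : ∃ a, p.coord a ≠ 0 := by
  obtain ⟨u, v, h'⟩ := p.exists_onEdge
  obtain ⟨h1, h2, h3, h4, h5⟩ := onEdge_data h'
  by_cases huv : u = v
  · exact ⟨u, by rw [h3 huv]; simp⟩
  · by_cases hu : p.coord u = 0
    · exact ⟨v, by have := (h4 huv).1; intro h; linarith⟩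
    · exact ⟨u, hu⟩

theorem exists_other_coord (p : GraphSpace G) {a : V} (ha : p.coord a ≠ 0) (hp : p ≠ vert G a) :
    ∃ b, b ≠ a ∧ p.coord b ≠ 0 := by
  by_contra! hcon
  apply hp
  obtain ⟨u, v, h'⟩ := p.exists_onEdge
  obtain ⟨h1, h2, h3, h4, h5⟩ := onEdge_data h'
  refine eq_of_coord_eq_one (a := a) ?_ (vert_coord_self a)
  have hu := hcon u
  have hv := hcon v
  by_cases hua : u = a
  · subst hua
    by_cases huv : u = v
    · exact h3 huv
    · have := hv (Ne.symm huv)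
      have := (h4 huv).1
      linarith
  · have hu := hu hua
    have huv : u ≠ v := by
      intro h
      rw [h3 h] at hu
      exact one_ne_zero hu
    have hva : v = a := by
      by_contra hva
      have := hv hva
      have := (h4 huv).1
      linarith
    have := (h4 huv).1
    rw [← hva]
    linarith

theorem eq_of_three_coord (p : GraphSpace G) {a b c : V} (ha : p.coord a ≠ 0)
    (hb : p.coord b ≠ 0) (hc : p.coord c ≠ 0) (hab : a ≠ b) : c = a ∨ c = b := by
  obtain ⟨u, v, h'⟩ := p.exists_onEdge
  obtain ⟨-, -, -, -, h5⟩ := onEdge_data h'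
  have key : ∀ w, p.coord w ≠ 0 → w = u ∨ w = v := by
    intro w hw
    by_contra! h
    exact hw (h5 w h.1 h.2)
  have := key a ha
  have := key b hb
  have := key c hc
  grind

/-- A point with non-zero coordinate `a` lies on a closed edge with end `a`. -/
theorem exists_onEdge_of_coord_ne_zero (p : GraphSpace G) {a : V} (ha : p.coord a ≠ 0) :
    ∃ b, G.OnEdge p.coord a b := by
  obtain ⟨u, v, h⟩ := p.exists_onEdge
  have d := onEdge_data h
  have : a = u ∨ a = v := by grind
  rcases this with rfl | rfl
  · exact ⟨v, h⟩
  · exact ⟨u, onEdge_symm h⟩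

/-- Barycentric coordinates are 1-Lipschitz. Hence open stars of vertices are open, and
connectedness of a set of points can be turned into statements about vertices. -/
theorem ofReal_abs_coord_sub_le (p q : GraphSpace G) (a : V) :
    ENNReal.ofReal |p.coord a - q.coord a| ≤ edist p q := by
  rw [← add_zero (edist p q)]
  have hp := p.coord_mem a
  have hq := q.coord_mem a
  refine le_edist_add (fun u v h1 h2 => ?_) (fun x y hx hy => ?_)
  · rw [add_zero]
    apply ENNReal.ofReal_le_ofReal
    have d1 := onEdge_data h1
    have d2 := onEdge_data h2
    by_cases ha : a = u
    · rw [ha]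
    · by_cases hv : a = v
      · subst hv
        have huv : u ≠ a := fun h => ha h.symm
        have e1 := (d1.2.2.2.1 huv).1
        have e2 := (d2.2.2.2.1 huv).1
        rw [← abs_neg]
        apply le_of_eq
        congr 1
        linarith
      · rw [d1.2.2.2.2 a ha hv, d2.2.2.2.2 a ha hv]
        simp
  · rw [add_zero]
    have habs : |p.coord a - q.coord a| ≤ 1 := abs_le.2 ⟨by linarith, by linarith⟩
    by_cases hxy : x = y
    · subst hxy
      have hpx := p.coord_mem x
      have hqx := q.coord_mem x
      simp only [SimpleGraph.edist_self, ENat.toENNReal_zero, add_zero]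
      rw [← ENNReal.ofReal_add (by linarith) (by linarith)]
      apply ENNReal.ofReal_le_ofReal
      by_cases hax : a = x
      · subst hax
        rw [abs_le]; constructor <;> linarith
      · have := p.coord_add_coord_le hax
        have := q.coord_add_coord_le hax
        rw [abs_le]; constructor <;> linarith
    · have h1 : (1 : ℝ≥0∞) ≤ (G.edist x y : ℝ≥0∞) := by
        have : 1 ≤ G.edist x y := by
          rw [Order.one_le_iff_ne_zero]
          simpa [SimpleGraph.edist_eq_zero_iff] using hxy
        simpa using ENat.toENNReal_le.2 this
      calc ENNReal.ofReal |p.coord a - q.coord a| ≤ 1 := by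
            rw [← ENNReal.ofReal_one]; exact ENNReal.ofReal_le_ofReal habs
        _ ≤ _ := h1.trans (le_add_self.trans le_self_add)

theorem continuous_coord (a : V) : Continuous fun p : GraphSpace G => p.coord a := by
  have : LipschitzWith 1 fun p : GraphSpace G => p.coord a := by
    intro p q
    rw [edist_dist, Real.dist_eq, ENNReal.coe_one, one_mul]
    exact ofReal_abs_coord_sub_le p q a
  exact this.continuous

theorem isOpen_star (a : V) : IsOpen {p : GraphSpace G | p.coord a ≠ 0} :=
  isOpen_ne_fun (continuous_coord a) continuous_const

/-- Passing to the geometric realization does not shorten distances between vertices, so lower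
bounds may be proved in the combinatorial metric. -/
theorem le_edist_vert (a b : V) :
    (G.edist a b : ℝ≥0∞) ≤ edist (vert G a) (vert G b) := by
  rw [← add_zero (edist (vert G a) (vert G b))]
  refine le_edist_add (fun u v h1 h2 => ?_) (fun x y hx hy => ?_)
  · have d1 := onEdge_data h1
    have d2 := onEdge_data h2
    by_cases hab : a = b
    · simp [hab]
    · have ha : a = u ∨ a = v := by
        by_contra! h
        have := d1.2.2.2.2 a h.1 h.2
        simp at this
      have hb : b = u ∨ b = v := by
        by_contra! h
        have := d2.2.2.2.2 b h.1 h.2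
        simp at this
      have hba : b ≠ a := fun h => hab h.symm
      have hadj : G.Adj a b := by
        have huv : u ≠ v := by grind
        have := (d1.2.2.2.1 huv).2
        rcases ha with rfl | rfl <;> rcases hb with rfl | rfl <;>
          first | exact absurd rfl hab | exact this | exact this.symm
      refine (toENNReal_edist_le_one hadj).trans ?_
      rw [add_zero, ENNReal.one_le_ofReal]
      rcases ha with rfl | rfl
      · simp [vert_coord_of_ne hab]
      · rcases hb with rfl | rfl
        · simp [vert_coord_of_ne hba]
        · exact absurd rfl hab
  · obtain rfl := vert_coord_ne_zero.1 hx
    obtain rfl := vert_coord_ne_zero.1 hy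
    simp

theorem edist_vert_le_one {a b : V} (h : G.Adj a b) : edist (vert G a) (vert G b) ≤ 1 := by
  refine (edist_le_local (onEdge_vert_left (Or.inr h)) (onEdge_vert_right (Or.inr h))).trans ?_
  simp [vert_coord_of_ne h.ne]

/-- Two points of a closed edge are joined by a path of length at most one. -/
theorem exists_path_of_onEdge {p q : GraphSpace G} {u v : V} (hp : G.OnEdge p.coord u v)
    (hq : G.OnEdge q.coord u v) : ∃ γ : Path p q, pathLength γ ≤ 1 := by
  have hmem : ∀ t : unitInterval,
      G.OnEdge ((1 - (t : ℝ)) • p.coord + (t : ℝ) • q.coord) u v := fun t =>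
    ⟨hp.1, (convex_segment _ _) hp.2 hq.2 (by linarith [t.2.2]) t.2.1 (by ring)⟩
  set f : unitInterval → GraphSpace G := fun t => ⟨_, u, v, hmem t⟩ with hf
  set c := |p.coord u - q.coord u| with hc
  have hd : ∀ s t, edist (f s) (f t) ≤ ENNReal.ofReal (c * |(s : ℝ) - t|) := by
    intro s t
    refine (edist_le_local (hmem s) (hmem t)).trans (le_of_eq ?_)
    rw [hc, ← abs_mul, ← abs_neg]
    congr 2
    simp [hf]
    ring
  have hc0 : 0 ≤ c := abs_nonneg _
  have hcont : Continuous f := by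
    have : LipschitzWith (Real.toNNReal c) f := by
      intro s t
      refine (hd s t).trans (le_of_eq ?_)
      rw [ENNReal.ofReal_mul hc0, Subtype.edist_eq, edist_dist, Real.dist_eq]
      rfl
    exact this.continuous
  refine ⟨⟨⟨f, hcont⟩, ?_, ?_⟩, ?_⟩
  · ext; simp [hf]
  · ext; simp [hf]
  · refine (pathLength_le_of_lipschitz _ hc0 hd).trans ?_
    rw [ENNReal.ofReal_le_one]
    have h1 := p.coord_mem u
    have h2 := q.coord_mem u
    exact abs_le.2 ⟨by linarith, by linarith⟩

/-- Points that share closed edges with a common point are at distance at most two. -/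
theorem setDist_le_two {S S' : Set (GraphSpace G)} {p z q : GraphSpace G} {a b c d : V}
    (hp : p ∈ S) (hq : q ∈ S') (hpa : G.OnEdge p.coord a b) (hza : G.OnEdge z.coord a b)
    (hzc : G.OnEdge z.coord c d) (hqc : G.OnEdge q.coord c d) : setDist S S' ≤ 2 := by
  obtain ⟨γ, hγ⟩ := exists_path_of_onEdge hpa hza
  obtain ⟨δ, hδ⟩ := exists_path_of_onEdge hzc hqc
  refine (setDist_le hp hq (γ.trans δ)).trans ((pathLength_trans_le γ δ).trans ?_)
  calc _ ≤ (1 : ℝ≥0∞) + 1 := add_le_add hγ hδ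
    _ = 2 := one_add_one_eq_two

/-! ### Vertices touched by and contained in a set of points -/

/-- The vertices touched by a set: those whose open star it meets. -/
def touched (S : Set (GraphSpace G)) : Set V := {a | ∃ p ∈ S, p.coord a ≠ 0}

/-- The vertices contained in a set of points. -/
def verts (S : Set (GraphSpace G)) : Set V := {a | vert G a ∈ S}

theorem verts_subset_touched (S : Set (GraphSpace G)) : verts S ⊆ touched S :=
  fun a ha => ⟨_, ha, by simp⟩

theorem touched_nonempty {S : Set (GraphSpace G)} (h : S.Nonempty) : (touched S).Nonempty := by
  obtain ⟨p, hp⟩ := h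
  obtain ⟨a, ha⟩ := p.exists_coord_ne_zero
  exact ⟨a, p, hp, ha⟩

theorem touched_union (S S' : Set (GraphSpace G)) :
    touched (S ∪ S') = touched S ∪ touched S' := by
  ext a
  simp only [touched, Set.mem_union, Set.mem_ofPred_eq]
  constructor
  · rintro ⟨p, hp | hp, h⟩
    · exact Or.inl ⟨p, hp, h⟩
    · exact Or.inr ⟨p, hp, h⟩
  · rintro (⟨p, hp, h⟩ | ⟨p, hp, h⟩)
    · exact ⟨p, Or.inl hp, h⟩
    · exact ⟨p, Or.inr hp, h⟩

theorem touched_inter_of_inter {S S' : Set (GraphSpace G)} (h : (S ∩ S').Nonempty) :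
    (touched S ∩ touched S').Nonempty := by
  obtain ⟨p, hp, hp'⟩ := h
  obtain ⟨a, ha⟩ := p.exists_coord_ne_zero
  exact ⟨a, ⟨p, hp, ha⟩, ⟨p, hp', ha⟩⟩

/-- If both sets meet the open star of `a`, two arcs of length at most one through `a` join them, so
their distance is at most 2. -/
theorem touched_disjoint {S S' : Set (GraphSpace G)} (h : 3 ≤ setDist S S') :
    Disjoint (touched S) (touched S') := by
  rw [Set.disjoint_left]
  rintro a ⟨p, hp, hpa⟩ ⟨q, hq, hqa⟩
  obtain ⟨b, hb⟩ := p.exists_onEdge_of_coord_ne_zero hpa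
  obtain ⟨c, hc⟩ := q.exists_onEdge_of_coord_ne_zero hqa
  have := setDist_le_two hp hq hb (onEdge_vert_left hb.1) (onEdge_vert_left hc.1) hc
  exact absurd (h.trans this) (by norm_num)

/-- This is the only contradiction with fatness that needs vertices contained in the sets: two of
them with a common neighbour are at distance 2, whereas points merely in their open stars may be
further apart. -/
theorem not_mem_verts_of_adj_adj {S S' : Set (GraphSpace G)} (h : 3 ≤ setDist S S') {a b c : V}
    (hab : G.Adj a b) (hbc : G.Adj b c) (ha : a ∈ verts S) : c ∉ verts S' := by
  intro hc
  have := setDist_le_two ha hc (onEdge_vert_left (Or.inr hab)) (onEdge_vert_right (Or.inr hab))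
    (onEdge_vert_left (Or.inr hbc)) (onEdge_vert_right (Or.inr hbc))
  exact absurd (h.trans this) (by norm_num)

/-- A set `M` of vertices is linked if it cannot be split into two non-empty parts without an edge
between them. -/
def _root_.SimpleGraph.Linked {V : Type*} (G : SimpleGraph V) (M : Set V) : Prop :=
  ∀ L : Set V, (∀ x ∈ M, ∀ y ∈ M, x ∈ L → G.Adj x y → y ∈ L) →
    ∀ x ∈ M, x ∈ L → ∀ y ∈ M, y ∈ L

theorem isOpen_star_union (A : Set V) :
    IsOpen {p : GraphSpace G | ∃ a ∈ A, p.coord a ≠ 0} := by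
  have : {p : GraphSpace G | ∃ a ∈ A, p.coord a ≠ 0} = ⋃ a ∈ A, {p | p.coord a ≠ 0} := by
    ext; simp
  rw [this]
  exact isOpen_biUnion fun a _ => isOpen_star a

/-- If a connected set contains no vertex outside `T` and `L` is closed under adjacency within `T`,
then the vertices of `T` it touches lie all in `L` or all outside. -/
theorem mem_of_touched {S : Set (GraphSpace G)} (hS : IsPreconnected S) {T L : Set V}
    (hT : ∀ a ∉ T, a ∉ verts S)
    (hL : ∀ x ∈ touched S ∩ T, ∀ y ∈ touched S ∩ T, x ∈ L → G.Adj x y → y ∈ L)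
    {x y : V} (hx : x ∈ touched S ∩ T) (hxL : x ∈ L) (hy : y ∈ touched S ∩ T) : y ∈ L := by
  by_contra hyL
  obtain ⟨⟨p, hp, hpx⟩, hxT⟩ := hx
  obtain ⟨⟨q, hq, hqy⟩, hyT⟩ := hy
  -- The interiors of edges with both ends outside `T`. With the stars of `T ∩ L` and of `T \ L`
  -- they cover `S`: a point of `S` with no coordinate in `T` is not a vertex, so it has two
  -- coordinates outside `T`.
  have hW : IsOpen (⋃ a ∈ Tᶜ, ⋃ b ∈ Tᶜ \ {a},
      ({p : GraphSpace G | p.coord a ≠ 0} ∩ {p | p.coord b ≠ 0})) :=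
    isOpen_biUnion fun a _ => isOpen_biUnion fun b _ => (isOpen_star a).inter (isOpen_star b)
  obtain ⟨z, hz, ⟨a, ha, hza⟩, hz2⟩ := hS _ _ (isOpen_star_union (T ∩ L))
    ((isOpen_star_union (T \ L)).union hW)
    (fun z hz => by
      by_cases h : ∃ a ∈ T, z.coord a ≠ 0
      · obtain ⟨a, haT, ha⟩ := h
        by_cases h : a ∈ L
        · exact Or.inl ⟨a, ⟨haT, h⟩, ha⟩
        · exact Or.inr (Or.inl ⟨a, ⟨haT, h⟩, ha⟩)
      · obtain ⟨a, ha⟩ := z.exists_coord_ne_zero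
        have haT : a ∉ T := fun h' => h ⟨a, h', ha⟩
        have hza : z ≠ vert G a := by
          rintro rfl
          exact hT a haT hz
        obtain ⟨b, hba, hb⟩ := z.exists_other_coord ha hza
        have hbT : b ∉ T := fun h' => h ⟨b, h', hb⟩
        refine Or.inr (Or.inr ?_)
        simp only [Set.mem_iUnion]
        exact ⟨a, haT, b, ⟨hbT, hba⟩, ha, hb⟩)
    ⟨p, hp, x, ⟨hxT, hxL⟩, hpx⟩ ⟨q, hq, Or.inl ⟨y, ⟨hyT, hyL⟩, hqy⟩⟩
  -- A common point gives either an edge within `T` from `L` to its complement or a point with three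
  -- non-zero coordinates.
  rcases hz2 with ⟨b, ⟨hbT, hbL⟩, hzb⟩ | hz2
  · have hab : a ≠ b := by rintro rfl; exact hbL ha.2
    exact hbL (hL a ⟨⟨z, hz, hza⟩, ha.1⟩ b ⟨⟨z, hz, hzb⟩, hbT⟩ ha.2
      (z.adj_of_coord_ne_zero hab hza hzb))
  · simp only [Set.mem_iUnion] at hz2
    obtain ⟨b, hb, c, hc, hzb, hzc⟩ := hz2
    rcases z.eq_of_three_coord hzb hzc hza (fun h => hc.2 h.symm) with rfl | rfl
    · exact hb ha.1
    · exact hc.1 ha.1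

theorem linked_touched {S : Set (GraphSpace G)} (hS : IsPreconnected S) :
    G.Linked (touched S) := by
  intro L hL x hx hxL y hy
  exact mem_of_touched hS (T := Set.univ) (by simp) (by simpa using hL) (by simpa using hx) hxL
    (by simpa using hy)

theorem linked_verts {S : Set (GraphSpace G)} (hS : IsPreconnected S) :
    G.Linked (verts S) := by
  intro L hL x hx hxL y hy
  exact mem_of_touched hS (T := verts S) (fun _ h => h)
    (fun x hx y hy => hL x hx.2 y hy.2) ⟨verts_subset_touched S hx, hx⟩ hxL
    ⟨verts_subset_touched S hy, hy⟩

/-- A connected set that touches `D` and touches a vertex outside `D ∪ F`, where `F` separates `D`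
from the rest of the graph, contains a vertex of `F`. -/
theorem exists_mem_verts_of_separates {S : Set (GraphSpace G)} (hS : IsPreconnected S)
    {D F : Set V} (hDF : ∀ x ∈ D, ∀ y, G.Adj x y → y ∈ D ∪ F) {x y : V} (hx : x ∈ touched S)
    (hxD : x ∈ D) (hxF : x ∉ F) (hy : y ∈ touched S) (hyD : y ∉ D ∪ F) : ∃ a ∈ F, a ∈ verts S := by
  by_contra! hF
  refine hyD (Or.inl (mem_of_touched hS (T := Fᶜ) (L := D) (fun a ha => hF a (by simpa using ha))
    ?_ ⟨hx, hxF⟩ hxD ⟨hy, fun h => hyD (Or.inr h)⟩))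
  rintro u ⟨-, hu⟩ v ⟨-, hv⟩ huD huv
  exact (hDF u huD v huv).resolve_right hv

end GraphSpace

/-! ### Graphs with short and long edges -/

/-- The vertices of a graph with long edges: the base vertices and, for each long edge, `m` vertices
subdividing it. -/
inductive LongVertex (B E : Type) (m : ℕ) : Type
  | base (b : B) : LongVertex B E m
  | mid (e : E) (k : ℕ) (hk : k < m) : LongVertex B E m

/-- A graph on `B` with edges of two kinds: short ones, and long ones that get subdivided. -/
structure LongGraph (B E : Type) where
  short : B → B → Prop
  src : E → B
  tgt : E → B
  m : ℕ

namespace LongGraph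

open LongVertex

variable {B E : Type} (Γ : LongGraph B E)

/-- The oriented edges of the subdivided graph. -/
inductive Step : LongVertex B E Γ.m → LongVertex B E Γ.m → Prop
  | short {x y : B} (h : Γ.short x y) : Step (base x) (base y)
  | start (e : E) (h : 0 < Γ.m) : Step (base (Γ.src e)) (mid e 0 h)
  | next (e : E) (k : ℕ) (h : k + 1 < Γ.m) : Step (mid e k (Nat.lt_of_succ_lt h)) (mid e (k + 1) h)
  | finish (e : E) (k : ℕ) (h : k < Γ.m) (hk : k + 1 = Γ.m) : Step (mid e k h) (base (Γ.tgt e))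

/-- The subdivided graph. -/
def graph : SimpleGraph (LongVertex B E Γ.m) := SimpleGraph.fromRel Γ.Step

theorem adj_of_step {x y : LongVertex B E Γ.m} (h : Γ.Step x y) (hne : x ≠ y) :
    Γ.graph.Adj x y := by
  rw [graph, SimpleGraph.fromRel_adj]
  exact ⟨hne, Or.inl h⟩

theorem step_of_adj {x y : LongVertex B E Γ.m} (h : Γ.graph.Adj x y) : Γ.Step x y ∨ Γ.Step y x := by
  rw [graph, SimpleGraph.fromRel_adj] at h
  exact h.2

theorem adj_mid (e : E) (k : ℕ) (h : k + 1 < Γ.m) :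
    Γ.graph.Adj (mid e k (Nat.lt_of_succ_lt h)) (mid e (k + 1) h) :=
  Γ.adj_of_step (.next e k h) (by simp)

theorem adj_src (e : E) (h : 0 < Γ.m) : Γ.graph.Adj (base (Γ.src e)) (mid e 0 h) :=
  Γ.adj_of_step (.start e h) (by simp)

theorem adj_tgt (e : E) (k : ℕ) (h : k < Γ.m) (hk : k + 1 = Γ.m) :
    Γ.graph.Adj (mid e k h) (base (Γ.tgt e)) :=
  Γ.adj_of_step (.finish e k h hk) (by simp)

/-- The base vertices of a linked set `M` are linked through the short edges and the long edges
contained in `M`. -/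
theorem mem_of_linked {M : Set (LongVertex B E Γ.m)} (hM : Γ.graph.Linked M) {L : Set B}
    (hs : ∀ x y, Γ.short x y → base x ∈ M → base y ∈ M → (x ∈ L ↔ y ∈ L))
    (hl : ∀ e, base (Γ.src e) ∈ M → base (Γ.tgt e) ∈ M →
      (∀ k hk, mid e k hk ∈ M) → (Γ.src e ∈ L ↔ Γ.tgt e ∈ L))
    {x y : B} (hx : base x ∈ M) (hxL : x ∈ L) (hy : base y ∈ M) : y ∈ L := by
  -- `L` is extended to a subdividing vertex when `M` contains the whole piece of the edge from it
  -- to an end lying in `L`.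
  let P : LongVertex B E Γ.m → Prop := fun
    | base b => b ∈ L
    | mid e k _ => (base (Γ.src e) ∈ M ∧ Γ.src e ∈ L ∧ ∀ k' h', k' ≤ k → mid e k' h' ∈ M) ∨
        (base (Γ.tgt e) ∈ M ∧ Γ.tgt e ∈ L ∧ ∀ k' h', k ≤ k' → mid e k' h' ∈ M)
  have key := hM {v | P v} ?_ (base x) hx hxL (base y) hy
  · exact key
  intro u hu v hv (hPu : P u) huv
  change P v
  rcases Γ.step_of_adj huv with h | h
  · cases h with
    | short h => exact (hs _ _ h hu hv).1 hPu
    | start e h =>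
      refine Or.inl ⟨hu, hPu, fun k' h' hk' => ?_⟩
      obtain rfl : k' = 0 := by omega
      exact hv
    | next e k h =>
      rcases hPu with ⟨h1, h2, h3⟩ | ⟨h1, h2, h3⟩
      · refine Or.inl ⟨h1, h2, fun k' h' hk' => ?_⟩
        rcases Nat.lt_or_ge k k' with hlt | hge
        · obtain rfl : k' = k + 1 := by omega
          exact hv
        · exact h3 k' h' hge
      · exact Or.inr ⟨h1, h2, fun k' h' hk' => h3 k' h' (by omega)⟩
    | finish e k h hk =>
      rcases hPu with ⟨h1, h2, h3⟩ | ⟨h1, h2, h3⟩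
      · exact (hl e h1 hv fun k' h' => h3 k' h' (by omega)).1 h2
      · exact h2
  · cases h with
    | short h => exact (hs _ _ h hv hu).2 hPu
    | start e h =>
      rcases hPu with ⟨h1, h2, h3⟩ | ⟨h1, h2, h3⟩
      · exact h2
      · exact (hl e hv h1 fun k' h' => h3 k' h' (by omega)).2 h2
    | next e k h =>
      rcases hPu with ⟨h1, h2, h3⟩ | ⟨h1, h2, h3⟩
      · exact Or.inl ⟨h1, h2, fun k' h' hk' => h3 k' h' (by omega)⟩
      · refine Or.inr ⟨h1, h2, fun k' h' hk' => ?_⟩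
        rcases Nat.lt_or_ge k k' with hlt | hge
        · exact h3 k' h' hlt
        · obtain rfl : k' = k := by omega
          exact hv
    | finish e k h hk =>
      refine Or.inr ⟨hu, hPu, fun k' h' hk' => ?_⟩
      obtain rfl : k' = k := by omega
      exact hv

/-- The set `C` of base vertices together with the open long edges with an end in `C`. -/
def hull (C : Set B) : Set (LongVertex B E Γ.m) :=
  {v | match v with
    | base b => b ∈ C
    | mid e _ _ => Γ.src e ∈ C ∨ Γ.tgt e ∈ C}

/-- `F` separates `C` from the other base vertices. -/
structure Separates (C F : Set B) : Prop where
  short : ∀ x y, Γ.short x y → (x ∈ C → y ∈ C ∪ F) ∧ (y ∈ C → x ∈ C ∪ F)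
  long : ∀ e, (Γ.src e ∈ C → Γ.tgt e ∈ C ∪ F) ∧ (Γ.tgt e ∈ C → Γ.src e ∈ C ∪ F)

theorem Separates.adj {C F : Set B} (h : Γ.Separates C F) :
    ∀ x ∈ Γ.hull C, ∀ y, Γ.graph.Adj x y → y ∈ Γ.hull C ∪ base '' F := by
  have hb : ∀ b, b ∈ C ∪ F → (base b : LongVertex B E Γ.m) ∈ Γ.hull C ∪ base '' F := by
    rintro b (hb | hb)
    · exact Or.inl hb
    · exact Or.inr ⟨b, hb, rfl⟩
  intro x hx y hxy
  rcases Γ.step_of_adj hxy with hst | hst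
  · cases hst with
    | short h' => exact hb _ ((h.short _ _ h').1 hx)
    | start e h' => exact Or.inl (Or.inl hx)
    | next e k h' => exact Or.inl hx
    | finish e k h' hk =>
      rcases hx with hx | hx
      · exact hb _ ((h.long e).1 hx)
      · exact Or.inl hx
  · cases hst with
    | short h' => exact hb _ ((h.short _ _ h').2 hx)
    | start e h' =>
      rcases hx with hx | hx
      · exact Or.inl hx
      · exact hb _ ((h.long e).2 hx)
    | next e k h' => exact Or.inl hx
    | finish e k h' hk => exact Or.inl (Or.inr hx)

/-- The extension of a function on the base vertices to the subdivided graph. It stays as large as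
possible on the edges in `hi` and as small as possible on the others. -/
noncomputable def extend (f : B → ℤ) (hi : Set E) (c : ℤ) : LongVertex B E Γ.m → ℤ := by
  classical exact fun
    | base b => f b
    | mid e k _ =>
      if e ∈ hi then min c (min (f (Γ.src e) + (k + 1)) (f (Γ.tgt e) + (Γ.m - k)))
      else max 0 (max (f (Γ.src e) - (k + 1)) (f (Γ.tgt e) - (Γ.m - k)))

variable {f : B → ℤ} {hi : Set E} {c : ℤ}

@[simp] theorem extend_base (b : B) : Γ.extend f hi c (base b) = f b := rfl

theorem extend_mid_of_mem {e : E} (he : e ∈ hi) (k : ℕ) (hk : k < Γ.m) :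
    Γ.extend f hi c (mid e k hk) =
      min c (min (f (Γ.src e) + (k + 1)) (f (Γ.tgt e) + (Γ.m - k))) := by
  simp [extend, he]

theorem extend_mid_of_not_mem {e : E} (he : e ∉ hi) (k : ℕ) (hk : k < Γ.m) :
    Γ.extend f hi c (mid e k hk) =
      max 0 (max (f (Γ.src e) - (k + 1)) (f (Γ.tgt e) - (Γ.m - k))) := by
  simp [extend, he]

/-- Along a long edge the extension is built from truncated cones of slope one over the two ends. As
`f` takes values in $[0,c]$ with `c ≤ Γ.m`, the cone of one end cannot disturb the value at the
other. Such 1-Lipschitz functions certify all lower bounds on distances in the gadget. -/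
theorem extend_sub_le_of_adj (hf : ∀ b, 0 ≤ f b ∧ f b ≤ c) (hc : c ≤ Γ.m)
    (hs : ∀ x y, Γ.short x y → |f x - f y| ≤ 1) {x y : LongVertex B E Γ.m}
    (h : Γ.graph.Adj x y) : Γ.extend f hi c x - Γ.extend f hi c y ≤ 1 := by
  have key : ∀ x y, Γ.Step x y → |Γ.extend f hi c x - Γ.extend f hi c y| ≤ 1 := by
    intro x y h
    cases h with
    | short h => exact hs _ _ h
    | start e h =>
      have h1 := hf (Γ.src e)
      have h2 := hf (Γ.tgt e)
      by_cases he : e ∈ hi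
      · rw [Γ.extend_mid_of_mem he, extend_base]; push_cast; grind
      · rw [Γ.extend_mid_of_not_mem he, extend_base]; push_cast; grind
    | next e k h =>
      by_cases he : e ∈ hi
      · rw [Γ.extend_mid_of_mem he, Γ.extend_mid_of_mem he]; push_cast; grind
      · rw [Γ.extend_mid_of_not_mem he, Γ.extend_mid_of_not_mem he]; push_cast; grind
    | finish e k h hk =>
      have h1 := hf (Γ.src e)
      have h2 := hf (Γ.tgt e)
      have h3 : (Γ.m : ℤ) = k + 1 := by exact_mod_cast hk.symm
      by_cases he : e ∈ hi
      · rw [Γ.extend_mid_of_mem he, extend_base]; grind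
      · rw [Γ.extend_mid_of_not_mem he, extend_base]; grind
  rcases Γ.step_of_adj h with h | h
  · exact (abs_le.1 (key _ _ h)).2
  · have := (abs_le.1 (key _ _ h)).1
    linarith

theorem _root_.SimpleGraph.le_edist_of_sub_le {V : Type*} (G : SimpleGraph V) {f : V → ℤ}
    (hf : ∀ x y, G.Adj x y → f x - f y ≤ 1) {x y : V} {d : ℕ} (h : (d : ℤ) ≤ f x - f y) :
    (d : ℕ∞) ≤ G.edist x y := by
  refine le_iInf fun p => ?_
  have : f x - f y ≤ p.length := by
    clear h
    induction p with
    | nil => simp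
    | cons hadj p ih =>
      have := hf _ _ hadj
      rw [SimpleGraph.Walk.length_cons]
      push_cast
      linarith
  exact_mod_cast h.trans this

theorem le_edist_of_extend (hf : ∀ b, 0 ≤ f b ∧ f b ≤ c) (hc : c ≤ Γ.m)
    (hs : ∀ x y, Γ.short x y → |f x - f y| ≤ 1) {x y : LongVertex B E Γ.m} {d : ℕ}
    (h : (d : ℤ) ≤ Γ.extend f hi c x - Γ.extend f hi c y) : (d : ℕ∞) ≤ Γ.graph.edist x y :=
  Γ.graph.le_edist_of_sub_le (fun _ _ h => Γ.extend_sub_le_of_adj hf hc hs h) h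

end LongGraph

/-! ### Models of complete graphs and separations -/

/-- A model of the complete graph on `t` vertices: disjoint linked sets `U i`, and disjoint linked
sets `P i j` meeting `U i` and `U j` only. -/
structure CliqueModel {V : Type*} (G : SimpleGraph V) (t : ℕ) where
  U : Fin t → Set V
  P : Fin t → Fin t → Set V
  linked_U : ∀ i, G.Linked (U i)
  nonempty_U : ∀ i, (U i).Nonempty
  linked_P : ∀ i j, i ≠ j → G.Linked (P i j)
  symm_P : ∀ i j, P i j = P j i
  meet : ∀ i j, i ≠ j → (U i ∩ P i j).Nonempty
  disjoint_U : ∀ i j, i ≠ j → Disjoint (U i) (U j)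
  disjoint_P_U : ∀ i j k, i ≠ j → k ≠ i → k ≠ j → Disjoint (P i j) (U k)
  disjoint_P : ∀ i i' j, i ≠ j → i' ≠ j → i ≠ i' → Disjoint (P i j) (P i' j)

namespace CliqueModel

variable {V : Type*} {G : SimpleGraph V} {t : ℕ} (𝓜 : CliqueModel G t)

theorem card_le_of_meet {A : Fin t → Set V} {s : Finset (Fin t)} {F : Finset V}
    (hA : ∀ i ∈ s, ∀ j ∈ s, i ≠ j → Disjoint (A i) (A j))
    (hF : ∀ i ∈ s, ∃ x ∈ A i, x ∈ F) : s.card ≤ F.card := by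
  rcases s.eq_empty_or_nonempty with rfl | ⟨i₀, hi₀⟩
  · simp
  obtain ⟨x₀, -, -⟩ := hF i₀ hi₀
  have : Nonempty V := ⟨x₀⟩
  choose! g hg hgF using hF
  refine Finset.card_le_card_of_injOn g (fun i hi => hgF i hi) ?_
  intro i hi j hj hij
  by_contra hne
  exact Set.disjoint_left.1 (hA i hi j hj hne) (hg i hi) (hij ▸ hg j hj)

theorem exists_avoids (F : Finset V) (hF : F.card < t) : ∃ i, ∀ x ∈ 𝓜.U i, x ∉ F := by
  by_contra! h
  have := card_le_of_meet (A := 𝓜.U) (s := Finset.univ) (F := F)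
    (fun i _ j _ hij => 𝓜.disjoint_U i j hij) (fun i _ => h i)
  simp at this
  omega

/-- A linked set that avoids the separator cannot leave `C`. -/
theorem subset_of_meets {C F : Set V} (hCF : ∀ x ∈ C, ∀ y, G.Adj x y → y ∈ C ∪ F) {M : Set V}
    (hM : G.Linked M) (hF : ∀ x ∈ M, x ∉ F) (hC : ∃ x ∈ M, x ∈ C) : M ⊆ C := by
  obtain ⟨x, hx, hxC⟩ := hC
  intro y hy
  refine hM C ?_ x hx hxC y hy
  intro u _ v hv huC huv
  exact (hCF u huC v huv).resolve_right (hF v hv)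

/-- A small separation does not split a model of a large complete graph. -/
theorem meets_of_separates {C : Set V} {F : Finset V}
    (hCF : ∀ x ∈ C, ∀ y, G.Adj x y → y ∈ C ∪ F) (ht : 3 * F.card < t) {i j : Fin t}
    (hi : ∀ x ∈ 𝓜.U i, x ∉ F) (hiC : ∃ x ∈ 𝓜.U i, x ∈ C) (hj : ∀ x ∈ 𝓜.U j, x ∉ F) :
    ∃ x ∈ 𝓜.U j, x ∈ C := by
  classical
  by_contra hjC
  -- The set joining a branch set inside `C` to one outside has to cross the separator.
  have hP : ∀ i j, (∀ x ∈ 𝓜.U i, x ∉ F) → (∃ x ∈ 𝓜.U i, x ∈ C) → (¬ ∃ x ∈ 𝓜.U j, x ∈ C) →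
      ∃ x ∈ 𝓜.P i j, x ∈ F := by
    intro i j hi hiC hjC
    by_contra! hcon
    have hij : i ≠ j := by rintro rfl; exact hjC hiC
    have hUC : 𝓜.U i ⊆ C := subset_of_meets hCF (𝓜.linked_U i) hi hiC
    obtain ⟨x, hx, hxP⟩ := 𝓜.meet i j hij
    obtain ⟨y, hy, hyP⟩ := 𝓜.meet j i hij.symm
    rw [𝓜.symm_P] at hyP
    exact hjC ⟨y, hy, subset_of_meets hCF (𝓜.linked_P i j hij) hcon ⟨x, hxP, hUC hx⟩ hyP⟩
  -- Each index lies in `I`, `O` or `Z`, and each of these has at most `F.card` members. Members of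
  -- `Z` meet `F` disjointly; the sets joining `I` to `j`, or `O` to `i`, are disjoint and each
  -- meets `F`. This contradicts `3 * F.card < t`.
  set I : Finset (Fin t) := {k | (∀ x ∈ 𝓜.U k, x ∉ F) ∧ ∃ x ∈ 𝓜.U k, x ∈ C} with hI
  set O : Finset (Fin t) := {k | (∀ x ∈ 𝓜.U k, x ∉ F) ∧ ¬ ∃ x ∈ 𝓜.U k, x ∈ C} with hO
  set Z : Finset (Fin t) := {k | ¬ ∀ x ∈ 𝓜.U k, x ∉ F} with hZ
  have h1 : Z.card ≤ F.card := by
    refine card_le_of_meet (A := 𝓜.U) (fun i _ j _ hij => 𝓜.disjoint_U i j hij) ?_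
    intro k hk
    rw [hZ, Finset.mem_filter] at hk
    simpa using hk.2
  have h2 : I.card ≤ F.card := by
    have hne : ∀ k ∈ I, k ≠ j := by
      rintro k hk rfl
      exact hjC (Finset.mem_filter.1 hk).2.2
    refine card_le_of_meet (A := fun k => 𝓜.P k j)
      (fun k hk l hl hkl => 𝓜.disjoint_P k l j (hne k hk) (hne l hl) hkl) ?_
    intro k hk
    have := (Finset.mem_filter.1 hk).2
    exact hP k j this.1 this.2 hjC
  have h3 : O.card ≤ F.card := by
    have hne : ∀ k ∈ O, k ≠ i := by
      rintro k hk rfl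
      exact (Finset.mem_filter.1 hk).2.2 hiC
    refine card_le_of_meet (A := fun k => 𝓜.P k i)
      (fun k hk l hl hkl => 𝓜.disjoint_P k l i (hne k hk) (hne l hl) hkl) ?_
    intro k hk
    have := (Finset.mem_filter.1 hk).2
    rw [𝓜.symm_P]
    exact hP i k hi hiC this.2
  have h4 : (Finset.univ : Finset (Fin t)) ⊆ I ∪ O ∪ Z := by
    intro k _
    simp only [hI, hO, hZ, Finset.mem_union, Finset.mem_filter, Finset.mem_univ, true_and]
    tauto
  have h5 := Finset.card_le_card h4
  have h6 := Finset.card_union_le (I ∪ O) Z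
  have h7 := Finset.card_union_le I O
  rw [Finset.card_fin] at h5
  omega

end CliqueModel

/-! ### Branch sets and base vertices of a subdivided graph. -/

namespace LongGraph

open LongVertex

variable {B E : Type} (Γ : LongGraph B E) {t : ℕ} (𝓜 : CliqueModel Γ.graph t)

/-- The separation property of models of complete graphs, for base vertices. -/
theorem meets_hull_of_separates {C : Set B} {F : Finset B} (h : Γ.Separates C F)
    (ht : 3 * F.card < t) {i j : Fin t} (hi : ∀ b ∈ F, base b ∉ 𝓜.U i)
    (hiC : ∃ x ∈ 𝓜.U i, x ∈ Γ.hull C) (hj : ∀ b ∈ F, base b ∉ 𝓜.U j) :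
    ∃ x ∈ 𝓜.U j, x ∈ Γ.hull C := by
  classical
  have hav : ∀ k, (∀ b ∈ F, base b ∉ 𝓜.U k) → ∀ x ∈ 𝓜.U k, x ∉ F.image base := by
    intro k hk x hx hxF
    obtain ⟨b, hb, rfl⟩ := Finset.mem_image.1 hxF
    exact hk b hb hx
  refine 𝓜.meets_of_separates (C := Γ.hull C) (F := F.image base) ?_ ?_ (hav i hi) hiC (hav j hj)
  · simpa using h.adj
  · have := Finset.card_image_le (s := F) (f := (base : B → LongVertex B E Γ.m))
    omega

theorem exists_avoids_base (F : Finset B) (hF : F.card < t) : ∃ i, ∀ b ∈ F, base b ∉ 𝓜.U i := by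
  classical
  have := Finset.card_image_le (s := F) (f := (base : B → LongVertex B E Γ.m))
  obtain ⟨i, hi⟩ := 𝓜.exists_avoids (F.image base) (by omega)
  exact ⟨i, fun b hb h => hi _ h (Finset.mem_image_of_mem _ hb)⟩

/-- No branch set of a model of a large complete graph lies inside a long edge. -/
theorem exists_base_mem (ht : 6 < t) (i : Fin t) : ∃ b, base b ∈ 𝓜.U i := by
  classical
  by_contra! hcon
  obtain ⟨x, hx⟩ := 𝓜.nonempty_U i
  obtain ⟨e, k, hk, rfl⟩ : ∃ e k hk, x = mid e k hk := by
    cases x with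
    | base b => exact absurd hx (hcon b)
    | mid e k hk => exact ⟨e, k, hk, rfl⟩
  -- initial segments of the edge
  let C : ℕ → Set (LongVertex B E Γ.m) := fun p => {v | ∃ k hk, k < p ∧ v = mid e k hk}
  let z : ℕ → LongVertex B E Γ.m := fun p => if h : p < Γ.m then mid e p h else base (Γ.tgt e)
  let F : ℕ → Finset (LongVertex B E Γ.m) := fun p => {base (Γ.src e), z p}
  have hF : ∀ p, 3 * (F p).card < t := fun p => by
    have : (F p).card ≤ 2 := Finset.card_le_two
    omega
  have hCF : ∀ p ≤ Γ.m, ∀ x ∈ C p, ∀ y, Γ.graph.Adj x y → y ∈ C p ∪ F p := by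
    rintro p hp x ⟨k, hk, hkp, rfl⟩ y hxy
    rcases Γ.step_of_adj hxy with h | h
    · cases h with
      | next _ _ h =>
        rcases Nat.lt_or_ge (k + 1) p with h' | h'
        · exact Or.inl ⟨k + 1, h, h', rfl⟩
        · refine Or.inr ?_
          obtain rfl : p = k + 1 := by omega
          simp [F, z, h]
      | finish _ _ h hk' =>
        refine Or.inr ?_
        have : ¬ p < Γ.m := by omega
        simp [F, z, this]
    · cases h with
      | start => exact Or.inr (by simp [F])
      | next _ k h => exact Or.inl ⟨k, by omega, by omega, rfl⟩
  -- Take the shortest initial segment of the edge that meets a branch set avoiding its two-element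
  -- boundary. Initially this is the whole open edge, with the branch set `i`.
  have hex : ∃ p, p ≤ Γ.m ∧ ∃ j, (∀ x ∈ 𝓜.U j, x ∉ F p) ∧ ∃ x ∈ 𝓜.U j, x ∈ C p := by
    refine ⟨Γ.m, le_rfl, i, fun x hx hxF => ?_, _, hx, k, hk, hk, rfl⟩
    have : x = base (Γ.src e) ∨ x = base (Γ.tgt e) := by simpa [F, z] using hxF
    rcases this with rfl | rfl <;> exact hcon _ hx
  obtain ⟨hp, j, hj, hjC⟩ := Nat.find_spec hex
  have hmin := fun p => Nat.find_min hex (m := p)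
  set p := Nat.find hex
  obtain ⟨p', hp'⟩ : ∃ p', p = p' + 1 := by
    obtain ⟨x, -, k, -, hk, -⟩ := hjC
    exact ⟨p - 1, by omega⟩
  -- The separation does not split the model, so a branch set `l` that also avoids the last vertex
  -- of the segment still meets the segment. It then meets the segment shortened by one, against
  -- minimality.
  obtain ⟨l, hl⟩ := 𝓜.exists_avoids (insert (z p') (F p)) (by
    have := Finset.card_insert_le (z p') (F p)
    have : (F p).card ≤ 2 := Finset.card_le_two
    omega)
  obtain ⟨x, hx, k', hk', hkp, rfl⟩ := 𝓜.meets_of_separates (hCF p hp) (hF p) hj hjC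
    (j := l) fun x hx h => hl x hx (Finset.mem_insert_of_mem h)
  refine hmin p' (by omega) ⟨by omega, l, fun x hx h => ?_, _, hx, k', hk', ?_, rfl⟩
  · rcases Finset.mem_insert.1 h with rfl | h
    · exact hl _ hx (by simp [F])
    · rw [Finset.mem_singleton] at h
      exact hl x hx (by rw [h]; exact Finset.mem_insert_self _ _)
  · by_contra h
    obtain rfl : k' = p' := by omega
    refine hl _ hx ?_
    rw [Finset.mem_insert]
    exact Or.inl (by simp [z, hk'])

end LongGraph

/-! ### The gadget graph -/

/-- The base vertices of the gadget: a frame of twenty vertices, the nodes of a complete binary tree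
of height `n` (the `j`-th node of height `h`, so that the leaves have height zero), and a bottom row
of `2 ^ n` vertices. -/
inductive GadgetVertex (n : ℕ) : Type
  | frame (u : Fin 20) : GadgetVertex n
  | node (h j : ℕ) (hh : h ≤ n) (hj : j < 2 ^ (n - h)) : GadgetVertex n
  | bot (i : ℕ) (hi : i < 2 ^ n) : GadgetVertex n

/-- The three pairs of frame vertices that are not joined by an edge of the frame. -/
def FramePair (u v : Fin 20) : Prop := (u = 0 ∧ v = 1) ∨ (u = 2 ∧ v = 3) ∨ (u = 4 ∧ v = 5)

instance (u v : Fin 20) : Decidable (FramePair u v) := inferInstanceAs (Decidable (_ ∨ _))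

/-- The long edges of the gadget: those of the frame; those between consecutive columns (leaf to
bottom, bottom to leaf or bottom to bottom); those that attach the ends of the two rows and the root
of the tree to the frame. -/
inductive GadgetEdge (n : ℕ) : Type
  | fr (u v : Fin 20) (huv : u < v) (h : ¬ FramePair u v) : GadgetEdge n
  | gap (a b : Bool) (hab : (a && b) = false) (i : ℕ) (hi : i + 1 < 2 ^ n) : GadgetEdge n
  | start (x : Bool) : GadgetEdge n
  | finish (a x : Bool) : GadgetEdge n
  | apex (x : Bool) : GadgetEdge n

namespace Gadget

open LongVertex GadgetVertex GadgetEdge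

variable {n : ℕ}

/-- The `i`-th vertex of the top row (the leaves) or of the bottom row. -/
def lev : (a : Bool) → (i : ℕ) → i < 2 ^ n → GadgetVertex n
  | true, i, h => node 0 i (Nat.zero_le n) h
  | false, i, h => bot i h

/-- The root of the tree. -/
def root : GadgetVertex n := node n 0 le_rfl (by simp)

/-- The frame vertex where a strand of a given colour starts. -/
def startFrame (x : Bool) : Fin 20 := if x then 0 else 2

/-- The frame vertex where a strand of a given colour stops. -/
def finishFrame (x : Bool) : Fin 20 := if x then 1 else 3

/-- The two frame vertices attached to the root. -/
def apexFrame (x : Bool) : Fin 20 := if x then 4 else 5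

theorem last_lt (n : ℕ) : 2 ^ n - 1 < 2 ^ n := Nat.sub_lt (by positivity) one_pos

/-- The source of a long edge. -/
def src : GadgetEdge n → GadgetVertex n
  | fr u _ _ _ => frame u
  | gap a _ _ i hi => lev a i (Nat.lt_of_succ_lt hi)
  | start x => frame (startFrame x)
  | finish a _ => lev a (2 ^ n - 1) (last_lt n)
  | apex _ => root

/-- The target of a long edge. -/
def tgt : GadgetEdge n → GadgetVertex n
  | fr _ v _ _ => frame v
  | gap _ b _ i hi => lev b (i + 1) hi
  | start x => lev x 0 (by positivity)
  | finish _ x => frame (finishFrame x)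
  | apex x => frame (apexFrame x)

/-- The tree edges. -/
inductive Tree : GadgetVertex n → GadgetVertex n → Prop
  | up (h j : ℕ) (hh : h ≤ n) (hj : j < 2 ^ (n - h)) (hh' : h + 1 ≤ n)
      (hj' : j / 2 < 2 ^ (n - (h + 1))) : Tree (node h j hh hj) (node (h + 1) (j / 2) hh' hj')

/-- The gadget. -/
def gadget (n : ℕ) : LongGraph (GadgetVertex n) (GadgetEdge n) where
  short := Tree
  src := src
  tgt := tgt
  -- Room for stars of radius `n` at both ends of a long edge and for a middle piece that overlaps
  -- both stars.
  m := 4 * n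

@[simp] theorem gadget_src (e : GadgetEdge n) : (gadget n).src e = src e := rfl
@[simp] theorem gadget_tgt (e : GadgetEdge n) : (gadget n).tgt e = tgt e := rfl
theorem gadget_m : (gadget n).m = 4 * n := rfl

theorem frame_ne_lev {u : Fin 20} {a : Bool} {i : ℕ} {hi : i < 2 ^ n} : frame u ≠ lev a i hi := by
  cases a <;> simp [lev]

theorem frame_ne_root {u : Fin 20} : (frame u : GadgetVertex n) ≠ root := by simp [root]

/-! ### Blocks -/

/-- The block of the node `(h, j)`: the nodes below it, and the bottom vertices of its columns. -/
def block (h j : ℕ) : Set (GadgetVertex n) :=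
  {v | match v with
    | frame _ => False
    | node h' j' _ _ => h' ≤ h ∧ j' / 2 ^ (h - h') = j
    | bot i _ => i / 2 ^ h = j}

/-- The boundary of a block: its top node, and the ends of its two rows. -/
def blockBdry (h j : ℕ) : Set (GadgetVertex n) :=
  {v | match v with
    | frame _ => False
    | node h' j' _ _ => (h' = h ∧ j' = j) ∨ (h' = 0 ∧ (j' = j * 2 ^ h ∨ j' + 1 = (j + 1) * 2 ^ h))
    | bot i _ => i = j * 2 ^ h ∨ i + 1 = (j + 1) * 2 ^ h}

theorem lev_mem_block {h j i : ℕ} {a : Bool} {hi : i < 2 ^ n} :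
    lev a i hi ∈ block h j ↔ j * 2 ^ h ≤ i ∧ i < (j + 1) * 2 ^ h := by
  have h1 : i / 2 ^ h = j ↔ j * 2 ^ h ≤ i ∧ i < (j + 1) * 2 ^ h := by
    rw [Nat.div_eq_iff (by positivity)]
    have : 0 < 2 ^ h := by positivity
    have : (j + 1) * 2 ^ h = j * 2 ^ h + 2 ^ h := by ring
    omega
  rw [← h1]
  cases a <;> simp [lev, block]

theorem lev_mem_blockBdry {h j i : ℕ} {a : Bool} {hi : i < 2 ^ n}
    (hij : i = j * 2 ^ h ∨ i + 1 = (j + 1) * 2 ^ h) : lev a i hi ∈ blockBdry h j := by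
  cases a
  · exact hij
  · exact Or.inr ⟨rfl, hij⟩

theorem exists_finset_blockBdry (h j : ℕ) : ∃ F : Finset (GadgetVertex n), F.card ≤ 5 ∧
    (F : Set (GadgetVertex n)) = blockBdry h j := by
  classical
  let T : Finset (ℕ × ℕ) := {(h, j), (0, j * 2 ^ h), (0, (j + 1) * 2 ^ h - 1)}
  let T' : Finset ℕ := {j * 2 ^ h, (j + 1) * 2 ^ h - 1}
  -- Indices out of range are sent to a frame vertex, which the filter by `blockBdry` removes.
  let r : ℕ × ℕ → GadgetVertex n := fun p =>
    if hp : p.1 ≤ n ∧ p.2 < 2 ^ (n - p.1) then node p.1 p.2 hp.1 hp.2 else frame 0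
  let r' : ℕ → GadgetVertex n := fun i => if hi : i < 2 ^ n then bot i hi else frame 0
  refine ⟨(T.image r ∪ T'.image r').filter (· ∈ blockBdry h j), ?_, ?_⟩
  · have h1 : T.card ≤ 3 := Finset.card_le_three
    have h2 : T'.card ≤ 2 := Finset.card_le_two
    have h3 := Finset.card_filter_le (T.image r ∪ T'.image r') (· ∈ blockBdry h j)
    have h4 := Finset.card_union_le (T.image r) (T'.image r')
    have h5 := Finset.card_image_le (s := T) (f := r)
    have h6 := Finset.card_image_le (s := T') (f := r')
    omega
  · ext v
    simp only [Finset.coe_filter, Set.mem_ofPred_eq]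
    refine ⟨fun h => h.2, fun hv => ⟨?_, hv⟩⟩
    rw [Finset.mem_union, Finset.mem_image, Finset.mem_image]
    cases v with
    | frame u => exact hv.elim
    | node h' j' hh hj =>
      refine Or.inl ⟨(h', j'), ?_, by simp [r, hh, hj]⟩
      rcases hv with ⟨rfl, rfl⟩ | ⟨rfl, rfl | hv⟩
      · simp [T]
      · simp [T]
      · have : j' = (j + 1) * 2 ^ h - 1 := by omega
        simp [T, ← this]
    | bot i hi =>
      refine Or.inr ⟨i, ?_, by simp [r', hi]⟩
      rcases hv with rfl | hv
      · simp [T']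
      · have : i = (j + 1) * 2 ^ h - 1 := by omega
        simp [T', ← this]

theorem pow_sub_div_two {h' h j' : ℕ} (hh : h' + 1 ≤ h) :
    j' / 2 / 2 ^ (h - (h' + 1)) = j' / 2 ^ (h - h') := by
  have : h - h' = (h - (h' + 1)) + 1 := by omega
  rw [this, Nat.div_div_eq_div_mul, pow_succ']

/-- Tree edges leave a block only at its top node, and gap edges only at the ends of its rows. Long
edges to the frame start at the ends of the full rows or at the root, which lie on the boundary of
any block containing them. -/
theorem separates_block {h j : ℕ} (hh : h ≤ n) (hj : j < 2 ^ (n - h)) :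
    (gadget n).Separates (block h j \ blockBdry h j) (blockBdry h j) := by
  have hcup : block h j \ blockBdry h j ∪ blockBdry h j =
      (block h j ∪ blockBdry h j : Set (GadgetVertex n)) := by simp
  have hlev : ∀ {a i hi}, lev a i hi ∈ (block h j \ blockBdry h j : Set (GadgetVertex n)) →
      j * 2 ^ h < i ∧ i + 1 < (j + 1) * 2 ^ h := by
    intro a i hi ⟨h1, h2⟩
    rw [lev_mem_block] at h1
    by_contra hcon
    exact h2 (lev_mem_blockBdry (by omega))
  have hN : (j + 1) * 2 ^ h ≤ 2 ^ n := by
    calc (j + 1) * 2 ^ h ≤ 2 ^ (n - h) * 2 ^ h := Nat.mul_le_mul_right _ hj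
      _ = 2 ^ n := by rw [← pow_add]; congr 1; omega
  constructor
  · rintro _ _ ⟨h', j', hh', hj', hh2, hj2⟩
    rw [hcup]
    constructor
    · rintro ⟨⟨h1, h2⟩, h3⟩
      refine Or.inl ?_
      have h4 : h' ≠ h := by
        rintro rfl
        exact h3 (Or.inl ⟨rfl, by simpa using h2⟩)
      exact ⟨by omega, by rw [pow_sub_div_two (by omega)]; exact h2⟩
    · rintro ⟨⟨h1, h2⟩, h3⟩
      exact Or.inl ⟨by omega, by rw [← pow_sub_div_two (by omega)]; exact h2⟩
  · intro e
    rw [hcup]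
    cases e with
    | fr u v => exact ⟨fun h => h.1.elim, fun h => h.1.elim⟩
    | gap a b hab i hi =>
      constructor
      · intro h1
        have := hlev h1
        exact Or.inl (lev_mem_block.2 (by omega))
      · intro h1
        have := hlev h1
        exact Or.inl (lev_mem_block.2 (by omega))
    | start x =>
      exact ⟨fun h => h.1.elim, fun h1 => by have := hlev h1; omega⟩
    | finish a x =>
      exact ⟨fun h1 => by have := hlev h1; omega, fun h => h.1.elim⟩
    | apex x =>
      refine ⟨fun ⟨h1, h2⟩ => ?_, fun h => h.1.elim⟩
      obtain rfl : n = h := le_antisymm h1.1 hh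
      exact absurd (Or.inl ⟨rfl, by simpa using h1.2⟩) h2

theorem block_zero_subset (j : ℕ) : (block 0 j : Set (GadgetVertex n)) ⊆ blockBdry 0 j := by
  intro v hv
  cases v with
  | frame u => exact hv.elim
  | node h' j' hh hj =>
    obtain ⟨h1, h2⟩ := hv
    obtain rfl : h' = 0 := by omega
    exact Or.inl ⟨rfl, by simpa using h2⟩
  | bot i hi =>
    have : i / 2 ^ 0 = j := hv
    exact Or.inl (by simpa using this)

theorem block_succ_subset (h j : ℕ) : (block (h + 1) j : Set (GadgetVertex n)) ⊆
    blockBdry (h + 1) j ∪ block h (2 * j) ∪ block h (2 * j + 1) := by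
  intro v hv
  cases v with
  | frame u => exact hv.elim
  | node h' j' hh hj =>
    obtain ⟨h1, h2⟩ := hv
    by_cases h3 : h' = h + 1
    · subst h3
      exact Or.inl (Or.inl (Or.inl ⟨rfl, by simpa using h2⟩))
    · have h4 : h + 1 - h' = (h - h') + 1 := by omega
      rw [h4, pow_succ, ← Nat.div_div_eq_div_mul] at h2
      have h5 : j' / 2 ^ (h - h') = 2 * j ∨ j' / 2 ^ (h - h') = 2 * j + 1 := by omega
      rcases h5 with h5 | h5
      · exact Or.inl (Or.inr ⟨by omega, h5⟩)
      · exact Or.inr ⟨by omega, h5⟩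
  | bot i hi =>
    have h2 : i / 2 ^ (h + 1) = j := hv
    rw [pow_succ, ← Nat.div_div_eq_div_mul] at h2
    have h5 : i / 2 ^ h = 2 * j ∨ i / 2 ^ h = 2 * j + 1 := by omega
    rcases h5 with h5 | h5
    · exact Or.inl (Or.inr h5)
    · exact Or.inr h5

theorem mem_block_root {v : GadgetVertex n} (hv : ∀ u, v ≠ frame u) : v ∈ block n 0 := by
  cases v with
  | frame u => exact absurd rfl (hv u)
  | node h' j' hh hj => exact ⟨hh, Nat.div_eq_of_lt hj⟩
  | bot i hi => exact Nat.div_eq_of_lt hi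

/-- The frame vertices with a neighbour outside the frame separate it from the rest. -/
theorem separates_frame : (gadget n).Separates {v | ∀ u, v ≠ frame u}
    (frame '' {u : Fin 20 | u < 6}) := by
  have h1 : ∀ x, startFrame x < 6 := by decide
  have h2 : ∀ x, finishFrame x < 6 := by decide
  have h3 : ∀ x, apexFrame x < 6 := by decide
  constructor
  · rintro _ _ ⟨h', j', hh', hj', hh2, hj2⟩
    exact ⟨fun _ => Or.inl fun u => by simp, fun _ => Or.inl fun u => by simp⟩
  · intro e
    cases e with
    | fr u v => exact ⟨fun h => absurd rfl (h u), fun h => absurd rfl (h v)⟩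
    | gap a b hab i hi =>
      exact ⟨fun _ => Or.inl fun u => frame_ne_lev.symm, fun _ => Or.inl fun u => frame_ne_lev.symm⟩
    | start x => exact ⟨fun _ => Or.inl fun u => frame_ne_lev.symm, fun _ => Or.inr ⟨_, h1 x, rfl⟩⟩
    | finish a x => exact ⟨fun _ => Or.inr ⟨_, h2 x, rfl⟩, fun _ => Or.inl fun u => frame_ne_lev.symm⟩
    | apex x => exact ⟨fun _ => Or.inr ⟨_, h3 x, rfl⟩, fun _ => Or.inl fun u => frame_ne_root.symm⟩

end Gadget

/-! ### Every branch set contains a frame vertex. -/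

/-- Exchange of branch sets: some branch set avoids both `F` and the further set `D`, and since `F`
does not split the model it too lies on the side of `C`. Choosing as `D` the boundaries of smaller
pieces allows a descent. -/
theorem LongGraph.exists_base_mem_of_separates {B E : Type} (Γ : LongGraph B E) {t : ℕ}
    (𝓜 : CliqueModel Γ.graph t) (ht : 6 < t) {C : Set B} {F D : Finset B}
    (h : Γ.Separates C F) (hF : 3 * F.card < t) (hD : F.card + D.card < t) {i : Fin t}
    (hi : ∀ b ∈ F, LongVertex.base b ∉ 𝓜.U i) (hiC : ∃ b ∈ C, LongVertex.base b ∈ 𝓜.U i) :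
    ∃ k, (∀ b ∈ F, LongVertex.base b ∉ 𝓜.U k) ∧ (∀ b ∈ D, LongVertex.base b ∉ 𝓜.U k) ∧
      ∃ b ∈ C, LongVertex.base b ∈ 𝓜.U k := by
  classical
  obtain ⟨k, hk⟩ := Γ.exists_avoids_base 𝓜 (F ∪ D)
    ((Finset.card_union_le F D).trans_lt hD)
  have hkF : ∀ b ∈ F, LongVertex.base b ∉ 𝓜.U k := fun b hb => hk b (Finset.mem_union_left _ hb)
  obtain ⟨b, hb⟩ := Γ.exists_base_mem 𝓜 ht k
  obtain ⟨c, hc, hci⟩ := hiC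
  have := CliqueModel.subset_of_meets h.adj (𝓜.linked_U k)
    (fun x hx ⟨b, hb, hbx⟩ => hkF b hb (hbx ▸ hx))
    (Γ.meets_hull_of_separates 𝓜 h hF hi ⟨_, hci, hc⟩ hkF) hb
  exact ⟨k, hkF, fun b hb => hk b (Finset.mem_union_right _ hb), b, this, hb⟩

namespace Gadget

open LongVertex GadgetVertex GadgetEdge

variable {n : ℕ}

/-- No branch set that avoids the boundary of a block lives inside it. -/
theorem not_mem_of_block (𝓜 : CliqueModel (gadget n).graph 20) (h : ℕ) :
    ∀ j, h ≤ n → j < 2 ^ (n - h) → ∀ i, (∀ b ∈ blockBdry h j, base b ∉ 𝓜.U i) →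
      ∀ b ∈ block h j, base b ∉ 𝓜.U i := by
  classical
  induction h with
  | zero => exact fun j _ _ i hi b hb => hi b (block_zero_subset j hb)
  | succ h ih =>
    intro j hh hj i hi b hb hbi
    have hp : 2 ^ (n - h) = 2 * 2 ^ (n - (h + 1)) := by
      rw [← pow_succ']; congr 1; omega
    obtain ⟨F, hF, hF'⟩ := exists_finset_blockBdry (n := n) (h + 1) j
    obtain ⟨F₁, hF₁, hF₁'⟩ := exists_finset_blockBdry (n := n) h (2 * j)
    obtain ⟨F₂, hF₂, hF₂'⟩ := exists_finset_blockBdry (n := n) h (2 * j + 1)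
    have hm : ∀ b, b ∈ F ↔ b ∈ blockBdry (h + 1) j := fun b => by rw [← hF', Finset.mem_coe]
    have hm₁ : ∀ b, b ∈ F₁ ↔ b ∈ blockBdry h (2 * j) := fun b => by rw [← hF₁', Finset.mem_coe]
    have hm₂ : ∀ b, b ∈ F₂ ↔ b ∈ blockBdry h (2 * j + 1) := fun b => by
      rw [← hF₂', Finset.mem_coe]
    have hcard := Finset.card_union_le F₁ F₂
    -- Pass to a branch set that also avoids the boundaries of the two child blocks: $3\cdot 5 < 20$
    -- and $5 + 10 < 20$. It has a base vertex in one of the children, where the induction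
    -- hypothesis applies.
    obtain ⟨k, hkF, hkD, c, hc, hck⟩ := (gadget n).exists_base_mem_of_separates 𝓜 (by norm_num)
      (C := block (h + 1) j \ blockBdry (h + 1) j) (F := F) (D := F₁ ∪ F₂)
      (by rw [hF']; exact separates_block hh hj) (by omega) (by omega) (i := i)
      (fun b hb => hi b ((hm b).1 hb)) ⟨b, ⟨hb, fun h => hi b h hbi⟩, hbi⟩
    rcases block_succ_subset h j hc.1 with (h1 | h1) | h1
    · exact hc.2 h1
    · exact ih _ (by omega) (by omega) k
        (fun b hb => hkD b (Finset.mem_union_left _ ((hm₁ b).2 hb))) c h1 hck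
    · exact ih _ (by omega) (by omega) k
        (fun b hb => hkD b (Finset.mem_union_right _ ((hm₂ b).2 hb))) c h1 hck

/-- Only six frame vertices have neighbours outside the frame, and $3\cdot 6 < 20$. A branch set
missing the frame could be exchanged for one in the rest of the gadget that also avoids the boundary
of the block of the root, contrary to `not_mem_of_block`. -/
theorem exists_frame_mem (𝓜 : CliqueModel (gadget n).graph 20) (i : Fin 20) :
    ∃ u, base (frame u) ∈ 𝓜.U i := by
  classical
  by_contra! hcon
  obtain ⟨F, hF, hF'⟩ := exists_finset_blockBdry (n := n) n 0
  let D : Finset (GadgetVertex n) := ({u : Fin 20 | u < 6} : Finset (Fin 20)).image frame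
  have hD : D.card ≤ 6 := Finset.card_image_le.trans (by decide)
  obtain ⟨b, hb⟩ := (gadget n).exists_base_mem 𝓜 (by norm_num) i
  obtain ⟨k, hkF, hkD, c, hc, hck⟩ := (gadget n).exists_base_mem_of_separates 𝓜 (by norm_num)
    (C := {v | ∀ u, v ≠ frame u}) (F := D) (D := F)
    (by convert separates_frame (n := n); simp [D]) (by omega) (by omega) (i := i)
    (fun b hb => by
      obtain ⟨u, -, rfl⟩ := Finset.mem_image.1 hb
      exact hcon u) ⟨b, fun u h => hcon u (h ▸ hb), hb⟩
  refine not_mem_of_block 𝓜 n 0 le_rfl (by positivity) k (fun b hb => hkD b ?_) c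
    (mem_block_root hc) hck
  rw [← hF'] at hb
  exact hb

/-- The branch sets are in bijection with the frame. -/
theorem exists_index (𝓜 : CliqueModel (gadget n).graph 20) : ∃ g : Fin 20 → Fin 20,
    Function.Injective g ∧ ∀ u, base (frame u) ∈ 𝓜.U (g u) := by
  choose f hf using exists_frame_mem 𝓜
  have hinj : Function.Injective f := by
    intro i j hij
    by_contra hne
    exact Set.disjoint_left.1 (𝓜.disjoint_U i j hne) (hf i) (hij ▸ hf j)
  have hsurj := Finite.surjective_of_injective hinj
  choose g hg using hsurj
  refine ⟨g, fun u v h => by rw [← hg u, ← hg v, h], fun u => ?_⟩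
  have := hf (g u)
  rwa [hg] at this

end Gadget

/-! ### Strands in a fat model -/

theorem pathLength_symm_le {X : Type*} [EMetricSpace X] {x y : X} (γ : Path x y) :
    pathLength γ.symm ≤ pathLength γ := by
  have : (γ.symm : unitInterval → X) = γ ∘ unitInterval.symm := by ext; rfl
  unfold pathLength
  rw [this]
  exact eVariationOn.comp_le_of_antitoneOn _ _
    (fun s _ t _ h => unitInterval.symm_le_symm.2 h) (fun _ _ => Set.mem_univ _)

theorem setDist_comm {X : Type*} [EMetricSpace X] (A B : Set X) : setDist A B = setDist B A := by
  have key : ∀ A B : Set X, setDist A B ≤ setDist B A := fun A B =>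
    le_iInf₂ fun x hx => le_iInf₂ fun y hy => le_iInf fun γ =>
      (setDist_le hy hx γ.symm).trans (pathLength_symm_le γ)
  exact le_antisymm (key A B) (key B A)

theorem le_setDist_union {X : Type*} [EMetricSpace X] {A A' B : Set X} {c : ℝ≥0∞}
    (h : c ≤ setDist A B) (h' : c ≤ setDist A' B) : c ≤ setDist (A ∪ A') B := by
  refine le_iInf₂ fun x hx => le_iInf₂ fun y hy => le_iInf fun γ => ?_
  rcases hx with hx | hx
  · exact h.trans (setDist_le hx hy γ)
  · exact h'.trans (setDist_le hx hy γ)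

namespace FatMinorModel

variable {V : Type} {G : SimpleGraph V} {t : ℕ}
  (𝓕 : FatMinorModel (⊤ : SimpleGraph (Fin t)) 3 (GraphSpace G))

/-- The set of the edge `ij` of a model of a complete graph. -/
def edgePart (i j : Fin t) : Set (GraphSpace G) :=
  if h : i ≠ j then 𝓕.P ⟨s(i, j), by simpa using h⟩ else ∅

theorem edgePart_of_ne {i j : Fin t} (h : i ≠ j) :
    𝓕.edgePart i j = 𝓕.P ⟨s(i, j), by simpa using h⟩ := dif_pos h

theorem edgePart_comm (i j : Fin t) : 𝓕.edgePart i j = 𝓕.edgePart j i := by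
  by_cases h : i = j
  · rw [h]
  · rw [𝓕.edgePart_of_ne h, 𝓕.edgePart_of_ne (Ne.symm h)]
    congr 2
    exact Sym2.eq_swap

theorem three_le_B_B {i j : Fin t} (h : i ≠ j) : 3 ≤ setDist (𝓕.B i) (𝓕.B j) := by
  simpa using 𝓕.le_setDist_B_B i j h

theorem three_le_B_P {i j k : Fin t} (h : i ≠ j) (hi : k ≠ i) (hj : k ≠ j) :
    3 ≤ setDist (𝓕.B k) (𝓕.edgePart i j) := by
  rw [𝓕.edgePart_of_ne h]
  simpa using 𝓕.le_setDist_B_P k ⟨s(i, j), by simpa using h⟩ (by simp [hi, hj])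

theorem three_le_P_P {i j k l : Fin t} (h : i ≠ j) (h' : k ≠ l) (hne : s(i, j) ≠ s(k, l)) :
    3 ≤ setDist (𝓕.edgePart i j) (𝓕.edgePart k l) := by
  rw [𝓕.edgePart_of_ne h, 𝓕.edgePart_of_ne h']
  simpa using 𝓕.le_setDist_P_P ⟨s(i, j), by simpa using h⟩ ⟨s(k, l), by simpa using h'⟩
    (by simpa using hne)

theorem inter_edgePart {i j : Fin t} (h : i ≠ j) : (𝓕.B i ∩ 𝓕.edgePart i j).Nonempty := by
  rw [𝓕.edgePart_of_ne h]
  exact 𝓕.inter_nonempty _ _ (by simp)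

theorem isPathConnected_edgePart {i j : Fin t} (h : i ≠ j) :
    IsPathConnected (𝓕.edgePart i j) := by
  rw [𝓕.edgePart_of_ne h]
  exact 𝓕.isPathConnected_P _

/-- The combinatorial model given by the vertices that the sets of a 3-fat model touch. -/
noncomputable def toCliqueModel : CliqueModel G t where
  U i := GraphSpace.touched (𝓕.B i)
  P i j := GraphSpace.touched (𝓕.edgePart i j)
  linked_U i := GraphSpace.linked_touched (𝓕.isPathConnected_B i).isConnected.isPreconnected
  nonempty_U i := GraphSpace.touched_nonempty (𝓕.isPathConnected_B i).nonempty
  linked_P i j h :=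
    GraphSpace.linked_touched (𝓕.isPathConnected_edgePart h).isConnected.isPreconnected
  symm_P i j := by rw [edgePart_comm]
  meet i j h := GraphSpace.touched_inter_of_inter (𝓕.inter_edgePart h)
  disjoint_U i j h := GraphSpace.touched_disjoint (𝓕.three_le_B_B h)
  disjoint_P_U i j k h hi hj :=
    GraphSpace.touched_disjoint (by rw [setDist_comm]; exact 𝓕.three_le_B_P h hi hj)
  disjoint_P i i' j h h' hne :=
    GraphSpace.touched_disjoint (𝓕.three_le_P_P h h' (by
      intro h3
      rcases Sym2.eq_iff.1 h3 with h3 | h3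
      · exact hne h3.1
      · exact h h3.1))

/-- The union of two branch sets and of the set of the edge between them. -/
def strand (i j : Fin t) : Set (GraphSpace G) := 𝓕.B i ∪ 𝓕.edgePart i j ∪ 𝓕.B j

theorem isPreconnected_strand {i j : Fin t} (h : i ≠ j) : IsPreconnected (𝓕.strand i j) := by
  have h1 := (𝓕.isPathConnected_B i).union (𝓕.isPathConnected_edgePart h) (𝓕.inter_edgePart h)
  obtain ⟨p, hp, hp'⟩ := 𝓕.inter_edgePart h.symm
  rw [𝓕.edgePart_comm] at hp'
  exact (h1.union (𝓕.isPathConnected_B j) ⟨p, Or.inr hp', hp⟩).isConnected.isPreconnected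

/-- For disjoint pairs no constituent of one strand is incident with one of the other, so fatness
bounds all nine distances. -/
theorem three_le_strand {i j k l : Fin t} (hij : i ≠ j) (hkl : k ≠ l) (hik : i ≠ k) (hil : i ≠ l)
    (hjk : j ≠ k) (hjl : j ≠ l) : 3 ≤ setDist (𝓕.strand i j) (𝓕.strand k l) := by
  have h1 : ∀ a, a ≠ k → a ≠ l → 3 ≤ setDist (𝓕.B a) (𝓕.strand k l) := by
    intro a hk hl
    rw [setDist_comm]
    refine le_setDist_union (le_setDist_union ?_ ?_) ?_
    · exact 𝓕.three_le_B_B (Ne.symm hk)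
    · rw [setDist_comm]; exact 𝓕.three_le_B_P hkl hk hl
    · exact 𝓕.three_le_B_B (Ne.symm hl)
  refine le_setDist_union (le_setDist_union (h1 i hik hil) ?_) (h1 j hjk hjl)
  rw [setDist_comm]
  refine le_setDist_union (le_setDist_union ?_ ?_) ?_
  · exact 𝓕.three_le_B_P hij hik.symm hjk.symm
  · refine 𝓕.three_le_P_P hkl hij fun h => ?_
    rcases Sym2.eq_iff.1 h with h | h
    · exact hik h.1.symm
    · exact hjk h.1.symm
  · exact 𝓕.three_le_B_P hij hil.symm hjl.symm

end FatMinorModel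

namespace Gadget

open LongVertex GadgetVertex GadgetEdge GraphSpace

variable {n : ℕ}

/-- A 3-fat model of the complete graph on twenty vertices contains, for each pair of frame vertices
not joined by an edge, a connected set touching these two frame vertices and no others; such sets
are far apart for different pairs. -/
theorem exists_strands (𝓕 : FatMinorModel (⊤ : SimpleGraph (Fin 20)) 3
    (GraphSpace (gadget n).graph)) : ∃ S : Fin 20 → Fin 20 → Set (GraphSpace (gadget n).graph),
    (∀ u v, u ≠ v → IsPreconnected (S u v)) ∧
    (∀ u v u' v', u ≠ v → u' ≠ v' → u ≠ u' → u ≠ v' → v ≠ u' → v ≠ v' →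
      3 ≤ setDist (S u v) (S u' v')) ∧
    ∀ u v w, u ≠ v → (base (frame w) ∈ touched (S u v) ↔ w = u ∨ w = v) := by
  obtain ⟨g, hg, hgU⟩ := exists_index 𝓕.toCliqueModel
  refine ⟨fun u v => 𝓕.strand (g u) (g v), fun u v h => 𝓕.isPreconnected_strand (hg.ne h),
    fun u v u' v' h1 h2 h3 h4 h5 h6 => 𝓕.three_le_strand (hg.ne h1) (hg.ne h2) (hg.ne h3)
      (hg.ne h4) (hg.ne h5) (hg.ne h6), fun u v w h => ?_⟩
  simp only [FatMinorModel.strand, touched_union]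
  constructor
  · intro hw
    by_contra! hcon
    rcases hw with (hw | hw) | hw
    · exact Set.disjoint_left.1 (𝓕.toCliqueModel.disjoint_U _ _ (hg.ne hcon.1)) (hgU w) hw
    · exact Set.disjoint_left.1 (𝓕.toCliqueModel.disjoint_P_U _ _ _ (hg.ne h) (hg.ne hcon.1)
        (hg.ne hcon.2)) hw (hgU w)
    · exact Set.disjoint_left.1 (𝓕.toCliqueModel.disjoint_U _ _ (hg.ne hcon.2)) (hgU w) hw
  · rintro (rfl | rfl)
    · exact Or.inl (Or.inl (hgU w))
    · exact Or.inr (hgU w)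

/-- The vertices outside the frame that are joined to the frame vertex `u` by a long edge. -/
def ports (u : Fin 20) : Set (GadgetVertex n) :=
  {c | (∃ x, u = startFrame x ∧ c = lev x 0 (by positivity)) ∨
    (∃ a x, u = finishFrame x ∧ c = lev a (2 ^ n - 1) (last_lt n)) ∨
    ∃ x, u = apexFrame x ∧ c = root}

/-- A connected set that touches a frame vertex and a single other one, to which it is not adjacent,
contains a port of the first one. -/
theorem exists_port_mem {S : Set (GraphSpace (gadget n).graph)} (hS : IsPreconnected S)
    {u v : Fin 20} (huv : u ≠ v) (hp : FramePair u v ∨ FramePair v u)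
    (hSf : ∀ w, base (frame w) ∈ touched S ↔ w = u ∨ w = v) :
    ∃ c ∈ ports u, base c ∈ verts S := by
  -- The pair `u`, `v` is not an edge of the frame, so `v` need not be in the separator. The other
  -- frame vertices in it are not touched by `S`, so the separating vertex found must be a port.
  have hsep : (gadget n).Separates {frame u}
      (ports u ∪ {c | ∃ w, c = frame w ∧ w ≠ u ∧ w ≠ v}) := by
    constructor
    · rintro _ _ ⟨h', j', hh', hj', hh2, hj2⟩
      exact ⟨fun h => by simp at h, fun h => by simp at h⟩
    · intro e
      cases e with
      | fr a b hab h =>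
        constructor
        · intro (h1 : frame a = frame u)
          obtain rfl : a = u := by simpa using h1
          refine Or.inr (Or.inr ⟨b, rfl, hab.ne', ?_⟩)
          rintro rfl
          rcases hp with hp | hp
          · exact h hp
          · unfold FramePair at hp
            rcases hp with ⟨rfl, rfl⟩ | ⟨rfl, rfl⟩ | ⟨rfl, rfl⟩ <;> exact absurd hab (by decide)
        · intro (h1 : frame b = frame u)
          obtain rfl : b = u := by simpa using h1
          refine Or.inr (Or.inr ⟨a, rfl, hab.ne, ?_⟩)
          rintro rfl
          rcases hp with hp | hp
          · unfold FramePair at hp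
            rcases hp with ⟨rfl, rfl⟩ | ⟨rfl, rfl⟩ | ⟨rfl, rfl⟩ <;> exact absurd hab (by decide)
          · exact h hp
      | gap a b hab i hi =>
        exact ⟨fun h => absurd h.symm frame_ne_lev, fun h => absurd h.symm frame_ne_lev⟩
      | start x =>
        refine ⟨fun (h : frame (startFrame x) = frame u) => ?_, fun h => absurd h.symm frame_ne_lev⟩
        exact Or.inr (Or.inl (Or.inl ⟨x, by simpa using h.symm, rfl⟩))
      | finish a x =>
        refine ⟨fun h => absurd h.symm frame_ne_lev, fun (h : frame (finishFrame x) = frame u) => ?_⟩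
        exact Or.inr (Or.inl (Or.inr (Or.inl ⟨a, x, by simpa using h.symm, rfl⟩)))
      | apex x =>
        refine ⟨fun h => absurd h.symm frame_ne_root, fun (h : frame (apexFrame x) = frame u) => ?_⟩
        exact Or.inr (Or.inl (Or.inr (Or.inr ⟨x, by simpa using h.symm, rfl⟩)))
  have hport : ∀ w, frame w ∉ (ports u : Set (GadgetVertex n)) := by
    rintro w (⟨x, -, h⟩ | ⟨a, x, -, h⟩ | ⟨x, -, h⟩)
    · exact frame_ne_lev h
    · exact frame_ne_lev h
    · exact frame_ne_root h
  have hu : base (frame u) ∉ (base '' (ports u ∪ {c | ∃ w, c = frame w ∧ w ≠ u ∧ w ≠ v}) :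
      Set (LongVertex (GadgetVertex n) (GadgetEdge n) (gadget n).m)) := by
    rintro ⟨c, hc, h⟩
    obtain rfl : c = frame u := by simpa using h
    rcases hc with hc | ⟨w, h, hw, -⟩
    · exact hport u hc
    · exact hw (by simpa using h.symm)
  have hv : base (frame v) ∉ (gadget n).hull {frame u} ∪
      base '' (ports u ∪ {c | ∃ w, c = frame w ∧ w ≠ u ∧ w ≠ v}) := by
    rintro (h | ⟨c, hc, h⟩)
    · have : frame v = (frame u : GadgetVertex n) := h
      exact huv (by simpa using this.symm)
    · obtain rfl : c = frame v := by simpa using h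
      rcases hc with hc | ⟨w, h, -, hw⟩
      · exact hport v hc
      · exact hw (by simpa using h.symm)
  obtain ⟨_, ⟨c, hc, rfl⟩, hcS⟩ := exists_mem_verts_of_separates hS hsep.adj
    ((hSf u).2 (Or.inl rfl)) rfl hu ((hSf v).2 (Or.inr rfl)) hv
  rcases hc with hc | ⟨w, rfl, hw, hw'⟩
  · exact ⟨c, hc, hcS⟩
  · have := (hSf w).1 (verts_subset_touched S hcS)
    tauto

end Gadget

/-! ### Walks in the binary tree -/

namespace NodeTree

/-- A step along an edge of the infinite binary tree between members of `M`; the parent of the node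
`(h, j)` is `(h + 1, j / 2)`. -/
def TreeStep (M : Set (ℕ × ℕ)) (a b : ℕ × ℕ) : Prop :=
  a ∈ M ∧ b ∈ M ∧ (b = (a.1 + 1, a.2 / 2) ∨ a = (b.1 + 1, b.2 / 2))

/-- Two nodes are joined in `M` if there is a tree walk in `M` between them. -/
def NodeJoined (M : Set (ℕ × ℕ)) : ℕ × ℕ → ℕ × ℕ → Prop := Relation.ReflTransGen (TreeStep M)

theorem NodeJoined.symm {M : Set (ℕ × ℕ)} {a b : ℕ × ℕ} (h : NodeJoined M a b) :
    NodeJoined M b a := by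
  induction h with
  | refl => exact .refl
  | tail _ h ih => exact .head ⟨h.2.1, h.1, h.2.2.symm⟩ ih

/-- The subtree below the node `(h, j)`. -/
def below (h j : ℕ) : Set (ℕ × ℕ) := {p | p.1 ≤ h ∧ p.2 / 2 ^ (h - p.1) = j}

theorem leaf_mem_below {h j i : ℕ} : (0, i) ∈ below h j ↔ j * 2 ^ h ≤ i ∧ i < (j + 1) * 2 ^ h := by
  have h1 : i / 2 ^ h = j ↔ j * 2 ^ h ≤ i ∧ i < (j + 1) * 2 ^ h := by
    rw [Nat.div_eq_iff (by positivity)]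
    have : 0 < 2 ^ h := by positivity
    have : (j + 1) * 2 ^ h = j * 2 ^ h + 2 ^ h := by ring
    omega
  rw [← h1]
  simp [below]

/-- A walk that leaves a subtree goes through its top node and the parent of this node. -/
theorem NodeJoined.mem_of_exit {M : Set (ℕ × ℕ)} {a b : ℕ × ℕ} (hab : NodeJoined M a b) {h j : ℕ}
    (ha : a ∈ below h j) (hb : b ∉ below h j) : (h, j) ∈ M ∧ (h + 1, j / 2) ∈ M := by
  induction hab with
  | refl => exact absurd ha hb
  | @tail b c _ hbc ih =>
    by_cases hb' : b ∈ below h j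
    · obtain ⟨hbM, hcM, rfl | hbc⟩ := hbc
      · obtain ⟨h1, h2⟩ := hb'
        obtain ⟨k, i⟩ := b
        by_cases hk : k = h
        · subst hk
          obtain rfl : i = j := by simpa using h2
          exact ⟨hbM, hcM⟩
        · have h1' : k + 1 ≤ h := by
            have : k ≤ h := h1
            omega
          refine absurd ⟨h1', ?_⟩ hb
          change i / 2 / 2 ^ (h - (k + 1)) = j
          rw [Gadget.pow_sub_div_two h1']
          exact h2
      · subst hbc
        obtain ⟨h1, h2⟩ := hb'
        obtain ⟨k, i⟩ := c
        have h1' : k + 1 ≤ h := h1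
        refine absurd ⟨(by omega : k ≤ h), ?_⟩ hb
        change i / 2 ^ (h - k) = j
        rw [← Gadget.pow_sub_div_two h1']
        exact h2
    · exact ih hb'

/-- The gap between the leaves `g` and `g + 1` is jumped by `M` if some leaves on both sides of it
are joined in `M`. -/
def Jumps (M : Set (ℕ × ℕ)) (g : ℕ) : Prop := ∃ p q, p ≤ g ∧ g < q ∧ NodeJoined M (0, p) (0, q)

/-- Two disjoint sets of nodes that do not contain the root, contain no two siblings one of each,
and contain one each of any two consecutive leaves between which none jumps, do not exist. -/
theorem false_of_two_sets {n : ℕ} (hn : 1 ≤ n) (M : Bool → Set (ℕ × ℕ))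
    (hdisj : ∀ x p, p ∈ M x → p ∉ M !x) (hfar : ∀ x h j, h < n → (h, 2 * j) ∈ M x →
      (h, 2 * j + 1) ∉ M !x) (hroot : ∀ x, (n, 0) ∉ M x)
    (hgap : ∀ g, g + 1 < 2 ^ n → (∀ x, ¬ Jumps (M x) g) →
      ∃ x, (0, g) ∈ M x ∧ (0, g + 1) ∈ M !x) : False := by
  classical
  -- `k + 1` is the least height of a node whose middle gap is unjumped. The root is such a node: a
  -- jump over its middle gap would leave the left half of the tree through the root, which belongs
  -- to neither set.
  have hex : ∃ k, k < n ∧ ∃ j < 2 ^ (n - (k + 1)), ∀ x, ¬ Jumps (M x) ((2 * j + 1) * 2 ^ k - 1) := by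
    refine ⟨n - 1, by omega, 0, by positivity, ?_⟩
    rintro x ⟨p, q, hp, hq, hpq⟩
    have hpos : 0 < 2 ^ (n - 1) := by positivity
    have := (NodeJoined.mem_of_exit hpq (h := n - 1) (j := 0) (leaf_mem_below.2 (by omega))
      (by rw [leaf_mem_below]; omega)).2
    rw [Nat.sub_add_cancel hn] at this
    exact hroot x this
  obtain ⟨hk, j, hj, hjump⟩ := Nat.find_spec hex
  have hmin := fun k => Nat.find_min hex (m := k)
  set k := Nat.find hex
  have hmin' : ∀ i < k, ∀ J < 2 ^ (n - (i + 1)), ∃ x, Jumps (M x) ((2 * J + 1) * 2 ^ i - 1) := by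
    intro i hi J hJ
    by_contra! hcon
    exact hmin i hi ⟨by omega, J, hJ, hcon⟩
  have hjN : 2 * j + 2 ≤ 2 ^ (n - k) := by
    have : 2 ^ (n - k) = 2 * 2 ^ (n - (k + 1)) := by rw [← pow_succ']; congr 1; omega
    omega
  have hN : (2 * j + 2) * 2 ^ k ≤ 2 ^ n := by
    calc _ ≤ 2 ^ (n - k) * 2 ^ k := Nat.mul_le_mul_right _ hjN
      _ = 2 ^ n := by rw [← pow_add]; congr 1; omega
  have hkpos : 0 < 2 ^ k := by positivity
  have hg1 : (2 * j + 2) * 2 ^ k = (2 * j + 1) * 2 ^ k + 2 ^ k := by ring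
  have hg0 : 2 ^ k ≤ (2 * j + 1) * 2 ^ k := Nat.le_mul_of_pos_left _ (by omega)
  obtain ⟨x, hx, hy⟩ := hgap ((2 * j + 1) * 2 ^ k - 1) (by omega) hjump
  rw [Nat.sub_add_cancel (by omega)] at hy
  -- the spines of the two children of the node
  have hspine : ∀ i ≤ k, (i, (2 * j + 1) * 2 ^ (k - i) - 1) ∈ M x ∧
      (i, (2 * j + 1) * 2 ^ (k - i)) ∈ M !x := by
    intro i
    induction i with
    | zero => exact fun _ => ⟨by simpa using hx, by simpa using hy⟩
    | succ i ih =>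
      intro hi
      obtain ⟨ih1, ih2⟩ := ih (by omega)
      set A := (2 * j + 1) * 2 ^ (k - (i + 1)) with hA
      have hA1 : (2 * j + 1) * 2 ^ (k - i) = 2 * A := by
        have : k - i = (k - (i + 1)) + 1 := by omega
        rw [this, pow_succ, hA]; ring
      have hA2 : 2 * A * 2 ^ i = (2 * j + 1) * 2 ^ k := by
        rw [← hA1, mul_assoc, ← pow_add]; congr 2; omega
      have hA3 : A + 1 ≤ 2 ^ (n - (i + 1)) := by
        have h1 : 2 ^ (n - k) * 2 ^ (k - (i + 1)) = 2 ^ (n - (i + 1)) := by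
          rw [← pow_add]; congr 1; omega
        have h2 : (2 * j + 2) * 2 ^ (k - (i + 1)) ≤ 2 ^ (n - k) * 2 ^ (k - (i + 1)) :=
          Nat.mul_le_mul_right _ hjN
        have h3 : (2 * j + 2) * 2 ^ (k - (i + 1)) = A + 2 ^ (k - (i + 1)) := by rw [hA]; ring
        have h4 : 0 < 2 ^ (k - (i + 1)) := by positivity
        omega
      have hA0 : 1 ≤ A := by rw [hA]; exact Nat.mul_pos (by omega) (by positivity)
      have hipos : 0 < 2 ^ i := by positivity
      rw [hA1] at ih1 ih2
      constructor
      · obtain ⟨J, hJ⟩ : ∃ J, A = J + 1 := ⟨A - 1, by omega⟩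
        rw [hJ] at ih1 hA2 ⊢
        rw [show 2 * (J + 1) - 1 = 2 * J + 1 by omega] at ih1
        -- By minimality the middle gap of the node `(i + 1, J)` is jumped by some `M z`. The right
        -- end `q` of the jump stays left of the chosen unjumped gap, hence below the right child
        -- `(i, 2 * J + 1)`. The walk leaves this subtree through the child and its parent. The
        -- child already belongs to `M x`, so `z = x` and the parent belongs to `M x` too.
        obtain ⟨z, p, q, hp, hq, hpq⟩ := hmin' i (by omega) J (by omega)
        have e1 : 2 * (J + 1) * 2 ^ i = (2 * J + 1) * 2 ^ i + 2 ^ i := by ring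
        have e2 : (2 * J + 1 + 1) * 2 ^ i = (2 * J + 1) * 2 ^ i + 2 ^ i := by ring
        have e3 : 0 < (2 * J + 1) * 2 ^ i := by positivity
        have hqg : q ≤ (2 * j + 1) * 2 ^ k - 1 := by
          by_contra hcon
          exact hjump z ⟨p, q, by omega, by omega, hpq⟩
        obtain ⟨h1, h2⟩ := NodeJoined.mem_of_exit (NodeJoined.symm hpq) (h := i) (j := 2 * J + 1)
          (leaf_mem_below.2 (by omega)) (by rw [leaf_mem_below]; omega)
        have hzx : z = x := by
          by_contra hne
          have hz : z = !x := Bool.eq_not.2 hne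
          exact hdisj x _ ih1 (by rw [← hz]; exact h1)
        rw [← hzx]
        rwa [show (2 * J + 1) / 2 = J + 1 - 1 by omega] at h2
      · obtain ⟨z, p, q, hp, hq, hpq⟩ := hmin' i (by omega) A (by omega)
        have e1 : (2 * A + 1) * 2 ^ i = 2 * A * 2 ^ i + 2 ^ i := by ring
        have hpg : (2 * j + 1) * 2 ^ k ≤ p := by
          by_contra hcon
          exact hjump z ⟨p, q, by omega, by omega, hpq⟩
        obtain ⟨h1, h2⟩ := NodeJoined.mem_of_exit hpq (h := i) (j := 2 * A)
          (leaf_mem_below.2 (by omega)) (by rw [leaf_mem_below]; omega)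
        have hzx : z = !x := by
          by_contra hne
          have hz : z = x := Bool.ne_not.1 hne
          exact hdisj z _ h1 (by rw [hz]; exact ih2)
        rw [← hzx]
        rwa [show 2 * A / 2 = A by omega] at h2
  -- At height `k` the two spines end in siblings.
  have := hspine k le_rfl
  simp only [Nat.sub_self, pow_zero, mul_one, Nat.add_sub_cancel] at this
  exact hfar x k j hk this.1 this.2

end NodeTree

/-! ### The two strands at a gap, and the absence of a 3-fat clique. -/

namespace Gadget

open LongVertex GadgetVertex GadgetEdge GraphSpace NodeTree

variable {n : ℕ}

/-- The tree nodes in a set of vertices. -/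
def nodes (M : Set (LongVertex (GadgetVertex n) (GadgetEdge n) (gadget n).m)) : Set (ℕ × ℕ) :=
  {p | ∃ hh hj, base (node p.1 p.2 hh hj) ∈ M}

/-- A linked set of vertices that runs from one end of the rows to the other contains, at each gap
it does not jump, both ends of a long edge over the gap. -/
theorem exists_gap_mem {M : Set (LongVertex (GadgetVertex n) (GadgetEdge n) (gadget n).m)}
    (hM : (gadget n).graph.Linked M) (x : Bool)
    (hf : ∀ u, base (frame u) ∈ M → u = startFrame x ∨ u = finishFrame x)
    (hroot : base root ∉ M) (hstart : base (lev x 0 (by positivity)) ∈ M)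
    {a : Bool} (hfinish : base (lev a (2 ^ n - 1) (last_lt n)) ∈ M)
    {g : ℕ} (hg : g + 1 < 2 ^ n) (hjump : ¬ Jumps (nodes M) g) :
    ∃ a b, (a && b) = false ∧ base (lev a g (Nat.lt_of_succ_lt hg)) ∈ M ∧
      base (lev b (g + 1) hg) ∈ M := by
  by_contra! hcon
  -- The part to the left of the gap. A tree node is on the left if it is joined to a leaf on the
  -- left; as `M` does not jump the gap, no leaf on the right is. Only long edges over the gap could
  -- then lead out of `L` within `M`.
  let L : Set (GadgetVertex n) := {v | match v with
    | frame u => u = 0 ∨ u = 2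
    | node h j _ _ => ∃ p ≤ g, NodeJoined (nodes M) (0, p) (h, j)
    | bot i _ => i ≤ g}
  have hlevL : ∀ {a i hi}, i ≤ g → lev a i hi ∈ L := by
    intro a i hi hig
    cases a
    · exact hig
    · exact ⟨i, hig, .refl⟩
  have hlevL' : ∀ {a i hi}, g < i → lev a i hi ∉ L := by
    intro a i hi hig h
    cases a
    · have : i ≤ g := h
      omega
    · obtain ⟨p, hp, hpi⟩ := h
      exact hjump ⟨p, i, hp, hig, hpi⟩
  refine hlevL' (by omega) ((gadget n).mem_of_linked hM (L := L) ?_ ?_ hstart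
    (hlevL (Nat.zero_le g)) hfinish)
  · rintro _ _ ⟨h, j, hh, hj, hh', hj'⟩ hx hy
    have h1 : (h, j) ∈ nodes M := ⟨hh, hj, hx⟩
    have h2 : (h + 1, j / 2) ∈ nodes M := ⟨hh', hj', hy⟩
    constructor
    · rintro ⟨p, hp, hpj⟩
      exact ⟨p, hp, hpj.tail ⟨h1, h2, Or.inl rfl⟩⟩
    · rintro ⟨p, hp, hpj⟩
      exact ⟨p, hp, hpj.tail ⟨h2, h1, Or.inr rfl⟩⟩
  · intro e h1 h2 _
    cases e with
    | fr u v huv h =>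
      exfalso
      -- The only frame vertices `M` may contain are the two ends of its strand, and these form a
      -- missing pair.
      have key : ∀ x, ¬ finishFrame x < startFrame x ∧ FramePair (startFrame x) (finishFrame x) := by
        decide
      rcases hf u h1 with rfl | rfl <;> rcases hf v h2 with rfl | rfl
      · exact absurd huv (lt_irrefl _)
      · exact h (key x).2
      · exact (key x).1 huv
      · exact absurd huv (lt_irrefl _)
    | gap a b hab i hi =>
      rcases lt_trichotomy i g with hig | rfl | hig
      · exact iff_of_true (hlevL (by omega)) (hlevL (by omega))
      · exact absurd h2 (hcon a b hab h1)
      · exact iff_of_false (hlevL' (by omega)) (hlevL' (by omega))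
    | start y =>
      refine iff_of_true ?_ (hlevL (by omega))
      cases y
      · exact Or.inr rfl
      · exact Or.inl rfl
    | finish b y =>
      refine iff_of_false (hlevL' (by omega)) ?_
      have : ∀ y, ¬ (finishFrame y = 0 ∨ finishFrame y = 2) := by decide
      exact this y
    | apex y => exact absurd h1 hroot

/-- The gadget has no 3-fat minor isomorphic to the complete graph on twenty vertices. -/
theorem not_hasFatMinor (hn : 1 ≤ n) :
    ¬ HasFatMinor (⊤ : SimpleGraph (Fin 20)) 3 (GraphSpace (gadget n).graph) := by
  rintro ⟨𝓕⟩
  obtain ⟨S, hS, hS3, hSf⟩ := exists_strands 𝓕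
  let R : Bool → Set (GraphSpace (gadget n).graph) := fun x => S (startFrame x) (finishFrame x)
  have hne : ∀ x, startFrame x ≠ finishFrame x := by decide
  have hRf : ∀ x u, base (frame u) ∈ touched (R x) ↔ u = startFrame x ∨ u = finishFrame x :=
    fun x u => hSf _ _ u (hne x)
  have hRR : ∀ x, 3 ≤ setDist (R x) (R !x) := fun x => by
    refine hS3 _ _ _ _ (hne x) (hne !x) ?_ ?_ ?_ ?_ <;> revert x <;> decide
  have hRA : ∀ x, 3 ≤ setDist (R x) (S 4 5) := fun x => by
    refine hS3 _ _ _ _ (hne x) (by decide) ?_ ?_ ?_ ?_ <;> revert x <;> decide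
  have hvd : ∀ {A B : Set (GraphSpace (gadget n).graph)}, 3 ≤ setDist A B →
      ∀ v ∈ verts A, v ∉ verts B := fun h v hv hv' =>
    Set.disjoint_left.1 (touched_disjoint h) (verts_subset_touched _ hv) (verts_subset_touched _ hv')
  -- The root is the only port of the frame vertex 4.
  have hrootA : base root ∈ verts (S 4 5) := by
    obtain ⟨c, hc, hcS⟩ := exists_port_mem (hS 4 5 (by decide)) (by decide) (Or.inl (by decide))
      fun w => hSf 4 5 w (by decide)
    rcases hc with ⟨x, h, -⟩ | ⟨a, x, h, -⟩ | ⟨x, -, rfl⟩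
    · exact absurd h (by revert x; decide)
    · exact absurd h (by revert x; decide)
    · exact hcS
  have hroot : ∀ x, base root ∉ verts (R x) := fun x h => hvd (hRA x) _ h hrootA
  have hstart : ∀ x, base (lev x 0 (by positivity)) ∈ verts (R x) := by
    intro x
    obtain ⟨c, hc, hcS⟩ := exists_port_mem (hS _ _ (hne x)) (hne x)
      (Or.inl (by revert x; decide)) (hRf x)
    rcases hc with ⟨y, h, rfl⟩ | ⟨a, y, h, -⟩ | ⟨y, h, -⟩
    · obtain rfl : x = y := by clear hcS; revert x y; decide
      exact hcS
    · exact absurd h (by clear hcS; revert x y; decide)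
    · exact absurd h (by clear hcS; revert x y; decide)
  have hfinish : ∀ x, ∃ a, base (lev a (2 ^ n - 1) (last_lt n)) ∈ verts (R x) := by
    intro x
    obtain ⟨c, hc, hcS⟩ := exists_port_mem (hS _ _ (hne x)) (hne x).symm
      (Or.inr (by revert x; decide)) (fun w => (hRf x w).trans or_comm)
    rcases hc with ⟨y, h, -⟩ | ⟨a, y, h, rfl⟩ | ⟨y, h, -⟩
    · exact absurd h (by clear hcS; revert x y; decide)
    · exact ⟨a, hcS⟩
    · exact absurd h (by clear hcS; revert x y; decide)
  have hadj : ∀ h j (hh : h ≤ n) (hj : j < 2 ^ (n - h)) (hh' : h + 1 ≤ n)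
      (hj' : j / 2 < 2 ^ (n - (h + 1))), (gadget n).graph.Adj (base (node h j hh hj))
        (base (node (h + 1) (j / 2) hh' hj')) := fun h j hh hj hh' hj' =>
    (gadget n).adj_of_step (.short (.up h j hh hj hh' hj')) (by simp)
  refine false_of_two_sets hn (fun x => nodes (verts (R x))) ?_ ?_ ?_ ?_
  · rintro x p ⟨hh, hj, hp⟩ ⟨_, _, hp'⟩
    exact hvd (hRR x) _ hp hp'
  · rintro x h j hlt ⟨hh, hj, hp⟩ ⟨hh', hj', hp'⟩
    have hp2 : 2 ^ (n - h) = 2 * 2 ^ (n - (h + 1)) := by rw [← pow_succ']; congr 1; omega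
    dsimp only at hj hj' hp hp'
    have h1 := hadj h (2 * j) hh hj hlt (by omega)
    have h2 := hadj h (2 * j + 1) hh hj' hlt (by omega)
    have e : 2 * j / 2 = (2 * j + 1) / 2 := by omega
    simp only [e] at h1
    exact not_mem_verts_of_adj_adj (hRR x) h1 h2.symm hp hp'
  · rintro x ⟨hh, hj, hp⟩
    exact hroot x hp
  · intro g hg hjump
    have key : ∀ x, ∃ a b, (a && b) = false ∧
        base (lev a g (Nat.lt_of_succ_lt hg)) ∈ verts (R x) ∧
        base (lev b (g + 1) hg) ∈ verts (R x) := by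
      intro x
      obtain ⟨a, ha⟩ := hfinish x
      exact exists_gap_mem (linked_verts (hS _ _ (hne x))) x
        (fun u hu => (hRf x u).1 (verts_subset_touched _ hu)) (hroot x) (hstart x) ha hg (hjump x)
    have hnode : ∀ {i hi x}, base (lev true i hi) ∈ verts (R x) → (0, i) ∈ nodes (verts (R x)) :=
      fun {i hi x} h => ⟨Nat.zero_le n, hi, h⟩
    obtain ⟨a, b, hab, ha, hb⟩ := key true
    obtain ⟨a', b', hab', ha', hb'⟩ := key false
    have hd := hvd (hRR true)
    rw [Bool.not_true] at hd
    have h1 : a ≠ a' := by rintro rfl; exact hd _ ha ha'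
    have h2 : b ≠ b' := by rintro rfl; exact hd _ hb hb'
    -- The strands are at different levels on both sides of the gap and no edge joins two leaves, so
    -- they exchange levels.
    have h3 : ∀ a b a' b' : Bool, (a && b) = false → (a' && b') = false → a ≠ a' → b ≠ b' →
        (a = true ∧ b' = true) ∨ (a' = true ∧ b = true) := by decide
    rcases h3 a b a' b' hab hab' h1 h2 with ⟨rfl, rfl⟩ | ⟨rfl, rfl⟩
    · exact ⟨true, hnode ha, hnode hb'⟩
    · exact ⟨false, hnode ha', hnode hb⟩

end Gadget

/-! ### Drawings of graphs in metric spaces -/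

theorem Path.isPathConnected_range {X : Type*} [TopologicalSpace X] {x y : X} (γ : Path x y) :
    IsPathConnected (Set.range γ) := by
  have : PathConnectedSpace unitInterval := isPathConnected_iff_pathConnectedSpace.1
    ((convex_Icc (0 : ℝ) 1).isPathConnected ⟨0, by simp⟩)
  exact _root_.isPathConnected_range γ.continuous

/-- A drawing of a graph in a metric space: a point for each vertex and, for each edge, a
path-connected set of points near its ends that contains them. -/
structure Drawing {V : Type*} (G : SimpleGraph V) (X : Type*) [EMetricSpace X] (r : ℝ≥0∞) where
  pt : V → X
  arc : V → V → Set X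
  isPathConnected_arc : ∀ a b, G.Adj a b → IsPathConnected (arc a b)
  left_mem : ∀ a b, G.Adj a b → pt a ∈ arc a b
  right_mem : ∀ a b, G.Adj a b → pt b ∈ arc a b
  edist_le : ∀ a b, G.Adj a b → ∀ y ∈ arc a b, edist y (pt a) ≤ r

namespace Drawing

variable {V : Type*} {G : SimpleGraph V} {X : Type*} [EMetricSpace X] {r : ℝ≥0∞}
  (D : Drawing G X r)

/-- The drawing of the subgraph induced by a set of vertices. -/
def img (S : Set V) : Set X :=
  {y | ∃ a ∈ S, y = D.pt a ∨ ∃ b ∈ S, G.Adj a b ∧ y ∈ D.arc a b}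

theorem pt_mem_img {S : Set V} {a : V} (h : a ∈ S) : D.pt a ∈ D.img S := ⟨a, h, Or.inl rfl⟩

theorem arc_subset_img {S : Set V} {a b : V} (ha : a ∈ S) (hb : b ∈ S) (hab : G.Adj a b) :
    D.arc a b ⊆ D.img S := fun _ hy => ⟨a, ha, Or.inr ⟨b, hb, hab, hy⟩⟩

theorem joinedIn_of_adj {S : Set V} {a b : V} (ha : a ∈ S) (hb : b ∈ S) (hab : G.Adj a b) :
    JoinedIn (D.img S) (D.pt a) (D.pt b) :=
  ((D.isPathConnected_arc a b hab).joinedIn _ (D.left_mem a b hab) _ (D.right_mem a b hab)).mono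
    (D.arc_subset_img ha hb hab)

theorem exists_joinedIn {S : Set V} {y : X} (hy : y ∈ D.img S) :
    ∃ a ∈ S, JoinedIn (D.img S) (D.pt a) y := by
  obtain ⟨a, ha, rfl | ⟨b, hb, hab, hy⟩⟩ := hy
  · exact ⟨a, ha, .refl (D.pt_mem_img ha)⟩
  · exact ⟨a, ha, ((D.isPathConnected_arc a b hab).joinedIn _ (D.left_mem a b hab) _ hy).mono
      (D.arc_subset_img ha hb hab)⟩

theorem isPathConnected_img {S : Set V} {a : V} (ha : a ∈ S)
    (h : ∀ b ∈ S, JoinedIn (D.img S) (D.pt a) (D.pt b)) : IsPathConnected (D.img S) := by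
  refine ⟨D.pt a, D.pt_mem_img ha, fun {y} hy => ?_⟩
  obtain ⟨b, hb, hby⟩ := D.exists_joinedIn hy
  exact (h b hb).trans hby

/-- Every point of `Y` is at distance at most `s` from the drawing of some vertex of `S`. -/
def Near (s : ℝ≥0∞) (Y : Set X) (S : Set V) : Prop := ∀ y ∈ Y, ∃ a ∈ S, edist y (D.pt a) ≤ s

theorem near_img (S : Set V) : D.Near r (D.img S) S := by
  rintro y ⟨a, ha, rfl | ⟨b, hb, hab, hy⟩⟩
  · exact ⟨a, ha, by simp⟩
  · exact ⟨a, ha, D.edist_le a b hab y hy⟩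

variable {D} in
theorem Near.mono {s s' : ℝ≥0∞} {Y : Set X} {S S' : Set V} (h : D.Near s Y S) (hs : s ≤ s')
    (hS : S ⊆ S') : D.Near s' Y S' := fun y hy => by
  obtain ⟨a, ha, hya⟩ := h y hy
  exact ⟨a, hS ha, hya.trans hs⟩

/-- The distance of any two vertices from `S` and `S'` is at least `d`. -/
def _root_.SimpleGraph.Far (G : SimpleGraph V) (d : ℕ) (S S' : Set V) : Prop :=
  ∀ a ∈ S, ∀ b ∈ S', (d : ℕ∞) ≤ G.edist a b

theorem _root_.SimpleGraph.Far.symm {d : ℕ} {S S' : Set V} (h : G.Far d S S') : G.Far d S' S :=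
  fun a ha b hb => by rw [SimpleGraph.edist_comm]; exact h b hb a ha

/-- Points at distance less than 1 would give $12q \le 2(3q+1)+1 = 6q+3$, which fails for $q \ge 1$.
The radius $3q+1$ is that of a drawn edge plus the unit lost when sets are merged into runs. -/
theorem one_le_setDist {d q : ℕ} (hq : 1 ≤ q)
    (hD : ∀ a b, (d : ℕ∞) ≤ G.edist a b → (12 * q : ℝ≥0∞) ≤ edist (D.pt a) (D.pt b))
    {Y Y' : Set X} {S S' : Set V} (hY : D.Near (3 * q + 1) Y S) (hY' : D.Near (3 * q + 1) Y' S')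
    (h : G.Far d S S') : 1 ≤ setDist Y Y' := by
  refine le_setDist fun y hy y' hy' => ?_
  obtain ⟨a, ha, hya⟩ := hY y hy
  obtain ⟨b, hb, hyb⟩ := hY' y' hy'
  by_contra! hcon
  have h1 : (12 * q : ℝ≥0∞) ≤ (3 * q + 1) + 1 + (3 * q + 1) := by
    calc (12 * q : ℝ≥0∞) ≤ edist (D.pt a) (D.pt b) := hD a b (h a ha b hb)
      _ ≤ edist (D.pt a) y + edist y y' + edist y' (D.pt b) := edist_triangle4 _ _ _ _
      _ ≤ _ := add_le_add (add_le_add (by rwa [edist_comm]) hcon.le) hyb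
  have h2 : 12 * q ≤ (3 * q + 1) + 1 + (3 * q + 1) := by exact_mod_cast h1
  omega

end Drawing

/-- Adjacent vertices have images at distance at most $2q$, and the length space property with slack
1 joins them by a path of length at most $2q+1 \le 3q$. Vertices at distance $13q^2$ have images at
distance at least $13q^2/q - q = 12q$. -/
theorem IsQuasiIsometry.exists_drawing {V : Type*} {G : SimpleGraph V} {X : Type*}
    [EMetricSpace X] (hX : IsLengthSpace X) {q : ℕ} (hq : 1 ≤ q) {φ : GraphSpace G → X}
    (hφ : IsQuasiIsometry q φ) : ∃ D : Drawing G X (3 * q),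
      ∀ a b, ((13 * q ^ 2 : ℕ) : ℕ∞) ≤ G.edist a b →
        (12 * q : ℝ≥0∞) ≤ edist (D.pt a) (D.pt b) := by
  have hadj : ∀ a b, G.Adj a b → ∃ Y : Set X, IsPathConnected Y ∧ φ (GraphSpace.vert G a) ∈ Y ∧
      φ (GraphSpace.vert G b) ∈ Y ∧ ∀ y ∈ Y, edist y (φ (GraphSpace.vert G a)) ≤ 3 * q := by
    intro a b hab
    have h1 : edist (φ (GraphSpace.vert G a)) (φ (GraphSpace.vert G b)) ≤ 2 * q := by
      refine (hφ.1 _ _).2.trans ?_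
      rw [two_mul]
      gcongr
      exact mul_le_of_le_one_right' (GraphSpace.edist_vert_le_one hab)
    have htop : (2 * q : ℝ≥0∞) ≠ ∞ := ENNReal.mul_ne_top (by simp) (by simp)
    obtain ⟨γ, hγ⟩ := hX _ _ (ne_top_of_le_ne_top htop h1) 1 one_pos
    refine ⟨Set.range γ, γ.isPathConnected_range, ⟨0, γ.source⟩, ⟨1, γ.target⟩, ?_⟩
    rintro _ ⟨t, rfl⟩
    rw [edist_comm]
    refine (edist_apply_le_pathLength γ t).trans (hγ.trans ?_)
    calc _ ≤ (2 * q + 1 : ℝ≥0∞) := by gcongr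
      _ ≤ 3 * q := by
        have : 2 * q + 1 ≤ 3 * q := by omega
        exact_mod_cast this
  choose! Y hY hYa hYb hYr using hadj
  refine ⟨⟨fun a => φ (GraphSpace.vert G a), Y, hY, hYa, hYb, hYr⟩, fun a b h => ?_⟩
  refine le_trans ?_ (hφ.1 _ _).1
  have h1 : ((13 * q ^ 2 : ℕ) : ℝ≥0∞) ≤ edist (GraphSpace.vert G a) (GraphSpace.vert G b) := by
    refine le_trans ?_ (GraphSpace.le_edist_vert a b)
    simpa using ENat.toENNReal_le.2 h
  have hq0 : (q : ℝ≥0∞) ≠ 0 := by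
    have : q ≠ 0 := by omega
    exact_mod_cast this
  have h2 : (13 * q : ℝ≥0∞) ≤
      (q : ℝ≥0∞)⁻¹ * edist (GraphSpace.vert G a) (GraphSpace.vert G b) := by
    calc (13 * q : ℝ≥0∞) = (q : ℝ≥0∞)⁻¹ * q * (13 * q) := by
          rw [ENNReal.inv_mul_cancel hq0 (by simp), one_mul]
      _ = (q : ℝ≥0∞)⁻¹ * ((13 * q ^ 2 : ℕ) : ℝ≥0∞) := by push_cast; ring
      _ ≤ _ := by gcongr
  refine le_trans ?_ (tsub_le_tsub_right h2 _)
  refine ENNReal.le_sub_of_add_le_right (by simp) (le_of_eq ?_)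
  ring

/-! ### Grouping a sequence of sets into runs -/

/-- The number of elements of `cut` below `i`. -/
def cutsBelow (cut : Finset ℕ) (i : ℕ) : ℕ := (cut.filter (· < i)).card

theorem cutsBelow_zero (cut : Finset ℕ) : cutsBelow cut 0 = 0 := by simp [cutsBelow]

theorem cutsBelow_succ_of_mem {cut : Finset ℕ} {i : ℕ} (h : i ∈ cut) :
    cutsBelow cut (i + 1) = cutsBelow cut i + 1 := by
  have : cut.filter (· < i + 1) = insert i (cut.filter (· < i)) := by
    ext j
    simp only [Finset.mem_filter, Finset.mem_insert]
    constructor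
    · rintro ⟨hj, hji⟩
      by_cases hij : j = i
      · exact Or.inl hij
      · exact Or.inr ⟨hj, by omega⟩
    · rintro (rfl | ⟨hj, hji⟩)
      · exact ⟨h, by omega⟩
      · exact ⟨hj, by omega⟩
  rw [cutsBelow, this, Finset.card_insert_of_notMem (by simp)]
  rfl

theorem cutsBelow_eq_of_forall {cut : Finset ℕ} {i j : ℕ} (hij : i ≤ j)
    (h : ∀ g, i ≤ g → g < j → g ∉ cut) : cutsBelow cut j = cutsBelow cut i := by
  unfold cutsBelow
  congr 1
  ext g
  simp only [Finset.mem_filter, and_congr_right_iff]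
  intro hg
  by_contra hcon
  exact h g (by omega) (by omega) hg

/-- A run: a maximal interval of `{0, …, N - 1}` without a cut between consecutive elements. -/
structure IsRun (N : ℕ) (cut : Finset ℕ) (s t : ℕ) : Prop where
  le : s ≤ t
  lt : t < N
  left : s = 0 ∨ s - 1 ∈ cut
  right : t = N - 1 ∨ t ∈ cut
  uncut : ∀ g, s ≤ g → g < t → g ∉ cut

theorem exists_isRun {N : ℕ} (cut : Finset ℕ) {i : ℕ} (hi : i < N) :
    ∃ s t, IsRun N cut s t ∧ s ≤ i ∧ i ≤ t := by
  classical
  have h1 : ∃ s, s ≤ i ∧ ∀ g, s ≤ g → g < i → g ∉ cut := ⟨i, le_rfl, fun g h h' => by omega⟩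
  have h2 : ∃ t, i ≤ t ∧ (t = N - 1 ∨ t ∈ cut) := ⟨N - 1, by omega, Or.inl rfl⟩
  obtain ⟨hs, hs'⟩ := Nat.find_spec h1
  obtain ⟨ht, ht'⟩ := Nat.find_spec h2
  have hmin := fun m => Nat.find_min h1 (m := m)
  have hmin' := fun m => Nat.find_min h2 (m := m)
  set s := Nat.find h1
  set t := Nat.find h2
  have htN : t ≤ N - 1 := by
    by_contra hcon
    exact hmin' (N - 1) (by omega) ⟨by omega, Or.inl rfl⟩
  refine ⟨s, t, ⟨by omega, by omega, ?_, ht', ?_⟩, hs, ht⟩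
  · by_contra! hcon
    refine hmin (s - 1) (by omega) ⟨by omega, fun g hg hgi => ?_⟩
    by_cases hgs : g = s - 1
    · rw [hgs]; exact hcon.2
    · exact hs' g (by omega) hgi
  · intro g hg hgt hcut
    by_cases hgi : g < i
    · exact hs' g hg hgi hcut
    · exact hmin' g hgt ⟨by omega, Or.inr hcut⟩

theorem IsRun.eq_of_inter {N : ℕ} {cut : Finset ℕ} {s t s' t' i : ℕ} (h : IsRun N cut s t)
    (h' : IsRun N cut s' t') (hsi : s ≤ i) (hit : i ≤ t) (hsi' : s' ≤ i) (hit' : i ≤ t') :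
    s = s' ∧ t = t' := by
  have h1 := h.left
  have h2 := h'.left
  have h3 := h.right
  have h4 := h'.right
  have h5 := h.lt
  have h6 := h'.lt
  constructor
  · rcases lt_trichotomy s s' with hlt | heq | hlt
    · exact absurd (h2.resolve_left (by omega)) (h.uncut _ (by omega) (by omega))
    · exact heq
    · exact absurd (h1.resolve_left (by omega)) (h'.uncut _ (by omega) (by omega))
  · rcases lt_trichotomy t t' with hlt | heq | hlt
    · exact absurd (h3.resolve_left (by omega)) (h'.uncut _ (by omega) (by omega))
    · exact heq
    · exact absurd (h4.resolve_left (by omega)) (h.uncut _ (by omega) (by omega))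

/-- The sets `I s` and `I t` lie in a path-connected set that stays close to the sets `I j` with
`s ≤ j ≤ t`. -/
def Bridged {X : Type*} [EMetricSpace X] (I : ℕ → Set X) (ε : ℝ≥0∞) (s t : ℕ) (A : Set X) : Prop :=
  IsPathConnected A ∧ I s ⊆ A ∧ I t ⊆ A ∧
    ∀ y ∈ A, ∃ j, s ≤ j ∧ j ≤ t ∧ ∃ z ∈ I j, edist y z ≤ (t - s : ℕ) * ε

/-- A path of length less than `ε` joins the two sets. Points on it lose at most one more `ε`, which
the bound `(t' - s) * ε` pays for because `t < s'`. Runs between `t` and `s'` may be dropped, since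
only the first and the last set have to be contained. -/
theorem Bridged.union {X : Type*} [EMetricSpace X] {I : ℕ → Set X} {ε : ℝ≥0∞} {s t s' t' : ℕ}
    {A A' : Set X} (h : Bridged I ε s t A) (h' : Bridged I ε s' t' A') (hst : s ≤ t)
    (hts' : t < s') (hst' : s' ≤ t') (hlt : setDist A A' < ε) :
    ∃ A'', Bridged I ε s t' A'' := by
  obtain ⟨hA, hs, ht, hn⟩ := h
  obtain ⟨hA', hs', ht', hn'⟩ := h'
  obtain ⟨x, hx, y, hy, γ, hγ⟩ := exists_path_of_setDist_lt hlt
  have hR : IsPathConnected (Set.range γ) := γ.isPathConnected_range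
  refine ⟨A ∪ Set.range γ ∪ A', ?_, fun z hz => Or.inl (Or.inl (hs hz)), fun z hz => Or.inr (ht' hz),
    ?_⟩
  · exact (hA.union hR ⟨x, hx, 0, γ.source⟩).union hA' ⟨y, Or.inr ⟨1, γ.target⟩, hy⟩
  · have hmono : ∀ a b : ℕ, a ≤ b → (a * ε : ℝ≥0∞) ≤ b * ε := fun a b hab => by gcongr
    rintro z ((hz | ⟨u, rfl⟩) | hz)
    · obtain ⟨j, h1, h2, w, hw, hzw⟩ := hn z hz
      exact ⟨j, h1, by omega, w, hw, hzw.trans (hmono _ _ (by omega))⟩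
    · obtain ⟨j, h1, h2, w, hw, hzw⟩ := hn x hx
      refine ⟨j, h1, by omega, w, hw, ?_⟩
      have h3 : edist (γ u) x ≤ ε := by
        rw [edist_comm]
        exact (edist_apply_le_pathLength γ u).trans hγ.le
      calc edist (γ u) w ≤ edist (γ u) x + edist x w := edist_triangle _ _ _
        _ ≤ ε + (t - s : ℕ) * ε := add_le_add h3 hzw
        _ = ((t - s + 1 : ℕ) : ℝ≥0∞) * ε := by push_cast; ring
        _ ≤ _ := hmono _ _ (by omega)
    · obtain ⟨j, h1, h2, w, hw, hzw⟩ := hn' z hz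
      exact ⟨j, by omega, h2, w, hw, hzw.trans (hmono _ _ (by omega))⟩

/-- A sequence of path-connected sets can be grouped into runs: to each run belongs a
path-connected set that contains the first and the last set of the run and stays close to the sets
of the run, and the path-connected sets of different runs are at distance at least `ε`. -/
theorem exists_runs {X : Type*} [EMetricSpace X] (N : ℕ) (I : ℕ → Set X)
    (hI : ∀ i < N, IsPathConnected (I i)) (ε : ℝ≥0∞) :
    ∃ (cut : Finset ℕ) (A : ℕ → Set X),
      (∀ i, i + 1 < N → i ∉ cut → A i = A (i + 1)) ∧
      (∀ i < N, IsPathConnected (A i)) ∧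
      (∀ i < N, (i = 0 ∨ i - 1 ∈ cut ∨ i = N - 1 ∨ i ∈ cut) → I i ⊆ A i) ∧
      (∀ i j, i < j → j < N → cutsBelow cut i ≠ cutsBelow cut j → ε ≤ setDist (A i) (A j)) ∧
      ∀ i < N, ∀ y ∈ A i, ∃ j < N, cutsBelow cut j = cutsBelow cut i ∧
        ∃ z ∈ I j, edist y z ≤ N * ε := by
  classical
  -- Choose a set of cuts of least size for which every run is bridged. Cutting everywhere works,
  -- with the sets `I s` themselves.
  have hex : ∃ k, ∃ cut : Finset ℕ, cut.card = k ∧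
      ∀ s t, IsRun N cut s t → ∃ A, Bridged I ε s t A := by
    refine ⟨_, Finset.range (N - 1), rfl, fun s t h => ?_⟩
    have := h.le
    have := h.lt
    obtain rfl : s = t := by
      by_contra hne
      exact h.uncut s le_rfl (by omega) (Finset.mem_range.2 (by omega))
    exact ⟨I s, hI s (by omega), subset_rfl, subset_rfl,
      fun y hy => ⟨s, le_rfl, le_rfl, y, hy, by simp⟩⟩
  obtain ⟨cut, hcard, hcut⟩ := Nat.find_spec hex
  have hmin : ∀ cut' : Finset ℕ, cut'.card < cut.card →
      ¬ ∀ s t, IsRun N cut' s t → ∃ A, Bridged I ε s t A := by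
    intro cut' h1 h2
    exact Nat.find_min hex (hcard ▸ h1) ⟨cut', rfl, h2⟩
  have hcut' : ∀ s t, ∃ A, IsRun N cut s t → Bridged I ε s t A := by
    intro s t
    by_cases h : IsRun N cut s t
    · obtain ⟨A, hA⟩ := hcut s t h
      exact ⟨A, fun _ => hA⟩
    · exact ⟨∅, fun h' => absurd h' h⟩
  choose A hA using hcut'
  have hrun : ∀ i, ∃ s t, i < N → IsRun N cut s t ∧ s ≤ i ∧ i ≤ t := by
    intro i
    by_cases hi : i < N
    · obtain ⟨s, t, h⟩ := exists_isRun cut hi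
      exact ⟨s, t, fun _ => h⟩
    · exact ⟨0, 0, fun h => absurd h hi⟩
  choose s t hst using hrun
  refine ⟨cut, fun i => A (s i) (t i), ?_, ?_, ?_, ?_, ?_⟩
  · intro i hi hic
    obtain ⟨h1, h2, h3⟩ := hst i (by omega)
    obtain ⟨h1', h2', h3'⟩ := hst (i + 1) hi
    have h4 : i + 1 ≤ t i := by
      by_contra hcon
      have hit : t i = i := by omega
      rcases h1.right with h | h
      · omega
      · exact hic (hit ▸ h)
    obtain ⟨e1, e2⟩ := h1.eq_of_inter h1' (by omega) h4 h2' h3'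
    simp only [e1, e2]
  · intro i hi
    exact (hA _ _ (hst i hi).1).1
  · intro i hi hend
    obtain ⟨h1, h2, h3⟩ := hst i hi
    obtain ⟨-, hs, ht, -⟩ := hA _ _ h1
    have hl : i = s i ∨ i = t i := by
      by_contra! hcon
      have h4 := h1.lt
      rcases hend with h | h | h | h
      · omega
      · exact h1.uncut _ (by omega) (by omega) h
      · omega
      · exact h1.uncut _ h2 (by omega) h
    rcases hl with h | h
    · exact (congrArg I h).trans_subset hs
    · exact (congrArg I h).trans_subset ht
  · intro i j hij hj hne
    obtain ⟨h1, h2, h3⟩ := hst i (by omega)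
    obtain ⟨h1', h2', h3'⟩ := hst j hj
    by_contra! hlt
    have hts : t i < s j := by
      by_contra hcon
      have hle : s i ≤ s j ∨ s j ≤ s i := le_total _ _
      have heq : s i = s j ∧ t i = t j := by
        rcases hle with hle | hle
        · exact h1.eq_of_inter h1' hle (by omega) le_rfl h1'.le
        · exact h1.eq_of_inter h1' le_rfl h1.le hle (by omega)
      exact hne (cutsBelow_eq_of_forall hij.le fun g hg hgj =>
        h1.uncut g (by omega) (by omega)).symm
    have htc : t i ∈ cut := h1.right.resolve_left (by have := h1'.lt; have := h1'.le; omega)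
    -- If the sets of two runs are too close, delete all cuts from the end of the first to the start
    -- of the second. The merged run is bridged by `Bridged.union`, and all other remaining runs are
    -- old ones; this contradicts minimality.
    set cut' := cut.filter fun g => g < t i ∨ s j ≤ g with hcut'
    have hmem : ∀ g, g ∈ cut' ↔ g ∈ cut ∧ (g < t i ∨ s j ≤ g) := fun g => by simp [hcut']
    refine hmin cut' (Finset.card_lt_card ?_) ?_
    · refine Finset.ssubset_iff_subset_ne.2 ⟨Finset.filter_subset _ _, fun h => ?_⟩
      have := (hmem (t i)).1 (h ▸ htc)
      omega
    · intro a b hab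
      obtain ⟨g1, g2, g3, g4, g5⟩ := hab
      have g5' : ∀ g, a ≤ g → g < b → (g < t i ∨ s j ≤ g) → g ∉ cut := fun g x1 x2 x3 x4 =>
        g5 g x1 x2 ((hmem g).2 ⟨x4, x3⟩)
      have g3' : a = 0 ∨ (a - 1 ∈ cut ∧ (a - 1 < t i ∨ s j ≤ a - 1)) := g3.imp_right (hmem _).1
      have g4' : b = N - 1 ∨ (b ∈ cut ∧ (b < t i ∨ s j ≤ b)) := g4.imp_right (hmem _).1
      have k1 := h1.lt
      have k2 := h1'.lt
      have k3 := h1.le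
      have k4 := h1'.le
      by_cases c1 : b < t i
      · exact hcut a b ⟨g1, g2, g3'.imp_right And.left, g4'.imp_right And.left,
          fun g x1 x2 => g5' g x1 x2 (by omega)⟩
      by_cases c2 : s j < a
      · exact hcut a b ⟨g1, g2, g3'.imp_right And.left, g4'.imp_right And.left,
          fun g x1 x2 => g5' g x1 x2 (by omega)⟩
      have c3 : a ≤ t i := by
        rcases g3' with h | ⟨-, h⟩ <;> omega
      have c4 : s j ≤ b := by
        rcases g4' with h | ⟨-, h⟩ <;> omega
      have e1 : a = s i := by
        rcases lt_trichotomy a (s i) with hlt | heq | hlt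
        · exact absurd (h1.left.resolve_left (by omega)) (g5' _ (by omega) (by omega) (by omega))
        · exact heq
        · exact absurd (g3'.resolve_left (by omega)).1 (h1.uncut _ (by omega) (by omega))
      have e2 : b = t j := by
        rcases lt_trichotomy b (t j) with hlt | heq | hlt
        · exact absurd (g4'.resolve_left (by omega)).1 (h1'.uncut _ (by omega) (by omega))
        · exact heq
        · exact absurd (h1'.right.resolve_left (by omega)) (g5' _ (by omega) (by omega) (by omega))
      rw [e1, e2]
      exact (hA _ _ h1).union (hA _ _ h1') h1.le hts h1'.le hlt
  · intro i hi y hy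
    obtain ⟨h1, h2, h3⟩ := hst i hi
    obtain ⟨-, -, -, hn⟩ := hA _ _ h1
    obtain ⟨j, hj1, hj2, z, hz, hyz⟩ := hn y hy
    have h4 := h1.lt
    refine ⟨j, by omega, ?_, z, hz, hyz.trans ?_⟩
    · rw [cutsBelow_eq_of_forall hj1 fun g x1 x2 => h1.uncut g x1 (by omega),
        cutsBelow_eq_of_forall h2 fun g x1 x2 => h1.uncut g x1 (by omega)]
    · gcongr
      omega

/-! ### Far sets of vertices -/

namespace LongGraph

open LongVertex

variable {B E : Type} (Γ : LongGraph B E) {n : ℕ}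

/-- The star of radius `n` around a base vertex. -/
def star (n : ℕ) (v : B) : Set (LongVertex B E Γ.m) :=
  {x | match x with
    | base b => b = v
    | mid e k _ => (Γ.src e = v ∧ k < n) ∨ (Γ.tgt e = v ∧ Γ.m ≤ k + n)}

/-- The part of a long edge outside the stars of radius `n - 1` around its ends. -/
def middle (n : ℕ) (e : E) : Set (LongVertex B E Γ.m) :=
  {x | match x with
    | base _ => False
    | mid e' k _ => e' = e ∧ n ≤ k + 1 ∧ k + n ≤ Γ.m}

/-- The method behind the distance estimates below: a 1-Lipschitz function that is at least `n` on
one set and at most 0 on the other. -/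
theorem far_of_extend {S S' : Set (LongVertex B E Γ.m)} (f : B → ℤ) (hi : Set E) (c : ℤ)
    (hf : ∀ b, 0 ≤ f b ∧ f b ≤ c) (hc : c ≤ Γ.m) (hs : ∀ x y, Γ.short x y → |f x - f y| ≤ 1)
    (hS : ∀ a ∈ S, (n : ℤ) ≤ Γ.extend f hi c a) (hS' : ∀ a ∈ S', Γ.extend f hi c a ≤ 0) :
    Γ.graph.Far n S S' := fun a ha b hb =>
  Γ.le_edist_of_extend hf hc hs (by have := hS a ha; have := hS' b hb; linarith)

theorem extend_mid_nonpos {f : B → ℤ} {hi : Set E} {c : ℤ} {e : E} (he : e ∉ hi) {k : ℕ}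
    {hk : k < Γ.m} (h1 : f (Γ.src e) ≤ k + 1) (h2 : f (Γ.tgt e) + k ≤ Γ.m) :
    Γ.extend f hi c (mid e k hk) ≤ 0 := by
  rw [Γ.extend_mid_of_not_mem he]
  exact max_le le_rfl (max_le (by linarith) (by linarith))

theorem le_extend_mid {f : B → ℤ} {hi : Set E} {c d : ℤ} {e : E} (he : e ∈ hi) {k : ℕ}
    {hk : k < Γ.m} (hc : d ≤ c) (h1 : d ≤ f (Γ.src e) + (k + 1))
    (h2 : d + k ≤ f (Γ.tgt e) + Γ.m) : d ≤ Γ.extend f hi c (mid e k hk) := by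
  rw [Γ.extend_mid_of_mem he]
  exact le_min hc (le_min h1 (by linarith))

/-- A cone of height at most `2 * n` over the far end of an edge subdivided `4 * n` times vanishes
before it reaches the star of radius `n` around `v`. -/
theorem extend_nonpos_of_mem_star {f : B → ℤ} {hi : Set E} {c : ℤ} {v : B} (hm : Γ.m = 4 * n)
    (hv : f v ≤ 0) (hf : ∀ b, f b ≤ 2 * n) (hhi : ∀ e, Γ.src e = v ∨ Γ.tgt e = v → e ∉ hi) :
    ∀ a ∈ Γ.star n v, Γ.extend f hi c a ≤ 0 := by
  intro a ha
  cases a with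
  | base b =>
    obtain rfl : b = v := ha
    exact hv
  | mid e k hk =>
    have hs := hf (Γ.src e)
    have ht := hf (Γ.tgt e)
    rcases ha with ⟨h1, h2⟩ | ⟨h1, h2⟩
    · refine Γ.extend_mid_nonpos (hhi e (Or.inl h1)) ?_ ?_
      · rw [h1]; linarith
      · omega
    · refine Γ.extend_mid_nonpos (hhi e (Or.inr h1)) ?_ ?_
      · omega
      · rw [h1]; have : (k : ℤ) < Γ.m := by exact_mod_cast hk
        linarith

theorem le_extend_of_mem_star {f : B → ℤ} {c : ℤ} {v : B} (hv : f v = 2 * n) :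
    ∀ a ∈ Γ.star n v, (n : ℤ) ≤ Γ.extend f ∅ c a := by
  intro a ha
  cases a with
  | base b =>
    obtain rfl : b = v := ha
    rw [extend_base, hv]
    linarith
  | mid e k hk =>
    rw [Γ.extend_mid_of_not_mem (Set.notMem_empty e)]
    rcases ha with ⟨h1, h2⟩ | ⟨h1, h2⟩
    · rw [h1, hv]
      exact le_max_of_le_right (le_max_of_le_left (by omega))
    · rw [h1, hv]
      exact le_max_of_le_right (le_max_of_le_right (by omega))

/-- The certificate is a cone of height `2 * n` over `u`. It is admissible because no short edge is
incident with `u`. -/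
theorem far_star_star (hm : Γ.m = 4 * n) {u v : B} (huv : u ≠ v)
    (hu : ∀ x y, Γ.short x y → x ≠ u ∧ y ≠ u) : Γ.graph.Far n (Γ.star n u) (Γ.star n v) := by
  classical
  refine Γ.far_of_extend (fun b => if b = u then 2 * n else 0) ∅ (2 * n) ?_ ?_ ?_
    (Γ.le_extend_of_mem_star (by simp))
    (Γ.extend_nonpos_of_mem_star hm (by simp [huv.symm]) ?_ (by simp))
  · intro b
    split_ifs <;> omega
  · omega
  · intro x y hxy
    simp [hu x y hxy]
  · intro b
    split_ifs <;> omega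

/-- The certificate is a tent supported on the single long edge `e`, cut off at height `n`. -/
theorem far_middle (hm : Γ.m = 4 * n) {e : E} {S : Set (LongVertex B E Γ.m)}
    (hS : ∀ k hk, mid e k hk ∉ S) : Γ.graph.Far n (Γ.middle n e) S := by
  refine Γ.far_of_extend (fun _ => 0) {e} n (fun b => ⟨le_rfl, by simp⟩) (by omega)
    (fun x y _ => by simp) ?_ ?_
  · intro a ha
    cases a with
    | base b => exact ha.elim
    | mid e' k hk =>
      obtain ⟨h1, h2, h3⟩ := ha
      exact Γ.le_extend_mid (by simp [h1]) le_rfl (by omega) (by omega)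
  · intro a ha
    cases a with
    | base b => exact le_rfl
    | mid e' k hk =>
      refine Γ.extend_mid_nonpos ?_ (by omega) (by omega)
      rintro rfl
      exact hS k hk ha

theorem mid_not_mem_star {e : E} {v : B} (h1 : Γ.src e ≠ v) (h2 : Γ.tgt e ≠ v) (k : ℕ)
    (hk : k < Γ.m) : mid e k hk ∉ Γ.star n v := by
  rintro (⟨h, -⟩ | ⟨h, -⟩)
  · exact h1 h
  · exact h2 h

end LongGraph

namespace Drawing

open LongVertex LongGraph

variable {B E : Type} {Γ : LongGraph B E} {n : ℕ} {X : Type*} [EMetricSpace X] {r : ℝ≥0∞}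
  (D : Drawing Γ.graph X r)

theorem joinedIn_mid {S : Set (LongVertex B E Γ.m)} {e : E} {k k' : ℕ} (hk : k < Γ.m)
    (hk' : k' < Γ.m) (hkk' : k ≤ k') (hS : ∀ j hj, k ≤ j → j ≤ k' → mid e j hj ∈ S) :
    JoinedIn (D.img S) (D.pt (mid e k hk)) (D.pt (mid e k' hk')) := by
  induction k', hkk' using Nat.le_induction with
  | base => exact .refl (D.pt_mem_img (hS k hk le_rfl le_rfl))
  | succ k' hkk' ih =>
    refine (ih (by omega) fun j hj h1 h2 => hS j hj h1 (by omega)).trans ?_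
    exact D.joinedIn_of_adj (hS k' (by omega) hkk' (by omega)) (hS (k' + 1) hk' (by omega) le_rfl)
      (Γ.adj_mid e k' hk')

theorem joinedIn_src {S : Set (LongVertex B E Γ.m)} {e : E} {k : ℕ} (hk : k < Γ.m)
    (hs : base (Γ.src e) ∈ S) (hS : ∀ j hj, j ≤ k → mid e j hj ∈ S) :
    JoinedIn (D.img S) (D.pt (base (Γ.src e))) (D.pt (mid e k hk)) :=
  (D.joinedIn_of_adj hs (hS 0 (by omega) (by omega)) (Γ.adj_src e (by omega))).trans
    (D.joinedIn_mid _ hk (by omega) fun j hj _ h => hS j hj h)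

theorem joinedIn_tgt {S : Set (LongVertex B E Γ.m)} {e : E} {k : ℕ} (hk : k < Γ.m)
    (ht : base (Γ.tgt e) ∈ S) (hS : ∀ j hj, k ≤ j → mid e j hj ∈ S) :
    JoinedIn (D.img S) (D.pt (base (Γ.tgt e))) (D.pt (mid e k hk)) :=
  ((D.joinedIn_mid hk (by omega : Γ.m - 1 < Γ.m) (by omega) fun j hj h _ => hS j hj h).trans
    (D.joinedIn_of_adj (hS _ (by omega) (by omega)) ht
      (Γ.adj_tgt e (Γ.m - 1) (by omega) (by omega)))).symm

theorem isPathConnected_img_star (v : B) : IsPathConnected (D.img (Γ.star n v)) := by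
  refine D.isPathConnected_img (a := base v) rfl fun b hb => ?_
  cases b with
  | base b =>
    obtain rfl : b = v := hb
    exact .refl (D.pt_mem_img rfl)
  | mid e k hk =>
    rcases hb with ⟨rfl, h⟩ | ⟨rfl, h⟩
    · exact D.joinedIn_src hk rfl fun j hj hjk => Or.inl ⟨rfl, by omega⟩
    · exact D.joinedIn_tgt hk rfl fun j hj hjk => Or.inr ⟨rfl, by omega⟩

theorem joinedIn_of_ordConnected {S : Set (LongVertex B E Γ.m)} {e : E}
    (hS : ∀ i j k hi hj hk, i ≤ j → j ≤ k → mid e i hi ∈ S → mid e k hk ∈ S → mid e j hj ∈ S)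
    {k k' : ℕ} {hk : k < Γ.m} {hk' : k' < Γ.m} (h : mid e k hk ∈ S) (h' : mid e k' hk' ∈ S) :
    JoinedIn (D.img S) (D.pt (mid e k hk)) (D.pt (mid e k' hk')) := by
  rcases le_total k k' with hkk | hkk
  · exact D.joinedIn_mid hk hk' hkk fun j hj h1 h2 => hS k j k' hk hj hk' h1 h2 h h'
  · exact (D.joinedIn_mid hk' hk hkk fun j hj h1 h2 => hS k' j k hk' hj hk h1 h2 h' h).symm

theorem isPathConnected_img_middle (hm : Γ.m = 4 * n) (hn : 1 ≤ n) (e : E) :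
    IsPathConnected (D.img (Γ.middle n e)) := by
  have h0 : mid e n (by omega) ∈ Γ.middle n e := ⟨rfl, by omega, by omega⟩
  refine D.isPathConnected_img h0 fun b hb => ?_
  cases b with
  | base b => exact hb.elim
  | mid e' k hk =>
    obtain rfl : e' = e := hb.1
    refine D.joinedIn_of_ordConnected ?_ h0 hb
    rintro i j k hi hj hk hij hjk ⟨-, h1, h2⟩ ⟨-, h3, h4⟩
    exact ⟨rfl, by omega, by omega⟩

end Drawing

/-! ### Strands in the gadget -/

namespace Gadget

open LongVertex GadgetVertex GadgetEdge

variable {n : ℕ}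

/-- The long edges used by the strand of colour `x` that runs at level `lv i` in column `i`. -/
def strandEdges (lv : ℕ → Bool) (x : Bool) : Set (GadgetEdge n) :=
  {e | match e with
    | fr _ _ _ _ => False
    | gap a b _ i _ => a = lv i ∧ b = lv (i + 1)
    | start y => y = x
    | finish a y => a = lv (2 ^ n - 1) ∧ y = x
    | apex _ => False}

/-- The bottom vertices. -/
def IsBot : GadgetVertex n → Prop
  | bot _ _ => True
  | _ => False

/-- The part outside the tree and away from the leaves and the frame of the strand of colour `x` that
runs at level `lv i` in column `i`. -/
def strandSet (lv : ℕ → Bool) (x : Bool) :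
    Set (LongVertex (GadgetVertex n) (GadgetEdge n) (gadget n).m) :=
  {v | match v with
    | base (frame _) => False
    | base (node _ _ _ _) => False
    | base (bot i _) => lv i = false
    | mid e k _ => e ∈ strandEdges lv x ∧ (IsBot (src e) ∨ n ≤ k + 1) ∧
        (IsBot (tgt e) ∨ k + n ≤ 4 * n)}

/-- The root and the parts away from the frame of the two long edges at the root. -/
def apexSet : Set (LongVertex (GadgetVertex n) (GadgetEdge n) (gadget n).m) :=
  {v | match v with
    | base b => b = root
    | mid (apex _) k _ => k + n ≤ 4 * n
    | mid _ _ _ => False}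

theorem exists_apex_of_mem_apexSet {e : GadgetEdge n} {k : ℕ} {hk : k < (gadget n).m}
    (h : mid e k hk ∈ apexSet) : (∃ x, e = apex x) ∧ k + n ≤ 4 * n := by
  cases e with
  | apex x => exact ⟨⟨x, rfl⟩, h⟩
  | fr => exact h.elim
  | gap => exact h.elim
  | start => exact h.elim
  | finish => exact h.elim

/-- The function that is `n` on the bottom vertices of a strand and zero elsewhere. -/
def botHeight (lv : ℕ → Bool) : GadgetVertex n → ℤ
  | bot i _ => if lv i = false then n else 0
  | _ => 0

theorem botHeight_bounds (lv : ℕ → Bool) (b : GadgetVertex n) :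
    0 ≤ botHeight lv b ∧ botHeight lv b ≤ n := by
  cases b <;> simp only [botHeight] <;> (try split_ifs) <;> omega

theorem botHeight_lev {lv : ℕ → Bool} {a : Bool} {i : ℕ} {hi : i < 2 ^ n} (h : a = !lv i) :
    botHeight lv (lev a i hi) = 0 := by
  cases a
  · simp only [lev, botHeight]
    rw [if_neg]
    intro h'
    rw [h'] at h
    exact absurd h (by decide)
  · rfl

theorem botHeight_of_isBot {lv : ℕ → Bool} {i : ℕ} {hi : i < 2 ^ n}
    (h : IsBot (lev (lv i) i hi)) : botHeight lv (lev (lv i) i hi) = n := by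
  cases hl : lv i
  · simp [lev, botHeight, hl]
  · rw [hl] at h
    exact h.elim

theorem botHeight_src {lv : ℕ → Bool} {x : Bool} {e : GadgetEdge n}
    (he : e ∈ strandEdges lv x) (h : IsBot (src e)) : botHeight lv (src e) = n := by
  cases e with
  | fr => exact he.elim
  | gap a b hab i hi =>
    obtain ⟨rfl, rfl⟩ := he
    exact botHeight_of_isBot h
  | start y => exact h.elim
  | finish a y =>
    obtain ⟨rfl, rfl⟩ := he
    exact botHeight_of_isBot h
  | apex y => exact he.elim

theorem botHeight_tgt {lv : ℕ → Bool} {x : Bool} (h0 : lv 0 = x) {e : GadgetEdge n}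
    (he : e ∈ strandEdges lv x) (h : IsBot (tgt e)) : botHeight lv (tgt e) = n := by
  cases e with
  | fr => exact he.elim
  | gap a b hab i hi =>
    obtain ⟨rfl, rfl⟩ := he
    exact botHeight_of_isBot h
  | start y =>
    obtain rfl : y = x := he
    subst h0
    exact botHeight_of_isBot h
  | finish a y => exact h.elim
  | apex y => exact he.elim

theorem tree_frame {x y : GadgetVertex n} (h : Tree x y) (u : Fin 20) :
    x ≠ frame u ∧ y ≠ frame u := by
  cases h; simp

/-- The extension of `botHeight` is at least `n` on the strand: along a used edge it starts at `n`
at a bottom end, while near any other end the strand omits the part where the function is still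
below `n`. -/
theorem far_strandSet {lv : ℕ → Bool} {x : Bool} (h0 : lv 0 = x)
    {S : Set (LongVertex (GadgetVertex n) (GadgetEdge n) (gadget n).m)}
    (hS : ∀ a ∈ S, (gadget n).extend (botHeight lv) (strandEdges lv x) n a ≤ 0) :
    (gadget n).graph.Far n (strandSet lv x) S := by
  refine (gadget n).far_of_extend (botHeight lv) (strandEdges lv x) n (botHeight_bounds lv)
    (by rw [gadget_m]; omega) ?_ ?_ hS
  · rintro _ _ ⟨⟩
    simp [botHeight]
  · intro a ha
    match a, ha with
    | base (bot i hi), ha =>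
      have : lv i = false := ha
      simp [botHeight, this]
    | mid e k hk, ⟨he, h1, h2⟩ =>
      have b1 := (botHeight_bounds lv (src e)).1
      have b2 := (botHeight_bounds lv (tgt e)).1
      refine (gadget n).le_extend_mid he le_rfl ?_ ?_
      · rw [gadget_src]
        rcases h1 with h1 | h1
        · rw [botHeight_src he h1]; omega
        · omega
      · rw [gadget_tgt, gadget_m]
        rw [gadget_m] at hk
        rcases h2 with h2 | h2
        · rw [botHeight_tgt h0 he h2]; omega
        · omega

theorem far_strandSet_star_frame {lv : ℕ → Bool} {x : Bool} (h0 : lv 0 = x) {u : Fin 20}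
    (h1 : u ≠ startFrame x) (h2 : u ≠ finishFrame x) :
    (gadget n).graph.Far n (strandSet lv x) ((gadget n).star n (frame u)) := by
  refine far_strandSet h0 ((gadget n).extend_nonpos_of_mem_star gadget_m le_rfl
    (fun b => (botHeight_bounds lv b).2.trans (by omega)) ?_)
  intro e he hex
  cases e with
  | fr => exact hex.elim
  | gap a b hab i hi => rcases he with he | he <;> exact frame_ne_lev he.symm
  | start y =>
    obtain rfl : y = x := hex
    rcases he with he | he
    · exact h1 (by simpa [src] using he.symm)
    · exact frame_ne_lev he.symm
  | finish a y =>
    obtain rfl : y = x := hex.2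
    rcases he with he | he
    · exact frame_ne_lev he.symm
    · exact h2 (by simpa [tgt] using he.symm)
  | apex y => exact hex.elim

theorem lev_inj {a b : Bool} {i j : ℕ} {hi : i < 2 ^ n} {hj : j < 2 ^ n}
    (h : lev a i hi = lev b j hj) : a = b ∧ i = j := by
  cases a <;> cases b <;> simp_all [lev]

theorem root_ne_lev (hn : 1 ≤ n) {a : Bool} {i : ℕ} {hi : i < 2 ^ n} : root ≠ lev a i hi := by
  cases a
  · simp [lev, root]
  · simp only [lev, root, ne_eq, node.injEq, not_and]
    omega

/-- A strand on the bottom level in column `i` uses no long edge at the leaf of that column. -/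
theorem far_strandSet_star_leaf {lv : ℕ → Bool} {x : Bool} (h0 : lv 0 = x) {i : ℕ}
    {hi : i < 2 ^ n} (hl : lv i = false) :
    (gadget n).graph.Far n (strandSet lv x) ((gadget n).star n (lev true i hi)) := by
  refine far_strandSet h0 ((gadget n).extend_nonpos_of_mem_star gadget_m le_rfl
    (fun b => (botHeight_bounds lv b).2.trans (by omega)) ?_)
  intro e he hex
  cases e with
  | fr => exact hex.elim
  | gap a b hab j hj =>
    obtain ⟨rfl, rfl⟩ := hex
    rcases he with he | he
    · obtain ⟨h1, rfl⟩ := lev_inj he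
      simp [hl] at h1
    · obtain ⟨h1, rfl⟩ := lev_inj he
      simp [hl] at h1
  | start y =>
    obtain rfl : y = x := hex
    rcases he with he | he
    · exact frame_ne_lev he
    · obtain ⟨h1, rfl⟩ := lev_inj he
      rw [hl] at h0
      simp [← h0] at h1
  | finish a y =>
    obtain ⟨rfl, rfl⟩ := hex
    rcases he with he | he
    · obtain ⟨h1, rfl⟩ := lev_inj he
      simp [hl] at h1
    · exact frame_ne_lev he
  | apex y => exact hex.elim

/-- Strands with complementary levels share no long edge, and the height function of one vanishes at
both ends of each edge used by the other. -/
theorem far_strandSet_strandSet {lv : ℕ → Bool} {x : Bool} (h0 : lv 0 = x) :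
    (gadget n).graph.Far n (strandSet lv x) (strandSet (fun i => !lv i) !x) := by
  refine far_strandSet h0 fun a ha => ?_
  match a, ha with
  | base (bot i hi), ha =>
    have : lv i = true := by simpa [strandSet] using ha
    simp [botHeight, this]
  | mid e k hk, ⟨he, _, _⟩ =>
    have hbz : botHeight lv (src e) = 0 ∧ botHeight lv (tgt e) = 0 ∧ e ∉ strandEdges lv x := by
      cases e with
      | fr => exact he.elim
      | gap a b hab j hj =>
        obtain ⟨ha, hb⟩ := he
        refine ⟨botHeight_lev ha, botHeight_lev hb, fun h => ?_⟩
        have := h.1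
        rw [ha] at this
        simp at this
      | start y =>
        have hy : y = !x := he
        refine ⟨rfl, botHeight_lev (by rw [hy, h0]), fun h => ?_⟩
        have : y = x := h
        rw [hy] at this
        simp at this
      | finish a y =>
        obtain ⟨ha, hb⟩ := he
        refine ⟨botHeight_lev ha, rfl, fun h => ?_⟩
        have := h.2
        rw [hb] at this
        simp at this
      | apex y => exact he.elim
    refine (gadget n).extend_mid_nonpos hbz.2.2 ?_ ?_
    · rw [gadget_src, hbz.1]; omega
    · rw [gadget_tgt, hbz.2.1]; omega

theorem far_strandSet_apexSet {lv : ℕ → Bool} {x : Bool} (h0 : lv 0 = x) :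
    (gadget n).graph.Far n (strandSet lv x) apexSet := by
  refine far_strandSet h0 fun a ha => ?_
  cases a with
  | base b =>
    obtain rfl : b = root := ha
    exact le_rfl
  | mid e k hk =>
    obtain ⟨⟨y, rfl⟩, -⟩ := exists_apex_of_mem_apexSet ha
    have hy : apex y ∉ strandEdges (n := n) lv x := fun h => h
    refine (gadget n).extend_mid_nonpos hy ?_ ?_
    · simp [src, root, botHeight]; omega
    · simp [tgt, botHeight]; omega

/-- The height `2 * n` on the whole tree makes the function constant along tree edges. -/
theorem far_star_leaf_star_frame {i : ℕ} {hi : i < 2 ^ n} (u : Fin 20) :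
    (gadget n).graph.Far n ((gadget n).star n (lev true i hi)) ((gadget n).star n (frame u)) := by
  refine (gadget n).far_of_extend (fun b => match b with
    | node _ _ _ _ => 2 * n
    | _ => 0) ∅ (2 * n) ?_ (by rw [gadget_m]; omega) ?_
    ((gadget n).le_extend_of_mem_star rfl)
    ((gadget n).extend_nonpos_of_mem_star gadget_m le_rfl ?_ (by simp))
  · rintro (_ | _ | _) <;> simp
  · rintro _ _ ⟨⟩
    simp
  · rintro (_ | _ | _) <;> simp

/-- Here the tree must have height `n`: the function falls by one per level, from `n` at the leaves
to 0 at the root. -/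
theorem far_star_leaf_apexSet (hn : 1 ≤ n) {i : ℕ} {hi : i < 2 ^ n} :
    (gadget n).graph.Far n ((gadget n).star n (lev true i hi)) apexSet := by
  let f : GadgetVertex n → ℤ := fun
    | frame _ => 0
    | node h _ _ _ => n - h
    | bot _ _ => n
  have hf : ∀ b, 0 ≤ f b ∧ f b ≤ n := by
    rintro (_ | ⟨h, j, hh, hj⟩ | _) <;> simp only [f] <;> omega
  refine (gadget n).far_of_extend f {e | ∀ x, e ≠ apex x} n hf (by rw [gadget_m]; omega) ?_ ?_ ?_
  · rintro _ _ ⟨⟩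
    simp [f]
  · intro a ha
    cases a with
    | base b =>
      obtain rfl : b = lev true i hi := ha
      simp [f, lev]
    | mid e k hk =>
      have hfl : f (lev true i hi) = n := by simp [f, lev]
      have b1 := hf (src e)
      have b2 := hf (tgt e)
      rcases ha with ⟨h1, h2⟩ | ⟨h1, h2⟩
      · refine (gadget n).le_extend_mid ?_ le_rfl ?_ ?_
        · rintro y rfl
          exact root_ne_lev hn h1
        · rw [h1, hfl]; omega
        · rw [gadget_tgt, gadget_m]; omega
      · refine (gadget n).le_extend_mid ?_ le_rfl ?_ ?_
        · rintro y rfl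
          exact frame_ne_lev h1
        · rw [gadget_src]; rw [gadget_m] at h2; omega
        · rw [h1, hfl]; omega
  · intro a ha
    cases a with
    | base b =>
      obtain rfl : b = root := ha
      simp [f, root]
    | mid e k hk =>
      obtain ⟨⟨y, rfl⟩, -⟩ := exists_apex_of_mem_apexSet ha
      refine (gadget n).extend_mid_nonpos (by simp) ?_ ?_
      · simp [src, root, f]; omega
      · simp only [gadget_tgt, tgt, f]; omega

/-- The certificate is the height in the tree, kept large along the two edges at the root. -/
theorem far_apexSet_star_frame {u : Fin 20} (h4 : u ≠ 4) (h5 : u ≠ 5) :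
    (gadget n).graph.Far n apexSet ((gadget n).star n (frame u)) := by
  let f : GadgetVertex n → ℤ := fun
    | node h _ _ _ => h
    | _ => 0
  have hf : ∀ b, 0 ≤ f b ∧ f b ≤ n := by
    rintro (_ | ⟨h, j, hh, hj⟩ | _) <;> simp only [f] <;> omega
  refine (gadget n).far_of_extend f {e | ∃ x, e = apex x} n hf (by rw [gadget_m]; omega) ?_ ?_
    ((gadget n).extend_nonpos_of_mem_star gadget_m le_rfl
      (fun b => (hf b).2.trans (by omega)) ?_)
  · rintro _ _ ⟨⟩
    simp [f]
  · intro a ha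
    cases a with
    | base b =>
      obtain rfl : b = root := ha
      simp [f, root]
    | mid e k hk =>
      obtain ⟨⟨y, rfl⟩, h⟩ := exists_apex_of_mem_apexSet ha
      have hy : apex y ∈ {e : GadgetEdge n | ∃ x, e = apex x} := ⟨y, rfl⟩
      refine (gadget n).le_extend_mid hy le_rfl ?_ ?_
      · simp [src, root, f]; omega
      · simp only [gadget_tgt, tgt, f, gadget_m]; omega
  · rintro e he ⟨y, rfl⟩
    rcases he with he | he
    · exact frame_ne_root he.symm
    · have : apexFrame y = u := by simpa [tgt] using he
      cases y
      · exact h5 this.symm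
      · exact h4 this.symm

theorem mid_fr_not_mem_strandSet {lv : ℕ → Bool} {x : Bool} {u v : Fin 20} {huv : u < v}
    {h : ¬ FramePair u v} (k : ℕ) (hk : k < (gadget n).m) :
    mid (fr u v huv h) k hk ∉ strandSet lv x := fun h => h.1

theorem mid_fr_not_mem_apexSet {u v : Fin 20} {huv : u < v} {h : ¬ FramePair u v} (k : ℕ)
    (hk : k < (gadget n).m) : mid (fr u v huv h) k hk ∉ apexSet := fun h => h

theorem mid_fr_not_mem_star_leaf {u v : Fin 20} {huv : u < v} {h : ¬ FramePair u v} {i : ℕ}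
    {hi : i < 2 ^ n} (k : ℕ) (hk : k < (gadget n).m) :
    mid (fr u v huv h) k hk ∉ (gadget n).star n (lev true i hi) :=
  (gadget n).mid_not_mem_star (e := fr u v huv h) frame_ne_lev frame_ne_lev k hk

end Gadget

/-! ### The fat model in a space that is quasi-isometric to the gadget -/

namespace Gadget

open LongVertex GadgetVertex GadgetEdge

variable {n : ℕ} {X : Type*} [EMetricSpace X] {r : ℝ≥0∞} (D : Drawing (gadget n).graph X r)
  (lv : ℕ → Bool) (x : Bool) (A : ℕ → Set X)

/-- A strand in `X`: the drawing of its part outside the tree, and the sets `A i` of the columns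
in which it runs at the top level. -/
def strandImg : Set X := D.img (strandSet lv x) ∪ {y | ∃ i < 2 ^ n, lv i = true ∧ y ∈ A i}

/-- The part of a strand in a column. -/
def column (i : ℕ) (hi : i < 2 ^ n) : Set X :=
  {y | (lv i = true ∧ y ∈ A i) ∨ (lv i = false ∧ y = D.pt (base (bot i hi)))}

variable {lv x A}

theorem mid_mem_strandSet {e : GadgetEdge n} (he : e ∈ strandEdges lv x) {k : ℕ}
    (hk : k < (gadget n).m) (h1 : n ≤ k + 1) (h2 : k + n ≤ 4 * n) :
    mid e k hk ∈ strandSet lv x := ⟨he, Or.inr h1, Or.inr h2⟩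

theorem joinedIn_strandSet {e : GadgetEdge n} {k k' : ℕ} {hk : k < (gadget n).m}
    {hk' : k' < (gadget n).m} (h : mid e k hk ∈ strandSet lv x)
    (h' : mid e k' hk' ∈ strandSet lv x) :
    JoinedIn (strandImg D lv x A) (D.pt (mid e k hk)) (D.pt (mid e k' hk')) := by
  refine (D.joinedIn_of_ordConnected ?_ h h').mono Set.subset_union_left
  rintro i j k hi hj hk hij hjk ⟨he, h1, h2⟩ ⟨-, h3, h4⟩
  exact ⟨he, h1.imp_right fun h => by omega, h4.imp_right fun h => by omega⟩

theorem column_nonempty {i : ℕ} (hi : i < 2 ^ n) (hA : IsPathConnected (A i)) :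
    (column D lv A i hi).Nonempty := by
  cases h : lv i
  · exact ⟨_, Or.inr ⟨h, rfl⟩⟩
  · obtain ⟨y, hy⟩ := hA.nonempty
    exact ⟨y, Or.inl ⟨h, hy⟩⟩

theorem joinedIn_top {e : GadgetEdge n} {i : ℕ} {hi : i < 2 ^ n} (hl : lv i = true)
    (hA : IsPathConnected (A i)) (hI : D.img ((gadget n).star n (lev true i hi)) ⊆ A i)
    {k k' : ℕ} {hk : k < (gadget n).m} {hk' : k' < (gadget n).m} (h : mid e k hk ∈ strandSet lv x)
    (h' : mid e k' hk' ∈ strandSet lv x)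
    (hstar : mid e k' hk' ∈ (gadget n).star n (lev true i hi)) {y : X} (hy : y ∈ A i) :
    JoinedIn (strandImg D lv x A) (D.pt (mid e k hk)) y :=
  (joinedIn_strandSet D h h').trans ((hA.joinedIn _ (hI (D.pt_mem_img hstar)) _ hy).mono
    fun _ hz => Or.inr ⟨i, hi, hl, hz⟩)

/-- In a top column the edge reaches `A i` at its subdividing vertex `n - 1`, which lies both in the
strand and in the star of the leaf. In a bottom column the strand contains the edge down to the
bottom vertex itself. -/
theorem joinedIn_column_of_src (hn : 1 ≤ n) {e : GadgetEdge n} (he : e ∈ strandEdges lv x) {i : ℕ}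
    {hi : i < 2 ^ n} (hsrc : src e = lev (lv i) i hi) (hA : IsPathConnected (A i))
    (hI : lv i = true → D.img ((gadget n).star n (lev true i hi)) ⊆ A i) {k : ℕ}
    {hk : k < (gadget n).m} (h : mid e k hk ∈ strandSet lv x) {y : X}
    (hy : y ∈ column D lv A i hi) :
    JoinedIn (strandImg D lv x A) (D.pt (mid e k hk)) y := by
  have hm := gadget_m (n := n)
  rcases hy with ⟨hl, hy⟩ | ⟨hl, rfl⟩
  · exact joinedIn_top D hl hA (hI hl) h
      (mid_mem_strandSet he (k := n - 1) (by omega) (by omega) (by omega))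
      (Or.inl ⟨by rw [gadget_src, hsrc, hl], by omega⟩) hy
  · have hs : (gadget n).src e = bot i hi := by rw [gadget_src, hsrc, hl]; rfl
    have hb : IsBot (src e) := by rw [← gadget_src, hs]; trivial
    have h1 : mid e 0 (by omega) ∈ strandSet lv x := ⟨he, Or.inl hb, Or.inr (by omega)⟩
    refine (joinedIn_strandSet D h h1).trans ?_
    have := D.joinedIn_src (S := strandSet lv x) (e := e) (k := 0) (by omega) (by rw [hs]; exact hl)
      (fun j hj hj0 => by obtain rfl : j = 0 := by omega
                          exact h1)
    rw [hs] at this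
    exact this.symm.mono Set.subset_union_left

theorem joinedIn_column_of_tgt (hn : 1 ≤ n) {e : GadgetEdge n} (he : e ∈ strandEdges lv x) {i : ℕ}
    {hi : i < 2 ^ n} (htgt : tgt e = lev (lv i) i hi) (hA : IsPathConnected (A i))
    (hI : lv i = true → D.img ((gadget n).star n (lev true i hi)) ⊆ A i) {k : ℕ}
    {hk : k < (gadget n).m} (h : mid e k hk ∈ strandSet lv x) {y : X}
    (hy : y ∈ column D lv A i hi) :
    JoinedIn (strandImg D lv x A) (D.pt (mid e k hk)) y := by
  have hm := gadget_m (n := n)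
  rcases hy with ⟨hl, hy⟩ | ⟨hl, rfl⟩
  · exact joinedIn_top D hl hA (hI hl) h
      (mid_mem_strandSet he (k := 3 * n) (by omega) (by omega) (by omega))
      (Or.inr ⟨by rw [gadget_tgt, htgt, hl], by omega⟩) hy
  · have ht : (gadget n).tgt e = bot i hi := by rw [gadget_tgt, htgt, hl]; rfl
    have hb : IsBot (tgt e) := by rw [← gadget_tgt, ht]; trivial
    have h1 : mid e ((gadget n).m - 1) (by omega) ∈ strandSet lv x :=
      ⟨he, Or.inr (by omega), Or.inl hb⟩
    refine (joinedIn_strandSet D h h1).trans ?_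
    have := D.joinedIn_tgt (S := strandSet lv x) (e := e) (k := (gadget n).m - 1) (by omega)
      (by rw [ht]; exact hl) (fun j hj hj0 => by obtain rfl : j = (gadget n).m - 1 := by omega
                                                 exact h1)
    rw [ht] at this
    exact this.symm.mono Set.subset_union_left

/-- A strand is path-connected if its level changes exactly at the cuts, the sets `A i` change only
at the cuts and contain the drawings of the stars around the leaves next to a cut or an end. -/
theorem isPathConnected_strandImg (hn : 1 ≤ n) (h0 : lv 0 = x) {cut : Finset ℕ}
    (hcut : ∀ i ∈ cut, lv (i + 1) = !lv i) (huncut : ∀ i ∉ cut, lv (i + 1) = lv i)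
    (hAeq : ∀ i, i + 1 < 2 ^ n → i ∉ cut → A i = A (i + 1))
    (hA : ∀ i < 2 ^ n, IsPathConnected (A i))
    (hI : ∀ i hi, (i = 0 ∨ i - 1 ∈ cut ∨ i = 2 ^ n - 1 ∨ i ∈ cut) →
      D.img ((gadget n).star n (lev true i hi)) ⊆ A i) :
    IsPathConnected (strandImg D lv x A) := by
  have hm := gadget_m (n := n)
  have hstart : start x ∈ strandEdges (n := n) lv x := rfl
  have hmid : ∀ {e : GadgetEdge n}, e ∈ strandEdges lv x → mid e n (by omega) ∈ strandSet lv x :=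
    fun he => mid_mem_strandSet he _ (by omega) (by omega)
  -- A strand that takes a long edge over a gap from the top level changes level there, so there is
  -- a cut and `A i` contains the drawn star.
  have hgapI : ∀ i hi, ∀ h : i + 1 < 2 ^ n, (lv i && lv (i + 1)) = false → lv i = true →
      D.img ((gadget n).star n (lev true i hi)) ⊆ A i := by
    intro i hi _ h hl
    refine hI i hi (Or.inr (Or.inr (Or.inr ?_)))
    by_contra hc
    rw [huncut i hc, hl] at h
    exact absurd h (by decide)
  have hgapI' : ∀ i, ∀ h : i + 1 < 2 ^ n, (lv i && lv (i + 1)) = false → lv (i + 1) = true →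
      D.img ((gadget n).star n (lev true (i + 1) h)) ⊆ A (i + 1) := by
    intro i hi h hl
    refine hI (i + 1) hi (Or.inr (Or.inl ?_))
    by_contra hc
    rw [Nat.add_sub_cancel] at hc
    rw [← huncut i hc, hl] at h
    exact absurd h (by decide)
  have hgap : ∀ i (h : i + 1 < 2 ^ n) (hl : (lv i && lv (i + 1)) = false),
      gap (lv i) (lv (i + 1)) hl i h ∈ strandEdges lv x := fun i h hl => ⟨rfl, rfl⟩
  have hcol : ∀ i hi, ∀ y ∈ column D lv A i hi,
      JoinedIn (strandImg D lv x A) (D.pt (mid (start x) n (by omega))) y := by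
    intro i
    induction i with
    | zero =>
      intro hi y hy
      exact joinedIn_column_of_tgt D hn hstart (by rw [h0]; rfl) (hA 0 hi)
        (fun _ => hI 0 hi (Or.inl rfl)) (hmid hstart) hy
    | succ i ih =>
      intro hi y hy
      have ih := ih (by omega)
      by_cases hl : (lv i && lv (i + 1)) = false
      · obtain ⟨z, hz⟩ := column_nonempty (lv := lv) D (by omega : i < 2 ^ n) (hA i (by omega))
        have he := hgap i hi hl
        refine (ih z hz).trans ((joinedIn_column_of_src D hn he rfl (hA i (by omega))
          (hgapI i (by omega) hi hl) (hmid he) hz).symm.trans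
          (joinedIn_column_of_tgt D hn he rfl (hA (i + 1) hi) (hgapI' i hi hl) (hmid he) hy))
      -- On the top level on both sides there is no edge to use, but also no cut, so the two columns
      -- share the same set `A i`.
      · have hl' : lv i = true ∧ lv (i + 1) = true := by simpa using hl
        have hic : i ∉ cut := fun h => by
          have := hcut i h
          rw [hl'.1, hl'.2] at this
          exact absurd this (by decide)
        rcases hy with ⟨-, hy⟩ | ⟨h, -⟩
        · exact ih y (Or.inl ⟨hl'.1, by rw [hAeq i hi hic]; exact hy⟩)
        · rw [hl'.2] at h
          exact absurd h (by decide)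
  refine ⟨_, Or.inl (D.pt_mem_img (hmid hstart)), fun {y} hy => ?_⟩
  rcases hy with hy | ⟨i, hi, hl, hy⟩
  · obtain ⟨a, ha, hay⟩ := D.exists_joinedIn hy
    refine JoinedIn.trans ?_ (hay.mono Set.subset_union_left)
    match a, ha with
    | base (bot i hi), ha => exact hcol i hi _ (Or.inr ⟨ha, rfl⟩)
    | mid e k hk, ha =>
      have he := ha.1
      cases e with
      | fr => exact he.elim
      | gap a b hab i hi =>
        obtain ⟨rfl, rfl⟩ := he
        obtain ⟨z, hz⟩ := column_nonempty (lv := lv) D (by omega : i < 2 ^ n) (hA i (by omega))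
        exact (hcol i (by omega) z hz).trans (joinedIn_column_of_src D hn (hgap i hi hab) rfl
          (hA i (by omega)) (hgapI i (by omega) hi hab) ha hz).symm
      | start y =>
        obtain rfl : y = x := he
        exact joinedIn_strandSet D (hmid hstart) ha
      | finish a y =>
        have hN := last_lt n
        obtain ⟨rfl, rfl⟩ := he
        obtain ⟨z, hz⟩ := column_nonempty (lv := lv) D hN (hA _ hN)
        exact (hcol _ hN z hz).trans (joinedIn_column_of_src D hn ha.1 rfl (hA _ hN)
          (fun _ => hI _ hN (Or.inr (Or.inr (Or.inl rfl)))) ha hz).symm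
      | apex y => exact he.elim
  · exact hcol i hi y (Or.inl ⟨hl, hy⟩)

theorem isPathConnected_img_apexSet : IsPathConnected (D.img (apexSet (n := n))) := by
  refine D.isPathConnected_img (a := base root) rfl fun b hb => ?_
  cases b with
  | base b =>
    obtain rfl : b = root := hb
    exact .refl (D.pt_mem_img rfl)
  | mid e k hk =>
    obtain ⟨⟨y, rfl⟩, h⟩ := exists_apex_of_mem_apexSet hb
    exact D.joinedIn_src (e := apex y) hk rfl fun j hj hjk => (by omega : j + n ≤ 4 * n)

end Gadget

/-! ### Routes, levels and the assembly of the fat model. -/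

namespace Gadget

open LongVertex GadgetVertex GadgetEdge

/-- The edges of the complete graph on the frame: the two strands, the pair joined through the root,
and the edges of the frame. -/
inductive Route : Type
  | strand (x : Bool) : Route
  | apex : Route
  | frame (u v : Fin 20) (huv : u < v) (h : ¬ FramePair u v) : Route

/-- The first end of a route. -/
def Route.fst : Route → Fin 20
  | strand x => startFrame x
  | apex => apexFrame true
  | frame u _ _ _ => u

/-- The second end of a route. -/
def Route.snd : Route → Fin 20
  | strand x => finishFrame x
  | apex => apexFrame false
  | frame _ v _ _ => v

theorem exists_route (e : (⊤ : SimpleGraph (Fin 20)).edgeSet) :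
    ∃ ρ : Route, e.1 = s(ρ.fst, ρ.snd) := by
  have key : ∀ u v : Fin 20, u < v → ∃ ρ : Route, s(u, v) = s(ρ.fst, ρ.snd) := by
    intro u v huv
    by_cases h : FramePair u v
    · rcases h with ⟨rfl, rfl⟩ | ⟨rfl, rfl⟩ | ⟨rfl, rfl⟩
      · exact ⟨.strand true, rfl⟩
      · exact ⟨.strand false, rfl⟩
      · exact ⟨.apex, rfl⟩
    · exact ⟨.frame u v huv h, rfl⟩
  obtain ⟨e, he⟩ := e
  induction e with
  | _ u v =>
    have huv : u ≠ v := by simpa using he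
    rcases lt_or_gt_of_ne huv with h | h
    · exact key u v h
    · obtain ⟨ρ, hρ⟩ := key v u h
      exact ⟨ρ, Sym2.eq_swap.trans hρ⟩

variable {n : ℕ} {X : Type*} [EMetricSpace X]

/-- A fat model of the complete graph, from a set for each route. -/
theorem hasFatMinor_of_routes {K : ℝ} (B : Fin 20 → Set X) (P : Route → Set X)
    (hB : ∀ u, IsPathConnected (B u)) (hP : ∀ ρ, IsPathConnected (P ρ))
    (hfst : ∀ ρ : Route, (B ρ.fst ∩ P ρ).Nonempty) (hsnd : ∀ ρ : Route, (B ρ.snd ∩ P ρ).Nonempty)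
    (hBB : ∀ u v, u ≠ v → ENNReal.ofReal K ≤ setDist (B u) (B v))
    (hBP : ∀ u, ∀ ρ : Route, u ≠ ρ.fst → u ≠ ρ.snd → ENNReal.ofReal K ≤ setDist (B u) (P ρ))
    (hPP : ∀ ρ ρ', ρ ≠ ρ' → ENNReal.ofReal K ≤ setDist (P ρ) (P ρ')) :
    HasFatMinor (⊤ : SimpleGraph (Fin 20)) K X := by
  choose ρ hρ using exists_route
  refine ⟨⟨B, fun e => P (ρ e), hB, fun e => hP _, fun v e hv => ?_, hBB, fun e f hef => ?_,
    fun v e hv => ?_⟩⟩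
  · rw [hρ, Sym2.mem_iff] at hv
    rcases hv with rfl | rfl
    · exact hfst _
    · exact hsnd _
  · refine hPP _ _ fun h => hef (Subtype.ext ?_)
    rw [hρ e, hρ f, h]
  · rw [hρ, Sym2.mem_iff, not_or] at hv
    exact hBP v _ hv.1 hv.2

/-- The level of the strand of colour `x` in column `i`: it starts at the level `x` and changes at
the cuts. -/
def level (cut : Finset ℕ) (x : Bool) (i : ℕ) : Bool := x ^^ (cutsBelow cut i).bodd

theorem level_zero (cut : Finset ℕ) (x : Bool) : level cut x 0 = x := by
  simp [level, cutsBelow_zero]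

theorem level_succ_of_mem {cut : Finset ℕ} {x : Bool} {i : ℕ} (h : i ∈ cut) :
    level cut x (i + 1) = !level cut x i := by
  simp [level, cutsBelow_succ_of_mem h]

theorem level_succ_of_not_mem {cut : Finset ℕ} {x : Bool} {i : ℕ} (h : i ∉ cut) :
    level cut x (i + 1) = level cut x i := by
  rw [level, cutsBelow_eq_of_forall (Nat.le_succ i)]
  · rfl
  · intro g h1 h2
    obtain rfl : g = i := by omega
    exact h

theorem level_not (cut : Finset ℕ) (x : Bool) : level cut (!x) = fun i => !level cut x i := by
  ext i
  simp [level]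

/-- The stars around the leaves of the columns in which the level is the top one. -/
def topSet (lv : ℕ → Bool) : Set (LongVertex (GadgetVertex n) (GadgetEdge n) (gadget n).m) :=
  {v | ∃ j hj, lv j = true ∧ v ∈ (gadget n).star n (lev true j hj)}

/-- A space with a drawing of the gadget that keeps far vertices apart has a fat minor isomorphic to
the complete graph on twenty vertices. -/
theorem hasFatMinor_of_drawing {q : ℕ} (hq : 1 ≤ q) (hn : 1 ≤ n)
    (D : Drawing (gadget n).graph X (3 * q))
    (hD : ∀ a b, (n : ℕ∞) ≤ (gadget n).graph.edist a b →
      (12 * q : ℝ≥0∞) ≤ edist (D.pt a) (D.pt b))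
    {K : ℝ} (hK : ENNReal.ofReal K ≤ 1) (hNK : ((2 ^ n : ℕ) : ℝ≥0∞) * ENNReal.ofReal K ≤ 1) :
    HasFatMinor (⊤ : SimpleGraph (Fin 20)) K X := by
  have hm := gadget_m (n := n)
  set ε := ENNReal.ofReal K
  have hfar : ∀ {Y Y' : Set X} {S S'}, D.Near (3 * q + 1) Y S → D.Near (3 * q + 1) Y' S' →
      (gadget n).graph.Far n S S' → ε ≤ setDist Y Y' := fun hY hY' h =>
    hK.trans (D.one_le_setDist hq hD hY hY' h)
  have himg : ∀ S, D.Near (3 * q + 1) (D.img S) S := fun S =>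
    (D.near_img S).mono le_self_add subset_rfl
  -- The sequence consists of the drawn stars of the leaves and is continued by empty sets beyond
  -- the last column.
  obtain ⟨cut, A, hAeq, hA, hI, hAA, hAn⟩ := exists_runs (2 ^ n)
    (fun i => {y | ∃ hi, y ∈ D.img ((gadget n).star n (lev true i hi))})
    (fun i hi => by simpa [hi] using D.isPathConnected_img_star (n := n) (lev true i hi)) ε
  let M : Bool → Set X := fun x => strandImg D (level cut x) x A
  let T : Bool → Set X := fun x => {y | ∃ i < 2 ^ n, level cut x i = true ∧ y ∈ A i}
  -- A point of `A i` is within $2^n\varepsilon \le 1$ of a drawn star of the same run, whose column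
  -- has the same level because the level depends only on the number of cuts passed.
  have hT : ∀ x, D.Near (3 * q + 1) (T x) (topSet (level cut x)) := by
    rintro x y ⟨i, hi, hl, hy⟩
    obtain ⟨j, hj, hji, z, ⟨hj', hz⟩, hyz⟩ := hAn i hi y hy
    obtain ⟨a, ha, hza⟩ := D.near_img _ z hz
    refine ⟨a, ⟨j, hj, by rwa [level, hji], ha⟩, ?_⟩
    calc edist y (D.pt a) ≤ edist y z + edist z (D.pt a) := edist_triangle _ _ _
      _ ≤ 1 + 3 * q := add_le_add (hyz.trans hNK) hza
      _ = 3 * q + 1 := add_comm _ _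
  have hfarM : ∀ {x Y S}, D.Near (3 * q + 1) Y S →
      (gadget n).graph.Far n (strandSet (level cut x) x) S →
      (∀ j hj, level cut x j = true →
        (gadget n).graph.Far n ((gadget n).star n (lev true j hj)) S) → ε ≤ setDist (M x) Y := by
    intro x Y S hY h1 h2
    refine le_setDist_union (hfar (himg _) hY h1) (hfar (hT x) hY ?_)
    rintro a ⟨j, hj, hl, ha⟩ b hb
    exact h2 j hj hl a ha b hb
  -- Each strand has a drawn part and a top part. Three of the four distances come from the drawing;
  -- between the two top parts only the bound `ε` from the runs is available.
  have hMM : ∀ x, ε ≤ setDist (M x) (M !x) := by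
    intro x
    have hz := fun x => level_zero cut x
    have key : ∀ x, ε ≤ setDist (T x) (D.img (strandSet (level cut !x) !x)) := by
      intro x
      refine hfar (hT x) (himg _) ?_
      rintro a ⟨j, hj, hl, ha⟩ b hb
      refine (far_strandSet_star_leaf (hz !x) ?_).symm a ha b hb
      simp [level_not, hl]
    refine le_setDist_union ?_ ?_ <;> rw [setDist_comm] <;> refine le_setDist_union ?_ ?_
    · rw [setDist_comm]
      refine hfar (himg _) (himg _) ?_
      have := far_strandSet_strandSet (n := n) (hz x)
      rwa [← level_not] at this
    · have := key !x
      rwa [Bool.not_not] at this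
    · rw [setDist_comm]
      exact key x
    · refine le_iInf₂ fun y hy => le_iInf₂ fun z hz => le_iInf fun γ => ?_
      obtain ⟨i, hi, hil, hy⟩ := hy
      obtain ⟨j, hj, hjl, hz⟩ := hz
      refine le_trans ?_ (setDist_le hy hz γ)
      -- Opposite levels mean different parities of the number of cuts, hence different runs.
      have hne : cutsBelow cut i ≠ cutsBelow cut j := by
        intro h
        rw [level, h] at hil
        rw [level] at hjl
        cases x <;> simp_all
      rcases lt_trichotomy i j with h | rfl | h
      · exact hAA i j h hj hne
      · exact absurd rfl hne
      · rw [setDist_comm]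
        exact hAA j i h hi hne.symm
  refine hasFatMinor_of_routes (fun u => D.img ((gadget n).star n (frame u)))
    (fun
      | .strand x => M x
      | .apex => D.img apexSet
      | .frame u v huv h => D.img ((gadget n).middle n (fr u v huv h)))
    (fun u => D.isPathConnected_img_star _) ?_ ?_ ?_ ?_ ?_ ?_
  · rintro (x | _ | ⟨u, v, huv, h⟩)
    · exact isPathConnected_strandImg D hn (level_zero cut x) (fun i hi => level_succ_of_mem hi)
        (fun i hi => level_succ_of_not_mem hi) hAeq hA fun i hi h y hy => hI i hi h ⟨hi, hy⟩
    · exact isPathConnected_img_apexSet D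
    · exact D.isPathConnected_img_middle hm hn _
  -- The subdividing vertices `n - 1` and `3 * n` of a long edge lie both in the star at the nearer
  -- end and in the middle piece, so they witness the incidences here and in the next case.
  · rintro (x | _ | ⟨u, v, huv, h⟩)
    · have he : start x ∈ strandEdges (n := n) (level cut x) x := rfl
      exact ⟨D.pt (mid (start x) (n - 1) (by omega)),
        D.pt_mem_img (Or.inl ⟨rfl, by omega⟩),
        Or.inl (D.pt_mem_img (mid_mem_strandSet he _ (by omega) (by omega)))⟩
    · exact ⟨D.pt (mid (apex true) (3 * n) (by omega)), D.pt_mem_img (Or.inr ⟨rfl, by omega⟩),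
        D.pt_mem_img (by change 3 * n + n ≤ 4 * n; omega)⟩
    · exact ⟨D.pt (mid (fr u v huv h) (n - 1) (by omega)), D.pt_mem_img (Or.inl ⟨rfl, by omega⟩),
        D.pt_mem_img ⟨rfl, by omega, by omega⟩⟩
  · rintro (x | _ | ⟨u, v, huv, h⟩)
    · have he : finish (level cut x (2 ^ n - 1)) x ∈ strandEdges (n := n) (level cut x) x :=
        ⟨rfl, rfl⟩
      exact ⟨D.pt (mid (finish (level cut x (2 ^ n - 1)) x) (3 * n) (by omega)),
        D.pt_mem_img (Or.inr ⟨rfl, by omega⟩),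
        Or.inl (D.pt_mem_img (mid_mem_strandSet he _ (by omega) (by omega)))⟩
    · exact ⟨D.pt (mid (apex false) (3 * n) (by omega)), D.pt_mem_img (Or.inr ⟨rfl, by omega⟩),
        D.pt_mem_img (by change 3 * n + n ≤ 4 * n; omega)⟩
    · exact ⟨D.pt (mid (fr u v huv h) (3 * n) (by omega)), D.pt_mem_img (Or.inr ⟨rfl, by omega⟩),
        D.pt_mem_img ⟨rfl, by omega, by omega⟩⟩
  · intro u v huv
    exact hfar (himg _) (himg _) ((gadget n).far_star_star hm (by simpa using huv)
      fun x y hxy => tree_frame hxy u)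
  · rintro w (x | _ | ⟨u, v, huv, h⟩) h1 h2
    · rw [setDist_comm]
      exact hfarM (himg _) (far_strandSet_star_frame (level_zero cut x) h1 h2)
        fun j hj _ => far_star_leaf_star_frame w
    · exact hfar (himg _) (himg _) (far_apexSet_star_frame h1 h2).symm
    · exact hfar (himg _) (himg _) ((gadget n).far_middle hm
        ((gadget n).mid_not_mem_star (e := fr u v huv h) (by simpa [src, Route.fst] using Ne.symm h1)
          (by simpa [tgt, Route.snd] using Ne.symm h2))).symm
  · have hMa : ∀ x, ε ≤ setDist (M x) (D.img apexSet) := fun x =>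
      hfarM (himg _) (far_strandSet_apexSet (level_zero cut x))
        fun j hj _ => far_star_leaf_apexSet hn
    have hMf : ∀ x u v huv h, ε ≤ setDist (M x) (D.img ((gadget n).middle n (fr u v huv h))) :=
      fun x u v huv h => hfarM (himg _)
        ((gadget n).far_middle hm fun k hk => mid_fr_not_mem_strandSet k hk).symm
        fun j hj _ => ((gadget n).far_middle hm fun k hk => mid_fr_not_mem_star_leaf k hk).symm
    have haf : ∀ u v huv h, ε ≤ setDist (D.img apexSet)
        (D.img ((gadget n).middle n (fr u v huv h))) := fun u v huv h =>
      hfar (himg _) (himg _) ((gadget n).far_middle hm fun k hk => mid_fr_not_mem_apexSet k hk).symm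
    rintro (x | _ | ⟨u, v, huv, h⟩) (x' | _ | ⟨u', v', huv', h'⟩) hne
    · obtain rfl : x' = !x := by
        rw [Bool.eq_not]
        rintro rfl
        exact hne rfl
      exact hMM x
    · exact hMa x
    · exact hMf x _ _ _ _
    · rw [setDist_comm]; exact hMa x'
    · exact absurd rfl hne
    · exact haf _ _ _ _
    · rw [setDist_comm]; exact hMf x' _ _ _ _
    · rw [setDist_comm]; exact haf _ _ _ _
    · refine hfar (himg _) (himg _) ((gadget n).far_middle hm ?_)
      rintro k hk ⟨he, -⟩
      obtain ⟨rfl, rfl⟩ : u = u' ∧ v = v' := by simpa using he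
      exact hne rfl

end Gadget

theorem theorem2 :
    ∃ (W : Type) (_ : Finite W) (H : SimpleGraph W), ∀ q : ℕ, 1 ≤ q →
      ∃ (V : Type) (G : SimpleGraph V), ¬ HasFatMinor H 3 (GraphSpace G) ∧
        ∀ (X : Type*) [EMetricSpace X], IsLengthSpace X →
          ¬ HasFatMinor H ((2 : ℝ) ^ (-(13 * (q : ℤ) ^ 2))) X →
            ¬ QuasiIsometric q (GraphSpace G) X := by
  refine ⟨Fin 20, inferInstance, ⊤, fun q hq => ?_⟩
  have hn : 1 ≤ 13 * q ^ 2 := by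
    have : 1 ≤ q ^ 2 := Nat.one_le_pow _ _ hq
    omega
  -- The tree height is the distance beyond which the drawing keeps vertices apart; it gives
  -- $2^{13q^2}$ leaves and hence the fatness $2^{-13q^2}$.
  refine ⟨_, (Gadget.gadget (13 * q ^ 2)).graph, Gadget.not_hasFatMinor hn, ?_⟩
  rintro X _ hX hH ⟨φ, hφ⟩
  obtain ⟨D, hD⟩ := hφ.exists_drawing hX hq
  have hK : (2 : ℝ) ^ (-(13 * (q : ℤ) ^ 2)) = (2 ^ (13 * q ^ 2))⁻¹ := by
    rw [zpow_neg, ← zpow_natCast]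
    push_cast
    rfl
  have hpos : (0 : ℝ) < 2 ^ (13 * q ^ 2) := by positivity
  refine hH (Gadget.hasFatMinor_of_drawing hq hn D hD ?_ ?_)
  · rw [hK, ENNReal.ofReal_le_one]
    exact inv_le_one_of_one_le₀ (one_le_pow₀ one_le_two)
  · rw [hK, ENNReal.ofReal_inv_of_pos hpos, ENNReal.ofReal_pow zero_le_two]
    simp only [ENNReal.ofReal_ofNat, Nat.cast_pow, Nat.cast_ofNat]
    exact ENNReal.mul_inv_le_one _
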